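/- Let $\mathcal A$ and $\mathcal B$ be unital $C^*$-algebras, and let $CP(\mathcal A,\mathcal B)$ be the set of nonzero completely positive maps $\mathcal A\to\mathcal B$. A Hilbert $\mathcal A$-$\mathcal B$-module is a (right) Hilbert $\mathcal B$-module $E$, with $\mathcal B$-valued inner product linear in the second variable, together with a unital $*$-representation of $\mathcal A$ by adjointable operators on $E$. For a completely positive map $\varphi:\mathcal A\to\mathcal B$ put $S(E,\varphi)=\{x\in E:\ \varphi(a)=\langle x,ax\rangle\ \text{for all } a\in\mathcal A\}$. The module $E$ is a common representation module for $\varphi_1,\varphi_2$ if $S(E,\varphi_1)$ and $S(E,\varphi_2)$ are both nonempty; in that case $\beta_E(\varphi_1,\varphi_2)=\inf\{\|x_1-x_2\|:\ x_i\in S(E,\varphi_i)\}$. The Bures distance is $\beta(\varphi_1,\varphi_2)=\inf_E\beta_E(\varphi_1,\varphi_2)$, the infimum being over all common representation modules $E$. Suppose $\mathcal B$ is injective: for every unital $C^*$-algebra $\mathcal C$ and every operator system (self-adjoint subspace containing $1$) $\mathcal S\subseteq\mathcal C$, each completely positive contraction $\mathcal S\to\mathcal B$ extends to a completely positive contraction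 $\mathcal C\to\mathcal B$. Then: 1. For every faithful representation (injective $*$-homomorphism) $\pi:\mathcal B\to B(G)$ on a Hilbert space $G$ and all $\varphi_1,\varphi_2\in CP(\mathcal A,\mathcal B)$, $\beta(\varphi_1,\varphi_2)=\beta(\pi\circ\varphi_1,\pi\circ\varphi_2)$. 2. $\beta$ is a metric on $CP(\mathcal A,\mathcal B)$. 3. For all $\varphi_1,\varphi_2\in CP(\mathcal A,\mathcal B)$, the maps $\varphi_1$, $\varphi_2$ and $\varphi_1-\varphi_2$ are completely bounded and $$\frac{\|\varphi_1-\varphi_2\|_{cb}}{\sqrt{\|\varphi_1\|_{cb}}+\sqrt{\|\varphi_2\|_{cb}}}\le\beta(\varphi_1,\varphi_2)\le\sqrt{\|\varphi_1-\varphi_2\|_{cb}}.$$ 4. For all $\varphi_1,\varphi_2\in CP(\mathcal A,\mathcal B)$ there exist a common representation module $E$ and $x_i\in S(E,\varphi_i)$, $i=1,2$, such that $\beta(\varphi_1,\varphi_2)=\beta_E(\varphi_1,\varphi_2)=\|x_1-x_2\|$. -/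

import Mathlib

open scoped CStarAlgebra

universe u v w

/-! ### Operator systems and injective C*-algebras -/

/-- An operator system in a unital C*-algebra `C`: a self-adjoint linear subspace containing `1`. -/
structure IsOperatorSystem {C : Type v} [CStarAlgebra C] (S : Submodule ℂ C) : Prop where
  one_mem : (1 : C) ∈ S
  star_mem : ∀ x ∈ S, star x ∈ S

/-- Complete positivity of a linear map `φ : S → B` on a subspace `S` of `C`: for every `n`, a
matrix in `Mₙ(S)` that is positive in `Mₙ(C)` is sent entrywise to a positive matrix in `Mₙ(B)`. -/
def IsCompletelyPositiveOn {C : Type v} [CStarAlgebra C] [PartialOrder C]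
    [StarOrderedRing C] {B : Type w} [CStarAlgebra B] [PartialOrder B] [StarOrderedRing B]
    {S : Submodule ℂ C} (φ : S →ₗ[ℂ] B) : Prop :=
  ∀ (n : ℕ) (M : Matrix (Fin n) (Fin n) S),
    0 ≤ (CStarMatrix.ofMatrix (M.map fun s => (s : C)) : CStarMatrix (Fin n) (Fin n) C) →
    0 ≤ (CStarMatrix.ofMatrix (M.map φ) : CStarMatrix (Fin n) (Fin n) B)

/-- A unital C*-algebra `B` is injective if every completely positive contraction from an operator
system `S ⊆ C` into `B` extends to a completely positive contraction `C → B`. -/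
def IsInjectiveCStarAlgebra (B : Type v) [CStarAlgebra B] [PartialOrder B]
    [StarOrderedRing B] : Prop :=
  ∀ (C : Type v) [CStarAlgebra C] [PartialOrder C] [StarOrderedRing C] (S : Submodule ℂ C),
    IsOperatorSystem S → ∀ φ : S →ₗ[ℂ] B, IsCompletelyPositiveOn φ → (∀ s, ‖φ s‖ ≤ ‖s‖) →
      ∃ ψ : C →CP B, (∀ c, ‖ψ c‖ ≤ ‖c‖) ∧ ∀ s : S, ψ s = φ s

/-! ### Hilbert bimodules -/

/-- A Hilbert `A`-`B`-module `E`. A right `B`-module is a `Bᵐᵒᵖ`-module, and Mathlib's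
`CStarModule Bᵐᵒᵖ E` (whose inner product takes values in `Bᵐᵒᵖ` and satisfies
`⟪x, op b • y⟫ = op b * ⟪x, y⟫`) is precisely the structure of a right inner product `B`-module; see
`HilbertBimodule.ip` for the `B`-valued inner product. Together with completeness this makes `E` a
Hilbert `B`-module. `A` acts unitally by adjointable operators, the adjoint of the action of `a`
being the action of `star a`: this is a nondegenerate representation of `A` on `E`
(such operators are automatically bounded and commute with the right action of `B`). -/
structure HilbertBimodule (A : Type u) (B : Type v) [CStarAlgebra A] [CStarAlgebra B]
    [PartialOrder B] where
  carrier : Type w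
  [normedAddCommGroup : NormedAddCommGroup carrier]
  [normedSpace : NormedSpace ℂ carrier]
  [completeSpace : CompleteSpace carrier]
  [rightModule : Module Bᵐᵒᵖ carrier]
  [cstarModule : CStarModule Bᵐᵒᵖ carrier]
  [leftModule : Module A carrier]
  [isScalarTower : IsScalarTower ℂ A carrier]
  inner_smul_left : ∀ (a : A) (x y : carrier),
    inner Bᵐᵒᵖ (a • x) y = inner Bᵐᵒᵖ x (star a • y)

namespace HilbertBimodule

variable {A : Type u} {B : Type v} [CStarAlgebra A] [CStarAlgebra B] [PartialOrder B]

instance : CoeSort (HilbertBimodule.{u, v, w} A B) (Type w) := ⟨carrier⟩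

attribute [instance] normedAddCommGroup normedSpace completeSpace rightModule cstarModule
  leftModule isScalarTower

variable (E : HilbertBimodule.{u, v, w} A B)

/-- The `B`-valued inner product of `E`, linear in the second variable. -/
def ip (x y : E) : B := (inner Bᵐᵒᵖ x y).unop

/-- It is `B`-linear for the right action `y b = op b • y`. -/
theorem ip_op_smul_right (x y : E) (b : B) : E.ip x (MulOpposite.op b • y) = E.ip x y * b := by
  simp [ip]

theorem star_ip (x y : E) : star (E.ip x y) = E.ip y x := by
  simp only [ip, ← MulOpposite.unop_star, CStarModule.star_inner]

theorem norm_eq_sqrt (x : E) : ‖x‖ = √‖E.ip x x‖ :=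
  CStarModule.norm_eq_sqrt_norm_inner_self (A := Bᵐᵒᵖ) x

end HilbertBimodule

/-! ### Completely positive maps and the Bures distance -/

section Bures

variable {A : Type u} [CStarAlgebra A] [PartialOrder A] [StarOrderedRing A]
  {B : Type v} [CStarAlgebra B] [PartialOrder B] [StarOrderedRing B]

variable (A B) in
/-- The set `CP(A, B)` of nonzero completely positive maps from `A` to `B`. -/
def NonzeroCP : Type (max u v) := {φ : A →CP B // φ.toLinearMap ≠ 0}

/-- The completely positive map `π ∘ φ`, for a `*`-homomorphism `π`. -/
noncomputable def starHomComp {C : Type w} [CStarAlgebra C] [PartialOrder C] [StarOrderedRing C]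
    (π : B →⋆ₙₐ[ℂ] C) (φ : A →CP B) : A →CP C where
  toFun a := π (φ a)
  map_add' x y := by simp
  map_smul' c x := by simp
  map_cstarMatrix_nonneg' k M hM :=
    CompletelyPositiveMapClass.map_cstarMatrix_nonneg' π k (M.map φ)
      (CompletelyPositiveMapClass.map_cstarMatrix_nonneg' φ k M hM)

/-- `S(E, φ)`: the set of all `x ∈ E` with `φ(a) = ⟨x, a x⟩` for all `a`; equivalently, `(E, x)` is
a GNS-construction for `φ`. -/
def representingSet (E : HilbertBimodule.{u, v, w} A B) (φ : A →CP B) : Set E :=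
  {x | ∀ a : A, φ a = E.ip x (a • x)}

/-- `E` is a common representation module for `φ₁` and `φ₂`. -/
def IsCommonRepresentationModule (E : HilbertBimodule.{u, v, w} A B) (φ₁ φ₂ : A →CP B) : Prop :=
  (representingSet E φ₁).Nonempty ∧ (representingSet E φ₂).Nonempty

/-- `β_E(φ₁, φ₂) = inf ‖x₁ - x₂‖` over `xᵢ ∈ S(E, φᵢ)`. -/
noncomputable def buresIn (E : HilbertBimodule.{u, v, w} A B) (φ₁ φ₂ : A →CP B) : ℝ :=
  sInf {r | ∃ x₁ ∈ representingSet E φ₁, ∃ x₂ ∈ representingSet E φ₂, r = ‖x₁ - x₂‖}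

/-- The Bures distance `β(φ₁, φ₂) = inf β_E(φ₁, φ₂)` over all common representation modules `E`.
Restricting the underlying sets of the modules to the universe `max u v` loses nothing: the closed
sub-bimodule generated by two vectors `x₁, x₂` has a copy in this universe. -/
noncomputable def bures (φ₁ φ₂ : A →CP B) : ℝ :=
  sInf {r | ∃ E : HilbertBimodule.{u, v, max u v} A B,
    IsCommonRepresentationModule E φ₁ φ₂ ∧ r = buresIn E φ₁ φ₂}

end Bures

section CompletelyBounded

variable {A : Type u} [CStarAlgebra A] [PartialOrder A] [StarOrderedRing A]
  {B : Type v} [CStarAlgebra B] [PartialOrder B] [StarOrderedRing B]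

/-- `φ` is completely bounded: its entrywise amplifications `Mₙ(A) → Mₙ(B)` are uniformly
bounded. -/
def IsCompletelyBounded (φ : A →ₗ[ℂ] B) : Prop :=
  ∃ K : ℝ, ∀ (n : ℕ) (M : CStarMatrix (Fin n) (Fin n) A), ‖M.map φ‖ ≤ K * ‖M‖

/-- The completely bounded norm `‖φ‖_cb = supₙ ‖φₙ‖`, where `φₙ : Mₙ(A) → Mₙ(B)` applies `φ`
entrywise (meaningful when `φ` is completely bounded). -/
noncomputable def cbNorm (φ : A →ₗ[ℂ] B) : ℝ :=
  sSup {r | ∃ (n : ℕ) (M : CStarMatrix (Fin n) (Fin n) A), ‖M‖ ≤ 1 ∧ r = ‖M.map φ‖}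

end CompletelyBounded

/-! The Bures distance is governed by 2×2 matrices of maps. Vectors `x₀, x₁` in a Hilbert bimodule
give the kernel `Φᵢⱼ(a) = ⟨xᵢ, a xⱼ⟩`, which is completely positive, has `φ₁, φ₂` on the diagonal,
and satisfies `‖x₀ - x₁‖² = ‖Φ₀₀(1) - Φ₀₁(1) - Φ₁₀(1) + Φ₁₁(1)‖`, the norm of `kernelDefect Φ`.
Conversely, a Stinespring decomposition `π(Φᵢⱼ(a)) = Vᵢ* σ(a) Vⱼ` over a faithful `π` realizes every
such kernel in a bimodule, namely the closed span of the operators `σ(a) Vᵢ π(b)`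
(`IsPositiveKernel.exists_bimodule`). Hence the distance is the infimum of `√‖kernelDefect Φ‖` over
all correlations `Φ` of `φ₁, φ₂`.

Injectivity provides a completely positive contraction `P : B(G) → B` with `P ∘ π = id`
(`exists_retraction`). Composing with `P` or with `π` carries correlations across without increasing
the defect. This proves the first claim and reduces the others to `B(G)`, where the following
arguments are available.

Triangle inequality: two correlations that share the entry `φ₂` are glued along the minimal
Stinespring space of `φ₂` (`IsCorrelation.trans`). Attainment: bounded families of operators have
weak operator limits, and positivity and the defect bound pass to the limit
(`exists_isCorrelation_of_tendsto`). At distance zero the optimal vectors coincide, so the maps do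
as well.

Lower bound: `φ₁ - φ₂ = V₀* σ(·) (V₀ - V₁) + (V₀ - V₁)* σ(·) V₁`, together with `‖V₀ - V₁‖² =
‖kernelDefect Φ‖` and `‖Vᵢ‖² = ‖Φᵢᵢ(1)‖` (`IsCorrelation.cb_estimates`).

Upper bound, with `c = ‖φ₁ - φ₂‖_cb`: compressed to a finite-dimensional subspace of `G`, a
correlation is a positive functional `Λ` on `M₂(Mₙ(A))` with prescribed values on block diagonal
matrices. Defect at most `c` means `Λ [[β, -β], [-β, β]] ≤ c tr β` for scalar `β ≥ 0`. Such a `Λ`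
comes from the Riesz extension theorem (`exists_positive_extension`). Its hypothesis is verified by
an interpolation: if `diag(x₀, x₁) + [[b, -b], [-b, b]] ≥ 0` with `b = γ*γ` invertible, some
self-adjoint contraction `k` satisfies `x₀ ≥ γ*kγ ≥ -x₁` (`exists_contraction_of_forall_nonneg`). A
limit over finite-dimensional subspaces gives the correlation on `G`. -/

section

open scoped ComplexOrder InnerProductSpace

/-! ### Order and norm in C*-algebras. -/

namespace CStarAlgebra

variable {A : Type*} [CStarAlgebra A]

/-- Equality fails in the zero algebra, which is allowed here. -/
theorem norm_one_le : ‖(1 : A)‖ ≤ 1 := by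
  have h := CStarRing.norm_star_mul_self (x := (1 : A))
  rw [star_one, mul_one] at h
  nlinarith [norm_nonneg (1 : A)]

variable [PartialOrder A] [StarOrderedRing A]

theorem exists_eq_star_mul_self {a : A} (ha : 0 ≤ a) : ∃ b, a = star b * b :=
  nonneg_iff_eq_star_mul_self.mp ha

/-- The negative part of a self-adjoint element detects positivity. -/
theorem exists_negPart {a : A} (ha : IsSelfAdjoint a) :
    ∃ d : A, 0 ≤ star d * d * d ∧ star d * a * d = -(star d * d * d) ∧
      (star d * d * d = 0 → 0 ≤ a) := by
  have hd : 0 ≤ a⁻ := CFC.negPart_nonneg a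
  refine ⟨a⁻, ?_, ?_, fun h => ?_⟩
  · simpa [hd.isSelfAdjoint.star_eq] using star_left_conjugate_nonneg hd a⁻
  · have : a * a⁻ = -(a⁻ * a⁻) := by
      have h : (a⁺ - a⁻) * a⁻ = -(a⁻ * a⁻) := by rw [sub_mul, CFC.posPart_mul_negPart, zero_sub]
      rwa [CFC.posPart_sub_negPart a ha] at h
    rw [mul_assoc, this, mul_neg, mul_assoc]
  -- The fourth power of `a⁻` vanishes with its cube, and the C*-identity used twice gives `a⁻ = 0`.
  · have h2 : star (star a⁻ * a⁻) * (star a⁻ * a⁻) = 0 := by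
      have : star (star a⁻ * a⁻) * (star a⁻ * a⁻) = a⁻ * (star a⁻ * a⁻ * a⁻) := by
        simp only [star_mul, hd.isSelfAdjoint.star_eq, mul_assoc]
      rw [this, h, mul_zero]
    have h3 : a⁻ = 0 := CStarRing.star_mul_self_eq_zero_iff _ |>.mp
      (CStarRing.star_mul_self_eq_zero_iff _ |>.mp h2)
    rw [← CFC.posPart_sub_negPart a ha, h3, sub_zero]
    exact CFC.posPart_nonneg a

theorem smul_one_sub_star_mul_self_nonneg (a : A) :
    0 ≤ ((‖a‖ ^ 2 : ℝ) : ℂ) • (1 : A) - star a * a := by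
  rw [sub_nonneg, sq, ← CStarRing.norm_star_mul_self, Complex.coe_smul,
    ← Algebra.algebraMap_eq_smul_one]
  exact IsSelfAdjoint.le_algebraMap_norm_self (.star_mul_self a)

theorem norm_le_of_nonneg_smul_one_sub {a : A} {C : ℝ} (hC : 0 ≤ C)
    (h : 0 ≤ ((C ^ 2 : ℝ) : ℂ) • (1 : A) - star a * a) : ‖a‖ ≤ C := by
  rw [sub_nonneg, Complex.coe_smul, ← Algebra.algebraMap_eq_smul_one,
    ← norm_le_iff_le_algebraMap _ (sq_nonneg C) (star_mul_self_nonneg a),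
    CStarRing.norm_star_mul_self, ← sq] at h
  exact (sq_le_sq₀ (norm_nonneg _) hC).mp h

end CStarAlgebra

/-! ### Positivity of matrices over a C*-algebra through quadratic forms. -/

namespace CStarMatrix

section

variable {n : Type*} [Fintype n] {B : Type*} [CStarAlgebra B]

theorem sum_star_mul_mul (M N : CStarMatrix n n B) (b : n → B) :
    ∑ k, ∑ l, star (b k) * (star M * N) k l * b l =
      ∑ p, star (∑ k, M p k * b k) * ∑ l, N p l * b l := by
  simp only [mul_apply, star_apply, Finset.mul_sum, Finset.sum_mul, star_sum, star_mul]
  rw [Finset.sum_comm_cycle]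
  refine Finset.sum_congr rfl fun k _ => ?_
  rw [Finset.sum_comm]
  exact Finset.sum_congr rfl fun p _ => Finset.sum_congr rfl fun l _ => by simp only [mul_assoc]

/-- Polarization: the symmetrized form vanishes, and putting `i c` for `c` makes the antisymmetrized
one vanish too. Applied to `M* - M`, it yields self-adjointness of a matrix with positive form. -/
theorem eq_zero_of_forall_sum_eq_zero [DecidableEq n] {M : CStarMatrix n n B}
    (h : ∀ b : n → B, ∑ k, ∑ l, star (b k) * M k l * b l = 0) : M = 0 := by
  let S : (n → B) → (n → B) → B := fun b c => ∑ k, ∑ l, star (b k) * M k l * c l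
  have hadd : ∀ b c, S b c + S c b = 0 := fun b c => by
    have h1 : S (b + c) (b + c) = S b b + S b c + S c b + S c c := by
      simp only [S, Pi.add_apply, star_add, add_mul, mul_add, Finset.sum_add_distrib]; abel
    have h2 : ∀ x, S x x = 0 := h
    rw [h2, h2, h2] at h1
    simpa using h1.symm
  have hl : ∀ b c, S b (Complex.I • c) = Complex.I • S b c := fun b c => by
    simp only [S, Pi.smul_apply, mul_smul_comm, Finset.smul_sum]
  have hr : ∀ b c, S (Complex.I • c) b = -(Complex.I • S c b) := fun b c => by
    simp only [S, Pi.smul_apply, star_smul, smul_mul_assoc, ← Finset.smul_sum, ← neg_smul]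
    simp
  have h0 : ∀ b c, S b c = 0 := fun b c => by
    have h1 := hadd b (Complex.I • c)
    rw [hl, hr, ← sub_eq_add_neg, ← smul_sub, smul_eq_zero] at h1
    have h2 := sub_eq_zero.mp (h1.resolve_left Complex.I_ne_zero)
    have h3 := hadd b c
    rw [← h2, ← two_smul ℂ, smul_eq_zero] at h3
    exact h3.resolve_left two_ne_zero
  ext k l
  simpa [S, Pi.single_apply, apply_ite star, ite_mul] using h0 (Pi.single k 1) (Pi.single l 1)

end

variable {n : Type*} [Fintype n] [DecidableEq n] {B : Type*} [CStarAlgebra B] [PartialOrder B]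
  [StarOrderedRing B]

/-- The quadratic form of a positive matrix is positive. -/
theorem sum_star_mul_mul_nonneg {M : CStarMatrix n n B} (hM : 0 ≤ M) (b : n → B) :
    0 ≤ ∑ k, ∑ l, star (b k) * M k l * b l := by
  obtain ⟨R, rfl⟩ := CStarAlgebra.exists_eq_star_mul_self hM
  rw [sum_star_mul_mul]
  exact Finset.sum_nonneg fun p _ => star_mul_self_nonneg _

/-- A matrix whose quadratic form is positive is positive. -/
theorem nonneg_of_forall_sum_nonneg {M : CStarMatrix n n B}
    (h : ∀ b : n → B, 0 ≤ ∑ k, ∑ l, star (b k) * M k l * b l) : 0 ≤ M := by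
  have hM : IsSelfAdjoint M := by
    rw [IsSelfAdjoint, ← sub_eq_zero]
    refine eq_zero_of_forall_sum_eq_zero fun b => ?_
    have h1 : ∑ k, ∑ l, star (b k) * (star M) k l * b l =
        star (∑ k, ∑ l, star (b k) * M k l * b l) := by
      simp only [star_sum, star_mul, star_star, star_apply]
      rw [Finset.sum_comm]
      simp only [mul_assoc]
    simp only [sub_apply, mul_sub, sub_mul, Finset.sum_sub_distrib]
    rw [h1, (h b).isSelfAdjoint.star_eq, sub_self]
  -- The form is tested on the columns of the negative part `N`. This makes the diagonal of the
  -- positive matrix `N*NN` both positive and negative, and a positive matrix `R*R` with zero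
  -- diagonal vanishes.
  obtain ⟨N, hcube, hMN, hN⟩ := CStarAlgebra.exists_negPart hM
  obtain ⟨R, hR⟩ := CStarAlgebra.exists_eq_star_mul_self hcube
  have hdiag : ∀ p, (star N * N * N) p p = 0 := fun p => by
    have h1 : ∑ k, ∑ l, star (N k p) * M k l * N l p = -(star N * N * N) p p := by
      rw [← neg_apply, ← hMN, mul_assoc]
      simp only [mul_apply, star_apply, Finset.mul_sum, mul_assoc]
    have h2 : 0 ≤ (star N * N * N) p p := by
      rw [hR]; simp only [mul_apply, star_apply]
      exact Finset.sum_nonneg fun q _ => star_mul_self_nonneg _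
    have h3 := h fun k => N k p
    rw [h1] at h3
    exact le_antisymm (neg_nonneg.mp h3) h2
  have hR0 : R = 0 := by
    ext q p
    have h1 := hdiag p
    rw [hR] at h1
    simp only [mul_apply, star_apply] at h1
    have h2 := (Finset.sum_eq_zero_iff_of_nonneg fun q _ => star_mul_self_nonneg (R q p)).mp h1 q
      (Finset.mem_univ q)
    simpa using h2
  exact hN (by rw [hR, hR0, mul_zero])

theorem nonneg_iff_forall_sum_nonneg {M : CStarMatrix n n B} :
    0 ≤ M ↔ ∀ b : n → B, 0 ≤ ∑ k, ∑ l, star (b k) * M k l * b l :=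
  ⟨sum_star_mul_mul_nonneg, nonneg_of_forall_sum_nonneg⟩

end CStarMatrix

/-- An injective `*`-homomorphism reflects positivity. -/
theorem NonUnitalStarAlgHom.nonneg_of_map_nonneg {B C : Type*} [CStarAlgebra B] [PartialOrder B]
    [StarOrderedRing B] [CStarAlgebra C] [PartialOrder C] [StarOrderedRing C]
    (π : B →⋆ₙₐ[ℂ] C) (hπ : Function.Injective π) {b : B} (hb : 0 ≤ π b) : 0 ≤ b := by
  have hsa : IsSelfAdjoint b := hπ (by rw [map_star, hb.isSelfAdjoint.star_eq])
  obtain ⟨d, hd, hbd, hd0⟩ := CStarAlgebra.exists_negPart hsa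
  have h2 : 0 ≤ star (π d) * π b * π d := star_left_conjugate_nonneg hb _
  rw [← map_star, ← map_mul, ← map_mul, hbd, map_neg] at h2
  refine hd0 (hπ ((le_antisymm (neg_nonneg.mp h2) ?_).trans (map_zero π).symm))
  obtain ⟨r, hr⟩ := CStarAlgebra.exists_eq_star_mul_self hd
  rw [hr, map_mul, map_star]
  exact star_mul_self_nonneg _

/-! ### Positivity tested on Hilbert space vectors. -/

section Operators

variable {G : Type*} [NormedAddCommGroup G] [InnerProductSpace ℂ G]

theorem inner_self_nonneg_complex (x : G) : 0 ≤ ⟪x, x⟫_ℂ := by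
  rw [inner_self_eq_norm_sq_to_K]
  exact RCLike.ofReal_nonneg.mpr (sq_nonneg ‖x‖) |>.trans_eq (by push_cast; rfl)

theorem ContinuousLinearMap.nonneg_iff_forall_inner (T : G →L[ℂ] G) :
    0 ≤ T ↔ ∀ g, 0 ≤ ⟪g, T g⟫_ℂ := by
  rw [ContinuousLinearMap.nonneg_iff_isPositive]
  refine ⟨fun h g => h.inner_nonneg_right g, fun h => ?_⟩
  rw [ContinuousLinearMap.isPositive_iff_complex]
  intro g
  have h1 := h g
  rw [← inner_conj_symm, RCLike.le_iff_re_im] at h1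
  simp only [map_zero, RCLike.conj_re, RCLike.conj_im, zero_eq_neg] at h1
  exact ⟨RCLike.ext (by simp) (by simpa using h1.2.symm), h1.1⟩

variable [CompleteSpace G] {n : Type*} [Fintype n] {B : Type*} [CStarAlgebra B]

theorem CStarMatrix.sum_inner_star_mul_self (π : B →⋆ₙₐ[ℂ] (G →L[ℂ] G)) (R : CStarMatrix n n B)
    (g : n → G) : ∑ k, ∑ l, ⟪g k, π ((star R * R) k l) (g l)⟫_ℂ =
      ∑ p, ⟪∑ k, π (R p k) (g k), ∑ l, π (R p l) (g l)⟫_ℂ := by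
  simp only [mul_apply, star_apply, map_sum, map_mul, map_star, sum_inner, inner_sum,
    _root_.sum_apply, mul_apply_eq_comp,
    ContinuousLinearMap.star_eq_adjoint, ContinuousLinearMap.adjoint_inner_right]
  rw [Finset.sum_comm_cycle]
  refine Finset.sum_congr rfl fun p _ => ?_
  rw [Finset.sum_comm]

variable [DecidableEq n] [PartialOrder B] [StarOrderedRing B]

theorem CStarMatrix.sum_inner_nonneg (π : B →⋆ₙₐ[ℂ] (G →L[ℂ] G)) {M : CStarMatrix n n B}
    (hM : 0 ≤ M) (g : n → G) : 0 ≤ ∑ k, ∑ l, ⟪g k, π (M k l) (g l)⟫_ℂ := by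
  obtain ⟨R, rfl⟩ := CStarAlgebra.exists_eq_star_mul_self hM
  rw [sum_inner_star_mul_self]
  exact Finset.sum_nonneg fun p _ => inner_self_nonneg_complex _

theorem CStarMatrix.nonneg_iff_forall_inner (π : B →⋆ₙₐ[ℂ] (G →L[ℂ] G))
    (hπ : Function.Injective π) {M : CStarMatrix n n B} :
    0 ≤ M ↔ ∀ g : n → G, 0 ≤ ∑ k, ∑ l, ⟪g k, π (M k l) (g l)⟫_ℂ := by
  refine ⟨fun hM => sum_inner_nonneg π hM, fun h => nonneg_of_forall_sum_nonneg fun b =>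
    NonUnitalStarAlgHom.nonneg_of_map_nonneg π hπ ?_⟩
  rw [ContinuousLinearMap.nonneg_iff_forall_inner]
  intro g
  simpa [map_sum, map_mul, map_star, inner_sum, _root_.sum_apply,
    ContinuousLinearMap.star_eq_adjoint, ContinuousLinearMap.adjoint_inner_right] using
    h fun k => π (b k) g

end Operators

/-! ### Kolmogorov decomposition of positive families of functionals -/

section Kolmogorov

open UniformSpace Completion

variable {A : Type*} [CStarAlgebra A] {X : Type*}

/-- The sesquilinear form on `X →₀ A` attached to a family of functionals on `A`. -/
noncomputable def functionalForm (k : X → X → A →ₗ[ℂ] ℂ) (u w : X →₀ A) : ℂ :=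
  u.sum fun x a => w.sum fun y b => k x y (star a * b)

/-- Positive definiteness of a family of functionals indexed by `X × X`. -/
def IsPositiveFamily (k : X → X → A →ₗ[ℂ] ℂ) : Prop := ∀ u, 0 ≤ functionalForm k u u

section Form

variable (k : X → X → A →ₗ[ℂ] ℂ)

theorem functionalForm_add_right (u w w' : X →₀ A) :
    functionalForm k u (w + w') = functionalForm k u w + functionalForm k u w' := by
  simp only [functionalForm, ← Finsupp.sum_add]
  refine Finsupp.sum_congr fun x _ => ?_
  exact Finsupp.sum_add_index' (by simp) (by simp [mul_add])

theorem functionalForm_add_left (u u' w : X →₀ A) :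
    functionalForm k (u + u') w = functionalForm k u w + functionalForm k u' w := by
  refine Finsupp.sum_add_index' (by simp) fun x a b => ?_
  simp [add_mul, Finsupp.sum_add]

theorem functionalForm_smul_right (c : ℂ) (u w : X →₀ A) :
    functionalForm k u (c • w) = c * functionalForm k u w := by
  simp only [functionalForm, Finsupp.mul_sum]
  refine Finsupp.sum_congr fun x _ => ?_
  rw [Finsupp.sum_smul_index' (by simp)]
  simp

theorem functionalForm_smul_left (c : ℂ) (u w : X →₀ A) :
    functionalForm k (c • u) w = star c * functionalForm k u w := by
  simp only [functionalForm, Finsupp.mul_sum]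
  rw [Finsupp.sum_smul_index' (by simp)]
  simp

theorem functionalForm_algebra_smul_right (a : A) (u w : X →₀ A) :
    functionalForm k u (a • w) = functionalForm k (star a • u) w := by
  simp only [functionalForm]
  rw [Finsupp.sum_smul_index' (by simp)]
  refine Finsupp.sum_congr fun x _ => ?_
  rw [Finsupp.sum_smul_index' (by simp)]
  simp [mul_assoc]

theorem functionalForm_single (x y : X) (a b : A) :
    functionalForm k (Finsupp.single x a) (Finsupp.single y b) = k x y (star a * b) := by
  simp [functionalForm]

variable {k}

theorem IsPositiveFamily.form_symm (hk : IsPositiveFamily k) (u w : X →₀ A) :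
    star (functionalForm k w u) = functionalForm k u w := by
  have him : ∀ z, (functionalForm k z z).im = 0 := fun z => ((Complex.le_def.mp (hk z)).2).symm
  have h1 := him (u + w)
  have h2 := him (u + Complex.I • w)
  simp only [functionalForm_add_right, functionalForm_add_left, functionalForm_smul_left,
    functionalForm_smul_right, Complex.add_im, Complex.add_re, Complex.mul_im,
    Complex.mul_re, Complex.star_def,
    Complex.conj_I, Complex.neg_re, Complex.neg_im, Complex.I_re, Complex.I_im,
    him] at h1 h2
  apply Complex.ext <;> simp <;> linarith

end Form

variable (k : X → X → A →ₗ[ℂ] ℂ) (hk : IsPositiveFamily k)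

set_option linter.unusedVariables false in
/-- The pre-Hilbert space of a positive family of functionals. -/
@[nolint unusedArguments]
def PreKolmogorov (hk : IsPositiveFamily k) := X →₀ A

namespace PreKolmogorov

noncomputable instance : AddCommGroup (PreKolmogorov k hk) := inferInstanceAs (AddCommGroup (X →₀ A))
noncomputable instance : Module ℂ (PreKolmogorov k hk) := inferInstanceAs (Module ℂ (X →₀ A))

/-- The elements of the pre-Hilbert space as finitely supported functions. -/
noncomputable def of : PreKolmogorov k hk ≃ₗ[ℂ] (X →₀ A) := LinearEquiv.refl ℂ _

/-- The inner product given by the functionals. -/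
noncomputable abbrev core : PreInnerProductSpace.Core ℂ (PreKolmogorov k hk) where
  inner u w := functionalForm k (of k hk u) (of k hk w)
  conj_inner_symm u w := hk.form_symm _ _
  re_inner_nonneg u := (Complex.le_def.mp (hk _)).1
  add_left u v w := by rw [map_add, functionalForm_add_left]
  smul_left u w c := by rw [map_smul, functionalForm_smul_left]; rfl

noncomputable instance : SeminormedAddCommGroup (PreKolmogorov k hk) :=
  InnerProductSpace.Core.toSeminormedAddCommGroup (c := core k hk)
noncomputable instance : InnerProductSpace ℂ (PreKolmogorov k hk) :=
  InnerProductSpace.ofCore (core k hk)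

theorem inner_def (u w : PreKolmogorov k hk) :
    ⟪u, w⟫_ℂ = functionalForm k (of k hk u) (of k hk w) := rfl

/-- The action of `A` on `X →₀ A` by left multiplication, as a linear map. -/
noncomputable def lmulₗ (a : A) : PreKolmogorov k hk →ₗ[ℂ] PreKolmogorov k hk where
  toFun u := (of k hk).symm (a • of k hk u)
  map_add' u w := by simp
  map_smul' c u := by
    rw [RingHom.id_apply, ← (of k hk).symm.map_smul, (of k hk).map_smul, smul_comm]

theorem of_lmulₗ (a : A) (u : PreKolmogorov k hk) : of k hk (lmulₗ k hk a u) = a • of k hk u := rfl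

theorem inner_lmulₗ (a : A) (u w : PreKolmogorov k hk) :
    ⟪u, lmulₗ k hk a w⟫_ℂ = ⟪lmulₗ k hk (star a) u, w⟫_ℂ := by
  simp only [inner_def, of_lmulₗ, functionalForm_algebra_smul_right]

theorem lmulₗ_mul (a b : A) (u : PreKolmogorov k hk) :
    lmulₗ k hk (a * b) u = lmulₗ k hk a (lmulₗ k hk b u) :=
  (of k hk).injective (by simp only [of_lmulₗ, mul_smul])

theorem lmulₗ_add (a b : A) (u : PreKolmogorov k hk) :
    lmulₗ k hk (a + b) u = lmulₗ k hk a u + lmulₗ k hk b u :=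
  (of k hk).injective (by simp only [of_lmulₗ, add_smul, map_add])

theorem lmulₗ_smul (c : ℂ) (a : A) (u : PreKolmogorov k hk) :
    lmulₗ k hk (c • a) u = c • lmulₗ k hk a u :=
  (of k hk).injective (by simp only [of_lmulₗ, smul_assoc, map_smul])

theorem lmulₗ_one (u : PreKolmogorov k hk) : lmulₗ k hk 1 u = u :=
  (of k hk).injective (by simp only [of_lmulₗ, one_smul])

/-- Writing `‖a‖² - a*a = c*c` gives `‖a‖²‖u‖² - ‖a u‖² = ‖c u‖² ≥ 0`. -/
theorem norm_lmulₗ_le (a : A) (u : PreKolmogorov k hk) : ‖lmulₗ k hk a u‖ ≤ ‖a‖ * ‖u‖ := by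
  let : PartialOrder A := CStarAlgebra.spectralOrder A
  have : StarOrderedRing A := CStarAlgebra.spectralOrderedRing A
  have h1 : 0 ≤ algebraMap ℝ A (‖a‖ ^ 2) - star a * a := by
    rw [sub_nonneg, sq, ← CStarRing.norm_star_mul_self]
    exact IsSelfAdjoint.le_algebraMap_norm_self (.star_mul_self a)
  obtain ⟨c, hc⟩ := CStarAlgebra.exists_eq_star_mul_self h1
  have h2 : ‖lmulₗ k hk c u‖ ^ 2 = ‖a‖ ^ 2 * ‖u‖ ^ 2 - ‖lmulₗ k hk a u‖ ^ 2 := by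
    have h3 : lmulₗ k hk (star c * c) u + lmulₗ k hk (star a * a) u = ((‖a‖ ^ 2 : ℝ) : ℂ) • u := by
      rw [← lmulₗ_add, ← hc, sub_add_cancel, Algebra.algebraMap_eq_smul_one, ← Complex.coe_smul,
        lmulₗ_smul, lmulₗ_one]
    have h4 := congrArg (fun w => (⟪u, w⟫_ℂ).re) h3
    simp only [inner_add_right, lmulₗ_mul, inner_smul_right] at h4
    rw [inner_lmulₗ k hk (star c), inner_lmulₗ k hk (star a), star_star, star_star] at h4
    have h5 : ∀ z : PreKolmogorov k hk, (⟪z, z⟫_ℂ).re = ‖z‖ ^ 2 := inner_self_eq_norm_sq (𝕜 := ℂ)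
    rw [Complex.add_re, Complex.re_ofReal_mul, h5, h5, h5] at h4
    linarith
  rw [← sq_le_sq₀ (norm_nonneg _) (by positivity), mul_pow]
  nlinarith [sq_nonneg ‖lmulₗ k hk c u‖]

/-- The action of `A` on the pre-Hilbert space. -/
noncomputable def lmul (a : A) : PreKolmogorov k hk →L[ℂ] PreKolmogorov k hk :=
  (lmulₗ k hk a).mkContinuous ‖a‖ (norm_lmulₗ_le k hk a)

theorem lmul_apply (a : A) (u : PreKolmogorov k hk) : lmul k hk a u = lmulₗ k hk a u := rfl

/-- The representation of `A` on the completion. -/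
noncomputable def rep :
    A →⋆ₐ[ℂ] (Completion (PreKolmogorov k hk) →L[ℂ] Completion (PreKolmogorov k hk)) where
  toFun a := (lmul k hk a).completion
  map_zero' := by
    ext c
    induction c using induction_on with
    | hp => apply isClosed_eq <;> fun_prop
    | ih c =>
      have := lmulₗ_smul k hk 0 0 c
      simp only [zero_smul] at this
      simp [lmul_apply, this, coe_zero]
  map_one' := by
    ext c
    induction c using induction_on with
    | hp => apply isClosed_eq <;> fun_prop
    | ih c => simp [lmul_apply, lmulₗ_one]
  map_add' a b := by
    ext c
    induction c using induction_on with
    | hp => apply isClosed_eq <;> fun_prop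
    | ih c => simp [lmul_apply, lmulₗ_add, coe_add]
  map_mul' a b := by
    ext c
    induction c using induction_on with
    | hp => apply isClosed_eq <;> fun_prop
    | ih c => simp [lmul_apply, lmulₗ_mul]
  commutes' c := by
    ext w
    induction w using induction_on with
    | hp => apply isClosed_eq <;> fun_prop
    | ih w => simp [lmul_apply, Algebra.algebraMap_eq_smul_one, lmulₗ_smul, lmulₗ_one]
  map_star' a := by
    refine (ContinuousLinearMap.eq_adjoint_iff (lmul k hk (star a)).completion
      (lmul k hk a).completion).mpr fun x y => ?_
    induction x, y using induction_on₂ with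
    | hp => apply isClosed_eq <;> fun_prop
    | ih x y => simp [lmul_apply, inner_lmulₗ]

theorem rep_apply_coe (a : A) (u : PreKolmogorov k hk) :
    rep k hk a (u : Completion (PreKolmogorov k hk)) = (lmulₗ k hk a u : PreKolmogorov k hk) := by
  change (lmul k hk a).completion u = _
  simp [lmul_apply]

end PreKolmogorov

end Kolmogorov

open PreKolmogorov in
/-- A positive family of functionals on a C*-algebra is implemented by vectors of a Hilbert space
carrying a representation for which these vectors are cyclic. -/
theorem IsPositiveFamily.exists_rep {A : Type u} [CStarAlgebra A] {X : Type v}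
    {k : X → X → A →ₗ[ℂ] ℂ} (hk : IsPositiveFamily k) :
    ∃ (H : Type max u v) (_ : NormedAddCommGroup H) (_ : InnerProductSpace ℂ H)
      (_ : CompleteSpace H) (σ : A →⋆ₐ[ℂ] (H →L[ℂ] H)) (w : X → H),
      (∀ x y a, ⟪w x, σ a (w y)⟫_ℂ = k x y a) ∧
      DenseRange (Finsupp.linearCombination ℂ fun p : A × X => σ p.1 (w p.2)) := by
  let w : X → PreKolmogorov k hk := fun x => (of k hk).symm (Finsupp.single x 1)
  have hw : ∀ x a, lmulₗ k hk a (w x) = (of k hk).symm (Finsupp.single x a) := fun x a =>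
    (of k hk).injective (by simp [of_lmulₗ, w])
  refine ⟨UniformSpace.Completion (PreKolmogorov k hk), inferInstance, inferInstance,
    inferInstance, rep k hk, fun x => (w x : PreKolmogorov k hk), fun x y a => ?_, ?_⟩
  · rw [rep_apply_coe, hw, UniformSpace.Completion.inner_coe, inner_def]
    simp [w, functionalForm_single]
  · refine UniformSpace.Completion.denseRange_coe.mono ?_
    rintro _ ⟨u, rfl⟩
    refine ⟨(of k hk u).sum fun x a => Finsupp.single (a, x) 1, ?_⟩
    rw [map_finsuppSum]
    simp only [Finsupp.linearCombination_single, one_smul, rep_apply_coe, hw]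
    conv_rhs => rw [← (of k hk).symm_apply_apply u, ← Finsupp.sum_single (of k hk u)]
    rw [map_finsuppSum]
    exact (map_finsuppSum (UniformSpace.Completion.toComplL (𝕜 := ℂ)
      (E := PreKolmogorov k hk)) _ _).symm

end

section

open scoped ComplexOrder InnerProductSpace ComplexStarModule

/-! ### Existence of faithful representations. -/

section Faithful

variable {A : Type u} [CStarAlgebra A]

/-- A real functional on the self-adjoint part extends to a complex functional. -/
theorem selfAdjoint.exists_complex_extension (f : selfAdjoint A →ₗ[ℝ] ℝ) :
    ∃ F : A →ₗ[ℂ] ℂ, ∀ a : selfAdjoint A, F a = f a := by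
  refine ⟨{ toFun := fun a => (f (ℜ a) : ℂ) + Complex.I * f (ℑ a)
            map_add' := fun a b => ?_
            map_smul' := fun c a => ?_ }, fun a => ?_⟩
  · simp only [map_add, Complex.ofReal_add]; ring
  · simp only [realPart_smul, imaginaryPart_smul, map_sub, map_add, map_smul, smul_eq_mul,
      Complex.ofReal_sub, Complex.ofReal_add, Complex.ofReal_mul, RingHom.id_apply]
    apply Complex.ext <;> simp
  · simp [a.2.imaginaryPart]

variable [PartialOrder A] [StarOrderedRing A]

/-- A real functional separates `-a` from the closed convex cone of positive elements; its complex
extension agrees with it on self-adjoint elements. -/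
theorem exists_positive_functional_ne_zero {a : A} (ha : 0 ≤ a) (h0 : a ≠ 0) :
    ∃ f : A →ₗ[ℂ] ℂ, (∀ b, 0 ≤ f (star b * b)) ∧ f a ≠ 0 := by
  let C : ProperCone ℝ A := ⟨PointedCone.positive ℝ A, CStarAlgebra.isClosed_nonneg⟩
  have hC : ∀ x, x ∈ C ↔ 0 ≤ x := fun x => Iff.rfl
  obtain ⟨f, hf, hf0⟩ := C.hyperplane_separation_point (x₀ := -a) fun h =>
    h0 (le_antisymm (neg_nonneg.mp ((hC _).mp h)) ha)
  obtain ⟨F, hF⟩ := selfAdjoint.exists_complex_extension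
    (f.toLinearMap ∘ₗ (selfAdjoint.submodule ℝ A).subtype)
  have hF' : ∀ x : A, 0 ≤ x → F x = f x := fun x hx => hF ⟨x, hx.isSelfAdjoint⟩
  refine ⟨F, fun b => ?_, ?_⟩
  · rw [hF' _ (star_mul_self_nonneg b)]
    exact_mod_cast hf _ ((hC _).mpr (star_mul_self_nonneg b))
  · rw [hF' a ha]
    rw [map_neg, neg_lt_zero] at hf0
    exact_mod_cast hf0.ne'

variable (A) in
/-- Every C*-algebra has a faithful representation. -/
theorem exists_faithful_rep : ∃ (G : Type u) (_ : NormedAddCommGroup G)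
    (_ : InnerProductSpace ℂ G) (_ : CompleteSpace G) (π : A →⋆ₐ[ℂ] (G →L[ℂ] G)),
    Function.Injective π := by
  classical
  let X := {f : A →ₗ[ℂ] ℂ // ∀ b, 0 ≤ f (star b * b)}
  -- The diagonal family over all positive functionals encodes the direct sum of their GNS
  -- representations.
  let k : X → X → A →ₗ[ℂ] ℂ := fun f g => if f = g then f.1 else 0
  have hk : IsPositiveFamily k := fun u => by
    refine Finset.sum_nonneg fun f hf => ?_
    have : (u.sum fun g b => k f g (star (u f) * b)) = f.1 (star (u f) * u f) := by
      rw [Finsupp.sum, Finset.sum_eq_single_of_mem f hf]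
      · simp [k]
      · intro g _ hg
        simp [k, hg.symm]
    exact (f.2 (u f)).trans_eq this.symm
  obtain ⟨G, i1, i2, i3, π, w, hw, -⟩ := hk.exists_rep
  refine ⟨G, i1, i2, i3, π, (injective_iff_map_eq_zero π).mpr fun a ha => ?_⟩
  by_contra h0
  have h1 : star a * a ≠ 0 := fun h => h0 ((CStarRing.star_mul_self_eq_zero_iff a).mp h)
  obtain ⟨f, hf, hfa⟩ := exists_positive_functional_ne_zero (star_mul_self_nonneg a) h1
  refine hfa ?_
  have h2 := hw ⟨f, hf⟩ ⟨f, hf⟩ (star a * a)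
  rw [map_mul, ha, mul_zero] at h2
  simpa [k] using h2.symm

end Faithful

/-! ### Uniqueness of cyclic decompositions. -/

section Isometry

variable {A : Type*} [CStarAlgebra A] {X : Type*}
  {H : Type*} [NormedAddCommGroup H] [InnerProductSpace ℂ H] [CompleteSpace H]
  {K : Type*} [NormedAddCommGroup K] [InnerProductSpace ℂ K] [CompleteSpace K]

/-- Two families of vectors with the same correlation functionals are related by an intertwining
isometry, defined on the whole space if the first family is cyclic. -/
theorem exists_intertwining_isometry (σ : A →⋆ₐ[ℂ] (H →L[ℂ] H)) (τ : A →⋆ₐ[ℂ] (K →L[ℂ] K))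
    (w : X → H) (z : X → K) (h : ∀ x y a, ⟪w x, σ a (w y)⟫_ℂ = ⟪z x, τ a (z y)⟫_ℂ)
    (hw : DenseRange (Finsupp.linearCombination ℂ fun p : A × X => σ p.1 (w p.2))) :
    ∃ I : H →L[ℂ] K, (∀ x, ‖I x‖ = ‖x‖) ∧ (∀ x, I (w x) = z x) ∧ ∀ a, I ∘L σ a = τ a ∘L I := by
  set e := Finsupp.linearCombination ℂ fun p : A × X => σ p.1 (w p.2) with he
  set f := Finsupp.linearCombination ℂ fun p : A × X => τ p.1 (z p.2) with hf
  have hin : ∀ p q : A × X, ⟪σ p.1 (w p.2), σ q.1 (w q.2)⟫_ℂ = ⟪τ p.1 (z p.2), τ q.1 (z q.2)⟫_ℂ := by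
    intro p q
    rw [← ContinuousLinearMap.adjoint_inner_right, ← ContinuousLinearMap.adjoint_inner_right (τ p.1),
      ← ContinuousLinearMap.star_eq_adjoint, ← ContinuousLinearMap.star_eq_adjoint, ← map_star,
      ← map_star, ← mul_apply_eq_comp, ← mul_apply_eq_comp, ← map_mul, ← map_mul, h]
  -- Equal norms let `f` factor isometrically through `e`, first on the dense range of `e` and then
  -- by continuity.
  have hnorm : ∀ u, ‖f u‖ = ‖e u‖ := fun u => by
    have : ⟪f u, f u⟫_ℂ = ⟪e u, e u⟫_ℂ := by
      simp only [he, hf, Finsupp.linearCombination_apply, Finsupp.sum_inner, Finsupp.inner_sum,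
        hin, inner_smul_left, inner_smul_right]
    rw [← sq_eq_sq₀ (norm_nonneg _) (norm_nonneg _), ← inner_self_eq_norm_sq (𝕜 := ℂ),
      ← inner_self_eq_norm_sq (𝕜 := ℂ), this]
  have hext : ∀ u, f.extendOfNorm e (e u) = f u := fun u =>
    f.extendOfNorm_eq hw ⟨1, fun x => by rw [hnorm, one_mul]⟩ u
  have hgen : ∀ a x, f.extendOfNorm e (σ a (w x)) = τ a (z x) := fun a x => by
    simpa [e, f] using hext (Finsupp.single (a, x) 1)
  refine ⟨f.extendOfNorm e, fun x => ?_, fun x => by simpa using hgen 1 x, fun a => ?_⟩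
  · induction x using hw.induction_on with
    | hp => apply isClosed_eq <;> fun_prop
    | ih u => rw [hext, hnorm]
  · ext x
    induction x using hw.induction_on with
    | hp => apply isClosed_eq <;> fun_prop
    | ih u =>
      simp only [he, Finsupp.linearCombination_apply, ContinuousLinearMap.comp_apply]
      simp only [map_finsuppSum, map_smul]
      refine Finsupp.sum_congr fun p _ => ?_
      rw [← mul_apply_eq_comp, ← map_mul, hgen, hgen, ← mul_apply_eq_comp, ← map_mul]

end Isometry

/-! ### Completely positive kernels and their Stinespring decomposition. -/

section Kernel

variable {A : Type u} [CStarAlgebra A] {B : Type v} [CStarAlgebra B] [PartialOrder B]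
  [StarOrderedRing B] {ι : Type w}

/-- Complete positivity of a matrix of linear maps `A → B`. -/
def IsPositiveKernel (Φ : ι → ι → A →ₗ[ℂ] B) : Prop :=
  ∀ (n : ℕ) (i : Fin n → ι) (a : Fin n → A),
    0 ≤ (CStarMatrix.ofMatrix fun k l => Φ (i k) (i l) (star (a k) * a l) :
      CStarMatrix (Fin n) (Fin n) B)

variable {Φ : ι → ι → A →ₗ[ℂ] B}

theorem isPositiveKernel_iff_sum : IsPositiveKernel Φ ↔
    ∀ (n : ℕ) (i : Fin n → ι) (a : Fin n → A) (b : Fin n → B),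
      0 ≤ ∑ k, ∑ l, star (b k) * Φ (i k) (i l) (star (a k) * a l) * b l :=
  forall_congr' fun _ => forall_congr' fun _ => forall_congr' fun _ =>
    CStarMatrix.nonneg_iff_forall_sum_nonneg

variable {G : Type v} [NormedAddCommGroup G] [InnerProductSpace ℂ G] [CompleteSpace G]
  (π : B →⋆ₙₐ[ℂ] (G →L[ℂ] G))

theorem isPositiveKernel_iff_inner (hπ : Function.Injective π) : IsPositiveKernel Φ ↔
    ∀ (n : ℕ) (i : Fin n → ι) (a : Fin n → A) (g : Fin n → G),
      0 ≤ ∑ k, ∑ l, ⟪g k, π (Φ (i k) (i l) (star (a k) * a l)) (g l)⟫_ℂ :=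
  forall_congr' fun _ => forall_congr' fun _ => forall_congr' fun _ =>
    CStarMatrix.nonneg_iff_forall_inner π hπ

theorem IsPositiveKernel.sum_inner_nonneg (hπ : Function.Injective π) (hΦ : IsPositiveKernel Φ)
    {T : Type*} (s : Finset T) (i : T → ι) (a : T → A) (g : T → G) :
    0 ≤ ∑ k ∈ s, ∑ l ∈ s, ⟪g k, π (Φ (i k) (i l) (star (a k) * a l)) (g l)⟫_ℂ := by
  have h := (isPositiveKernel_iff_inner π hπ).mp hΦ s.card (fun k => i (s.equivFin.symm k))
    (fun k => a (s.equivFin.symm k)) fun k => g (s.equivFin.symm k)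
  refine h.trans_eq ?_
  rw [← Finset.sum_coe_sort s, ← s.equivFin.symm.sum_comp]
  refine Finset.sum_congr rfl fun k _ => ?_
  rw [← Finset.sum_coe_sort s, ← s.equivFin.symm.sum_comp]

/-- Stinespring decomposition of a positive kernel, with a cyclic family of operators. -/
theorem IsPositiveKernel.exists_stinespring (hπ : Function.Injective π) (hΦ : IsPositiveKernel Φ) :
    ∃ (K : Type max u v w) (_ : NormedAddCommGroup K) (_ : InnerProductSpace ℂ K)
      (_ : CompleteSpace K) (σ : A →⋆ₐ[ℂ] (K →L[ℂ] K)) (V : ι → G →L[ℂ] K),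
      (∀ i j a g h, ⟪V i g, σ a (V j h)⟫_ℂ = ⟪g, π (Φ i j a) h⟫_ℂ) ∧
      DenseRange (Finsupp.linearCombination ℂ fun p : A × (ι × G) => σ p.1 (V p.2.1 p.2.2)) := by
  let k : ι × G → ι × G → A →ₗ[ℂ] ℂ := fun p q =>
    { toFun := fun a => ⟪p.2, π (Φ p.1 q.1 a) q.2⟫_ℂ
      map_add' := fun a b => by simp
      map_smul' := fun c a => by simp }
  have hk : IsPositiveFamily k := fun u =>
    hΦ.sum_inner_nonneg π hπ u.support (fun p => p.1) u fun p => p.2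
  obtain ⟨K, i1, i2, i3, σ, w, hw, hd⟩ := hk.exists_rep
  have hin : ∀ p q, ⟪w p, w q⟫_ℂ = ⟪p.2, π (Φ p.1 q.1 1) q.2⟫_ℂ := fun p q => by
    simpa [k] using hw p q 1
  -- The vectors `w (i, g)` are linear in `g` because their inner products are: the squared norm of
  -- the discrepancy expands to zero.
  have hadd : ∀ i g h, w (i, g + h) = w (i, g) + w (i, h) := fun i g h => by
    rw [← sub_eq_zero, ← inner_self_eq_zero (𝕜 := ℂ)]
    simp only [inner_sub_left, inner_sub_right, inner_add_left, inner_add_right, hin, map_add]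
    ring
  have hsmul : ∀ i (c : ℂ) g, w (i, c • g) = c • w (i, g) := fun i c g => by
    rw [← sub_eq_zero, ← inner_self_eq_zero (𝕜 := ℂ)]
    simp only [inner_sub_left, inner_sub_right, inner_smul_left, inner_smul_right, hin, map_smul]
    ring
  have hbd : ∀ i g, ‖w (i, g)‖ ≤ √‖π (Φ i i 1)‖ * ‖g‖ := fun i g => by
    rw [← sq_le_sq₀ (norm_nonneg _) (by positivity), mul_pow, Real.sq_sqrt (norm_nonneg _),
      ← inner_self_eq_norm_sq (𝕜 := ℂ), hin]
    refine (Complex.re_le_norm _).trans ((norm_inner_le_norm _ _).trans ?_)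
    have := (π (Φ i i 1)).le_opNorm g
    dsimp only
    nlinarith [norm_nonneg g]
  refine ⟨K, i1, i2, i3, σ, fun i => LinearMap.mkContinuous
    { toFun := fun g => w (i, g), map_add' := hadd i, map_smul' := hsmul i } _ (hbd i),
    fun i j a g h => hw (i, g) (j, h) a, hd⟩

end Kernel

end

section

open scoped ComplexOrder InnerProductSpace

/-! ### Hilbert bimodules made of operators. -/

section Realization

open ContinuousLinearMap MulOpposite

variable {A : Type u} [CStarAlgebra A] {B : Type v} [CStarAlgebra B] [PartialOrder B]
  [StarOrderedRing B]
  {G : Type v} [NormedAddCommGroup G] [InnerProductSpace ℂ G] [CompleteSpace G]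
  {K : Type max u v} [NormedAddCommGroup K] [InnerProductSpace ℂ K] [CompleteSpace K]

/-- A closed space `M` of operators `G → K` that is invariant under a representation of `A` on `K`
and under a faithful representation `π` of `B` on `G`, and with `S* T ∈ π(B)` for `S, T ∈ M`, is a
Hilbert `A`-`B`-module. -/
noncomputable def HilbertBimodule.ofOperators (π : B →⋆ₙₐ[ℂ] (G →L[ℂ] G))
    (hπ : Function.Injective π) (σ : A →⋆ₐ[ℂ] (K →L[ℂ] K)) (M : Submodule ℂ (G →L[ℂ] K))
    (hM : IsClosed (M : Set (G →L[ℂ] K))) (hl : ∀ a, ∀ T ∈ M, σ a ∘L T ∈ M)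
    (hr : ∀ b, ∀ T ∈ M, T ∘L π b ∈ M) (h1 : ∀ T ∈ M, T ∘L π 1 = T)
    (ip : M → M → B) (hip : ∀ S T, π (ip S T) = adjoint S.1 ∘L T.1) : HilbertBimodule.{u, v, max u v} A B :=
  letI rightModule : Module Bᵐᵒᵖ M :=
    { smul := fun b T => ⟨T.1 ∘L π b.unop, hr _ _ T.2⟩
      one_smul := fun T => Subtype.ext (h1 _ T.2)
      mul_smul := fun b c T => Subtype.ext (by
        change T.1 ∘L π (b * c).unop = (T.1 ∘L π c.unop) ∘L π b.unop
        rw [unop_mul, map_mul]; rfl)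
      smul_zero := fun b => Subtype.ext (zero_comp _)
      smul_add := fun b S T => Subtype.ext (add_comp _ _ _)
      add_smul := fun b c T => Subtype.ext (by
        change T.1 ∘L π (b + c).unop = T.1 ∘L π b.unop + T.1 ∘L π c.unop
        rw [unop_add, map_add, comp_add])
      zero_smul := fun T => Subtype.ext (by
        change T.1 ∘L π (0 : Bᵐᵒᵖ).unop = 0
        rw [unop_zero, map_zero, comp_zero]) }
  letI leftModule : Module A M :=
    { smul := fun a T => ⟨σ a ∘L T.1, hl _ _ T.2⟩
      one_smul := fun T => Subtype.ext (by
        change σ 1 ∘L T.1 = T.1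
        rw [map_one]; rfl)
      mul_smul := fun a b T => Subtype.ext (by
        change σ (a * b) ∘L T.1 = σ a ∘L (σ b ∘L T.1)
        rw [map_mul]; rfl)
      smul_zero := fun a => Subtype.ext (comp_zero _)
      smul_add := fun a S T => Subtype.ext (comp_add _ _ _)
      add_smul := fun a b T => Subtype.ext (by
        change σ (a + b) ∘L T.1 = σ a ∘L T.1 + σ b ∘L T.1
        rw [map_add, add_comp])
      zero_smul := fun T => Subtype.ext (by
        change σ 0 ∘L T.1 = 0
        rw [map_zero, zero_comp]) }
  { carrier := M
    completeSpace := hM.completeSpace_coe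
    rightModule := rightModule
    leftModule := leftModule
    cstarModule :=
      { inner := fun S T => op (ip S T)
        inner_add_right := fun {S T U} => unop_injective (hπ (by
          change π (ip S (T + U)) =
            π (ip S T + ip S U)
          rw [map_add, hip, hip, hip]
          exact comp_add _ _ _))
        inner_self_nonneg := fun {S} => by
          change 0 ≤ ip S S
          refine NonUnitalStarAlgHom.nonneg_of_map_nonneg π hπ ?_
          rw [hip, nonneg_iff_forall_inner]
          intro g
          rw [comp_apply, adjoint_inner_right]
          exact inner_self_nonneg_complex _
        inner_self := fun {S} => by
          rw [← unop_injective.eq_iff, ← hπ.eq_iff]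
          change π (ip S S) = π 0 ↔ _
          rw [hip, map_zero, ← norm_eq_zero, norm_adjoint_comp_self,
            mul_self_eq_zero, norm_eq_zero]
          exact Submodule.coe_eq_zero
        inner_op_smul_right := fun {b S T} => unop_injective (hπ (by
          change π (ip S ⟨T.1 ∘L π b.unop, hr _ _ T.2⟩) =
            π (ip S T * b.unop)
          rw [map_mul, hip, hip]
          rfl))
        inner_smul_right_complex := fun {c S T} => unop_injective (hπ (by
          change π (ip S (c • T)) = π (c • ip S T)
          rw [map_smul, hip, hip]
          exact comp_smul _ _ _))
        star_inner := fun S T => unop_injective (hπ (by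
          change π (star (ip S T)) = π (ip T S)
          rw [map_star, hip, hip, star_eq_adjoint, adjoint_comp, adjoint_adjoint]))
        norm_eq_sqrt_norm_inner_self := fun S => by
          change ‖S.1‖ = √‖(ip S S)‖
          rw [← NonUnitalStarAlgHom.norm_map π hπ, hip,
            norm_adjoint_comp_self, Real.sqrt_mul_self (norm_nonneg _)] }
    isScalarTower := ⟨fun c a T => Subtype.ext (by
      change σ (c • a) ∘L T.1 = c • (σ a ∘L T.1)
      rw [map_smul, smul_comp])⟩
    inner_smul_left := fun a S T => unop_injective (hπ (by
      change π (ip ⟨σ a ∘L S.1, hl _ _ S.2⟩ T) =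
        π (ip S ⟨σ (star a) ∘L T.1, hl _ _ T.2⟩)
      rw [hip, hip, adjoint_comp, ← star_eq_adjoint (σ a), ← map_star]; rfl)) }

/-- A positive kernel is implemented by vectors of a Hilbert bimodule. -/
theorem IsPositiveKernel.exists_bimodule {ι : Type} {Φ : ι → ι → A →ₗ[ℂ] B}
    (hΦ : IsPositiveKernel Φ) (π : B →⋆ₙₐ[ℂ] (G →L[ℂ] G)) (hπ : Function.Injective π) :
    ∃ (E : HilbertBimodule.{u, v, max u v} A B) (x : ι → E),
      ∀ i j a, E.ip (x i) (a • x j) = Φ i j a := by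
  obtain ⟨K, i1, i2, i3, σ, V, hV, -⟩ := hΦ.exists_stinespring π hπ
  have hV' : ∀ i j a b b', adjoint (V i ∘L π b) ∘L σ a ∘L V j ∘L π b' = π (star b * Φ i j a * b') := by
    intro i j a b b'
    refine ContinuousLinearMap.ext fun g => ext_inner_left ℂ fun h => ?_
    simp only [comp_apply, adjoint_inner_right, hV, map_mul, mul_apply_eq_comp, map_star,
      star_eq_adjoint]
  let M₀ : Submodule ℂ (G →L[ℂ] K) :=
    Submodule.span ℂ (Set.range fun p : A × ι × B => σ p.1 ∘L V p.2.1 ∘L π p.2.2)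
  have hgen : ∀ a i b, σ a ∘L V i ∘L π b ∈ M₀ := fun a i b => Submodule.subset_span ⟨(a, i, b), rfl⟩
  have hl : ∀ a, ∀ T ∈ M₀.topologicalClosure, σ a ∘L T ∈ M₀.topologicalClosure := by
    intro a
    let L : (G →L[ℂ] K) →L[ℂ] (G →L[ℂ] K) := compL ℂ G K K (σ a)
    refine fun T hT => map_mem_closure (f := L) (s := M₀) (t := M₀) L.continuous hT fun S hS => ?_
    have : M₀ ≤ M₀.comap L.toLinearMap := Submodule.span_le.mpr (by
      rintro _ ⟨⟨a', i, b⟩, rfl⟩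
      have := hgen (a * a') i b
      rw [map_mul] at this
      exact this)
    exact this hS
  have hr : ∀ b, ∀ T ∈ M₀.topologicalClosure, T ∘L π b ∈ M₀.topologicalClosure := by
    intro b
    let L : (G →L[ℂ] K) →L[ℂ] (G →L[ℂ] K) := (compL ℂ G G K).flip (π b)
    refine fun T hT => map_mem_closure (f := L) (s := M₀) (t := M₀) L.continuous hT fun S hS => ?_
    have : M₀ ≤ M₀.comap L.toLinearMap := Submodule.span_le.mpr (by
      rintro _ ⟨⟨a, i, b'⟩, rfl⟩
      have := hgen a i (b' * b)
      rw [map_mul] at this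
      exact this)
    exact this hS
  -- Since `π` may be non-unital, `π 1` is only a projection; it acts as the identity on the module
  -- because every generator ends in some `π b`.
  have h1 : ∀ T ∈ M₀.topologicalClosure, T ∘L π 1 = T := by
    let L : (G →L[ℂ] K) →L[ℂ] (G →L[ℂ] K) := (compL ℂ G G K).flip (π 1)
    intro T hT
    refine closure_minimal (s := (M₀ : Set (G →L[ℂ] K))) (t := {T | L T = T}) (fun S hS => ?_)
      (isClosed_eq L.continuous continuous_id) hT
    have : M₀ ≤ LinearMap.eqLocus L.toLinearMap LinearMap.id := Submodule.span_le.mpr (by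
      rintro _ ⟨⟨a, i, b⟩, rfl⟩
      change (σ a ∘L V i ∘L π b) ∘L π 1 = _
      rw [comp_assoc, comp_assoc, ← mul_def, ← map_mul, mul_one]; rfl)
    exact this hS
  have hrange : IsClosed (Set.range π) :=
    (AddMonoidHomClass.isometry_of_norm π
      (NonUnitalStarAlgHom.norm_map π hπ)).isClosedEmbedding.isClosed_range
  -- Membership of `S* T` in the closed range of `π` passes from generators to the closure, one
  -- variable at a time. Using this twice, with an adjoint in between, covers both variables.
  have hclosed : ∀ S : G →L[ℂ] K, (∀ a i b, adjoint S ∘L σ a ∘L V i ∘L π b ∈ Set.range π) →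
      ∀ T ∈ M₀.topologicalClosure, adjoint S ∘L T ∈ Set.range π := by
    intro S hS T hT
    let L : (G →L[ℂ] K) →L[ℂ] (G →L[ℂ] G) := compL ℂ G K G (adjoint S)
    refine closure_minimal (s := (M₀ : Set (G →L[ℂ] K))) (t := L ⁻¹' Set.range π) (fun U hU => ?_)
      (hrange.preimage L.continuous) hT
    have : M₀ ≤ (LinearMap.range (π : B →ₗ[ℂ] (G →L[ℂ] G))).comap L.toLinearMap :=
      Submodule.span_le.mpr (by
        rintro _ ⟨⟨a, i, b⟩, rfl⟩
        exact hS a i b)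
    exact this hU
  have hgen' : ∀ a i b, ∀ T ∈ M₀.topologicalClosure,
      adjoint (σ a ∘L V i ∘L π b) ∘L T ∈ Set.range π := fun a i b =>
    hclosed _ fun a' i' b' => ⟨star b * Φ i i' (star a * a') * b', by
      rw [← hV', map_mul, map_star, star_eq_adjoint]
      simp only [adjoint_comp, mul_def, comp_assoc]⟩
  have hin : ∀ S ∈ M₀.topologicalClosure, ∀ T ∈ M₀.topologicalClosure,
      ∃ b, π b = adjoint S ∘L T := fun S hS T hT =>
    hclosed S (fun a i b => by
      obtain ⟨c, hc⟩ := hgen' a i b S hS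
      refine ⟨star c, ?_⟩
      rw [map_star, hc, star_eq_adjoint, adjoint_comp, adjoint_adjoint]) T hT
  -- `V i` itself may lie outside the module; cutting it by `π 1` leaves the kernel unchanged
  -- because `π 1 * π b * π 1 = π b`.
  have hmem : ∀ i, V i ∘L π 1 ∈ M₀.topologicalClosure := fun i => M₀.le_topologicalClosure (by
    have h := hgen 1 i 1
    rwa [map_one] at h)
  choose! ip' hip' using hin
  let ip : M₀.topologicalClosure → M₀.topologicalClosure → B := fun S T => ip' S.1 T.1
  have hip : ∀ S T, π (ip S T) = adjoint S.1 ∘L T.1 := fun S T => hip' _ S.2 _ T.2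
  refine ⟨HilbertBimodule.ofOperators π hπ σ M₀.topologicalClosure M₀.isClosed_topologicalClosure
    hl hr h1 ip hip, fun i => ⟨V i ∘L π 1, hmem i⟩,
    fun i j a => hπ ?_⟩
  refine (hip _ ⟨σ a ∘L V j ∘L π 1, hl _ _ (hmem j)⟩).trans ?_
  rw [hV', star_one, one_mul, mul_one]

end Realization

end

section

open scoped ComplexOrder InnerProductSpace CStarAlgebra

/-! ### Correlations of two completely positive maps. -/

section Correlation

variable {A : Type u} [CStarAlgebra A] {B : Type v} [CStarAlgebra B]

/-- The value at `1` of the completely positive map `Φ₀₀ - Φ₀₁ - Φ₁₀ + Φ₁₁`. -/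
noncomputable def kernelDefect (Φ : Fin 2 → Fin 2 → A →ₗ[ℂ] B) : B :=
  Φ 0 0 1 - Φ 0 1 1 - Φ 1 0 1 + Φ 1 1 1

theorem kernelDefect_map {C : Type w} [CStarAlgebra C] (Φ : Fin 2 → Fin 2 → A →ₗ[ℂ] B)
    (θ : B →ₗ[ℂ] C) : kernelDefect (fun i j => θ ∘ₗ Φ i j) = θ (kernelDefect Φ) := by
  simp [kernelDefect]

variable [PartialOrder B] [StarOrderedRing B]

/-- `Φ` is a positive kernel with prescribed diagonal entries. -/
structure IsCorrelation (Φ : Fin 2 → Fin 2 → A →ₗ[ℂ] B) (φ₁ φ₂ : A →ₗ[ℂ] B) : Prop where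
  pos : IsPositiveKernel Φ
  fst : Φ 0 0 = φ₁
  snd : Φ 1 1 = φ₂

theorem IsPositiveKernel.map {C : Type w} [CStarAlgebra C] [PartialOrder C] [StarOrderedRing C]
    {ι : Type*} {Φ : ι → ι → A →ₗ[ℂ] B} (hΦ : IsPositiveKernel Φ) (θ : B →CP C) :
    IsPositiveKernel fun i j => θ.toLinearMap ∘ₗ Φ i j := fun n i a =>
  CompletelyPositiveMapClass.map_cstarMatrix_nonneg' θ n _ (hΦ n i a)

theorem IsCorrelation.map {C : Type w} [CStarAlgebra C] [PartialOrder C] [StarOrderedRing C]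
    {Φ : Fin 2 → Fin 2 → A →ₗ[ℂ] B} {φ₁ φ₂ : A →ₗ[ℂ] B} (hΦ : IsCorrelation Φ φ₁ φ₂)
    (θ : B →CP C) : IsCorrelation (fun i j => θ.toLinearMap ∘ₗ Φ i j) (θ.toLinearMap ∘ₗ φ₁)
      (θ.toLinearMap ∘ₗ φ₂) :=
  ⟨hΦ.pos.map θ, by rw [hΦ.fst], by rw [hΦ.snd]⟩

variable [PartialOrder A] [StarOrderedRing A]

/-- The diagonal kernel given by a family of completely positive maps. -/
theorem isPositiveKernel_diagonal {ι : Type*} [Fintype ι] [DecidableEq ι] (φ : ι → A →CP B) :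
    IsPositiveKernel fun i j => if i = j then (φ i).toLinearMap else 0 := by
  rw [isPositiveKernel_iff_sum]
  intro n i a b
  -- The form of a diagonal kernel splits by the value `j` of the index; each piece is the form of
  -- `φ j` applied to the positive matrix `a k* a l`.
  have hgram : ∀ j, 0 ≤ ∑ k, ∑ l, star (if i k = j then b k else 0) *
      φ j (star (a k) * a l) * (if i l = j then b l else 0) := fun j => by
    have h : 0 ≤ (CStarMatrix.ofMatrix fun k l => star (a k) * a l :
        CStarMatrix (Fin n) (Fin n) A) := by
      refine CStarMatrix.nonneg_of_forall_sum_nonneg fun c => ?_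
      have : ∑ k, ∑ l, star (c k) * (star (a k) * a l) * c l =
          star (∑ k, a k * c k) * ∑ l, a l * c l := by
        simp only [star_sum, Finset.sum_mul, Finset.mul_sum, star_mul, mul_assoc]
        exact Finset.sum_comm
      exact (star_mul_self_nonneg _).trans_eq this.symm
    exact CStarMatrix.sum_star_mul_mul_nonneg
      (CompletelyPositiveMapClass.map_cstarMatrix_nonneg' (φ j) n _ h) _
  refine (Finset.sum_nonneg fun j (_ : j ∈ Finset.univ) => hgram j).trans_eq ?_
  rw [Finset.sum_comm]
  refine Finset.sum_congr rfl fun k _ => ?_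
  rw [Finset.sum_comm]
  refine Finset.sum_congr rfl fun l _ => ?_
  rw [Finset.sum_eq_single_of_mem (i k) (Finset.mem_univ _)]
  · by_cases h : i k = i l
    · simp [h]; rfl
    · simp [h, Ne.symm h]
  · intro j _ hj
    simp [hj.symm]

/-- The off-diagonal entries are zero. The existence of some correlation keeps the infimum defining
`bures` from ranging over the empty set, where `sInf` would return `0`. -/
theorem exists_isCorrelation (φ₁ φ₂ : A →CP B) :
    ∃ Φ, IsCorrelation Φ φ₁.toLinearMap φ₂.toLinearMap :=
  ⟨_, isPositiveKernel_diagonal ![φ₁, φ₂], by simp, by simp⟩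

end Correlation

namespace HilbertBimodule

variable {A : Type u} [CStarAlgebra A] {B : Type v} [CStarAlgebra B] [PartialOrder B]
  (E : HilbertBimodule.{u, v, w} A B)

theorem ip_add_right (x y z : E) : E.ip x (y + z) = E.ip x y + E.ip x z := by simp [ip]

theorem ip_sub_right (x y z : E) : E.ip x (y - z) = E.ip x y - E.ip x z := by simp [ip]

theorem ip_sub_left (x y z : E) : E.ip (x - y) z = E.ip x z - E.ip y z := by simp [ip]

theorem ip_sum_right {T : Type*} (s : Finset T) (x : E) (y : T → E) :
    E.ip x (∑ t ∈ s, y t) = ∑ t ∈ s, E.ip x (y t) := by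
  simp [ip, CStarModule.inner_sum_right]

theorem ip_sum_left {T : Type*} (s : Finset T) (x : T → E) (y : E) :
    E.ip (∑ t ∈ s, x t) y = ∑ t ∈ s, E.ip (x t) y := by
  simp [ip, CStarModule.inner_sum_left]

theorem ip_smul_right (x y : E) (c : ℂ) : E.ip x (c • y) = c • E.ip x y := by simp [ip]

theorem ip_op_smul_left (x y : E) (b : B) :
    E.ip (MulOpposite.op b • x) y = star b * E.ip x y := by
  rw [← star_ip, ip_op_smul_right, star_mul, star_ip]

theorem ip_left_action (a : A) (x y : E) : E.ip (a • x) y = E.ip x (star a • y) := by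
  simp only [ip, E.inner_smul_left]

theorem ip_self_nonneg (x : E) : 0 ≤ E.ip x x :=
  (CStarModule.inner_self_nonneg (A := Bᵐᵒᵖ) (x := x) :)

variable {E} in
/-- The correlation kernel `Φᵢⱼ(a) = ⟨xᵢ, a xⱼ⟩` of a family of vectors. -/
noncomputable def kernel {ι : Type*} (x : ι → E) (i j : ι) : A →ₗ[ℂ] B where
  toFun a := E.ip (x i) (a • x j)
  map_add' a b := by rw [add_smul, ip_add_right]
  map_smul' c a := by rw [smul_assoc, ip_smul_right, RingHom.id_apply]

variable {E} in
theorem isPositiveKernel_kernel [StarOrderedRing B] {ι : Type*} (x : ι → E) :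
    IsPositiveKernel (kernel x) := by
  rw [isPositiveKernel_iff_sum]
  intro n i a b
  refine (E.ip_self_nonneg (∑ k, MulOpposite.op (b k) • (a k • x (i k)))).trans_eq ?_
  simp only [ip_sum_left, ip_sum_right, ip_op_smul_left, ip_op_smul_right, ip_left_action,
    kernel, ← mul_smul, LinearMap.coe_mk, AddHom.coe_mk, Finset.sum_mul, mul_assoc]
  exact Finset.sum_comm

variable {E} in
theorem norm_sub_eq_sqrt_defect (x : Fin 2 → E) : ‖x 0 - x 1‖ = √‖kernelDefect (kernel x)‖ := by
  rw [E.norm_eq_sqrt]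
  congr 2
  simp only [kernelDefect, kernel, ip_sub_left, ip_sub_right, LinearMap.coe_mk, AddHom.coe_mk,
    one_smul]
  abel

end HilbertBimodule

/-! ### The Bures distance as an infimum over correlations. -/

section BuresCharacterization

variable {A : Type u} [CStarAlgebra A] [PartialOrder A] [StarOrderedRing A]
  {B : Type v} [CStarAlgebra B] [PartialOrder B] [StarOrderedRing B] {φ₁ φ₂ : A →CP B}

theorem exists_isCorrelation_of_mem {E : HilbertBimodule.{u, v, w} A B} {x₁ x₂ : E}
    (h₁ : x₁ ∈ representingSet E φ₁) (h₂ : x₂ ∈ representingSet E φ₂) :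
    ∃ Φ, IsCorrelation Φ φ₁.toLinearMap φ₂.toLinearMap ∧ √‖kernelDefect Φ‖ = ‖x₁ - x₂‖ :=
  ⟨HilbertBimodule.kernel ![x₁, x₂], ⟨HilbertBimodule.isPositiveKernel_kernel _,
    LinearMap.ext fun a => (h₁ a).symm, LinearMap.ext fun a => (h₂ a).symm⟩,
    (HilbertBimodule.norm_sub_eq_sqrt_defect ![x₁, x₂]).symm⟩

/-- A positive kernel with diagonal entries `φ₁`, `φ₂` gives a common representation module. -/
theorem IsCorrelation.exists_mem {Φ : Fin 2 → Fin 2 → A →ₗ[ℂ] B}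
    (hΦ : IsCorrelation Φ φ₁.toLinearMap φ₂.toLinearMap) :
    ∃ E : HilbertBimodule.{u, v, max u v} A B, ∃ x₁ ∈ representingSet E φ₁,
      ∃ x₂ ∈ representingSet E φ₂, ‖x₁ - x₂‖ = √‖kernelDefect Φ‖ := by
  obtain ⟨G, _, _, _, π, hπ⟩ := exists_faithful_rep B
  obtain ⟨E, x, hx⟩ := hΦ.pos.exists_bimodule (π : B →⋆ₙₐ[ℂ] (G →L[ℂ] G)) hπ
  refine ⟨E, x 0, fun a => ?_, x 1, fun a => ?_, ?_⟩
  · rw [hx, hΦ.fst]; rfl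
  · rw [hx, hΦ.snd]; rfl
  · rw [HilbertBimodule.norm_sub_eq_sqrt_defect]
    congr 3
    funext i j
    exact LinearMap.ext fun a => hx i j a

theorem bddBelow_buresIn (E : HilbertBimodule.{u, v, w} A B) (φ₁ φ₂ : A →CP B) :
    BddBelow {r | ∃ x₁ ∈ representingSet E φ₁, ∃ x₂ ∈ representingSet E φ₂, r = ‖x₁ - x₂‖} :=
  ⟨0, by rintro _ ⟨x₁, -, x₂, -, rfl⟩; exact norm_nonneg _⟩

theorem buresIn_nonneg (E : HilbertBimodule.{u, v, w} A B) (φ₁ φ₂ : A →CP B) :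
    0 ≤ buresIn E φ₁ φ₂ :=
  Real.sInf_nonneg (by rintro _ ⟨x₁, -, x₂, -, rfl⟩; exact norm_nonneg _)

theorem buresIn_le_norm_sub {E : HilbertBimodule.{u, v, w} A B} {x₁ x₂ : E}
    (h₁ : x₁ ∈ representingSet E φ₁) (h₂ : x₂ ∈ representingSet E φ₂) :
    buresIn E φ₁ φ₂ ≤ ‖x₁ - x₂‖ :=
  csInf_le (bddBelow_buresIn E φ₁ φ₂) ⟨x₁, h₁, x₂, h₂, rfl⟩

theorem bures_nonneg (φ₁ φ₂ : A →CP B) : 0 ≤ bures φ₁ φ₂ :=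
  Real.sInf_nonneg (by rintro _ ⟨E, -, rfl⟩; exact buresIn_nonneg E φ₁ φ₂)

theorem bures_le_buresIn {E : HilbertBimodule.{u, v, max u v} A B}
    (h : IsCommonRepresentationModule E φ₁ φ₂) : bures φ₁ φ₂ ≤ buresIn E φ₁ φ₂ :=
  csInf_le ⟨0, by rintro _ ⟨E, -, rfl⟩; exact buresIn_nonneg E φ₁ φ₂⟩ ⟨E, h, rfl⟩

/-- Together with `exists_isCorrelation_lt` this replaces the infimum over modules and vectors by
one over kernels; modules reappear only for attainment. -/
theorem IsCorrelation.bures_le {Φ : Fin 2 → Fin 2 → A →ₗ[ℂ] B}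
    (hΦ : IsCorrelation Φ φ₁.toLinearMap φ₂.toLinearMap) : bures φ₁ φ₂ ≤ √‖kernelDefect Φ‖ := by
  obtain ⟨E, x₁, h₁, x₂, h₂, h⟩ := hΦ.exists_mem
  exact (bures_le_buresIn ⟨⟨x₁, h₁⟩, ⟨x₂, h₂⟩⟩).trans ((buresIn_le_norm_sub h₁ h₂).trans_eq h)

theorem exists_isCorrelation_lt {r : ℝ} (h : bures φ₁ φ₂ < r) :
    ∃ Φ, IsCorrelation Φ φ₁.toLinearMap φ₂.toLinearMap ∧ √‖kernelDefect Φ‖ < r := by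
  obtain ⟨Φ, hΦ⟩ := exists_isCorrelation φ₁ φ₂
  obtain ⟨E, x₁, h₁, x₂, h₂, -⟩ := hΦ.exists_mem
  have hne : {r | ∃ E : HilbertBimodule.{u, v, max u v} A B,
      IsCommonRepresentationModule E φ₁ φ₂ ∧ r = buresIn E φ₁ φ₂}.Nonempty :=
    ⟨_, E, ⟨⟨x₁, h₁⟩, ⟨x₂, h₂⟩⟩, rfl⟩
  obtain ⟨_, ⟨E, ⟨⟨y₁, k₁⟩, ⟨y₂, k₂⟩⟩, rfl⟩, hr⟩ := exists_lt_of_csInf_lt hne h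
  have hne' : {r | ∃ x₁ ∈ representingSet E φ₁, ∃ x₂ ∈ representingSet E φ₂,
      r = ‖x₁ - x₂‖}.Nonempty := ⟨_, y₁, k₁, y₂, k₂, rfl⟩
  obtain ⟨_, ⟨z₁, l₁, z₂, l₂, rfl⟩, hr'⟩ := exists_lt_of_csInf_lt hne' hr
  obtain ⟨Φ, hΦ, hd⟩ := exists_isCorrelation_of_mem l₁ l₂
  exact ⟨Φ, hΦ, hd.trans_lt hr'⟩

theorem le_bures {r : ℝ}
    (h : ∀ Φ, IsCorrelation Φ φ₁.toLinearMap φ₂.toLinearMap → r ≤ √‖kernelDefect Φ‖) :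
    r ≤ bures φ₁ φ₂ := by
  by_contra! hr
  obtain ⟨Φ, hΦ, hd⟩ := exists_isCorrelation_lt hr
  exact (h Φ hΦ).not_gt hd

end BuresCharacterization

/-! ### Injectivity: retraction of `B(G)` onto the algebra. -/

section Injective

variable {B : Type v} [CStarAlgebra B] [PartialOrder B] [StarOrderedRing B]
  {G : Type v} [NormedAddCommGroup G] [InnerProductSpace ℂ G] [CompleteSpace G]

/-- An injective C*-algebra is the range of a completely positive contraction on `B(G)`, for every
faithful representation on `G`. -/
theorem IsInjectiveCStarAlgebra.exists_retraction (hB : IsInjectiveCStarAlgebra B)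
    (π : B →⋆ₙₐ[ℂ] (G →L[ℂ] G)) (hπ : Function.Injective π) :
    ∃ P : (G →L[ℂ] G) →CP B, (∀ T, ‖P T‖ ≤ ‖T‖) ∧ ∀ b, P (π b) = b := by
  set p := π 1 with hp
  have hpp : p * p = p := by rw [hp, ← map_mul, one_mul]
  have hps : star p = p := by rw [hp, ← map_star, star_one]
  have hpn : ‖p‖ ≤ 1 := by
    have h := CStarRing.norm_star_mul_self (x := p)
    rw [hps, hpp] at h
    nlinarith [norm_nonneg p]
  -- For non-unital `π` the range need not contain `1`. The space of all `x` with `p x p ∈ π(B)`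
  -- contains both `1` and `π(B)`, and `x ↦ π⁻¹(p x p)` is the map to extend.
  let S : Submodule ℂ (G →L[ℂ] G) :=
    (LinearMap.range (π : B →ₗ[ℂ] (G →L[ℂ] G))).comap
      (LinearMap.mulLeft ℂ p ∘ₗ LinearMap.mulRight ℂ p)
  have hS : ∀ x : S, ∃ b, π b = p * (x.1 * p) := fun x => x.2
  have hSop : IsOperatorSystem S := by
    refine ⟨⟨1, ?_⟩, ?_⟩
    · change π 1 = p * (1 * p)
      rw [one_mul, hpp]
    · rintro x ⟨b, hb⟩
      refine ⟨star b, ?_⟩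
      change π b = p * (x * p) at hb
      change π (star b) = p * (star x * p)
      rw [map_star, hb, star_mul, star_mul, hps, mul_assoc]
  choose β hβ using hS
  let φ : S →ₗ[ℂ] B :=
    { toFun := β
      map_add' := fun x y => hπ (by simp [hβ, add_mul, mul_add])
      map_smul' := fun c x => hπ (by simp [hβ]) }
  have hφ : ∀ s, π (φ s) = p * (s.1 * p) := hβ
  obtain ⟨P, hP, hPφ⟩ := hB (G →L[ℂ] G) S hSop φ (fun n M hM => by
    rw [CStarMatrix.nonneg_iff_forall_inner π hπ]
    rw [CStarMatrix.nonneg_iff_forall_inner (NonUnitalStarAlgHom.id ℂ (G →L[ℂ] G))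
      Function.injective_id] at hM
    intro g
    -- The form of the compressed matrix at `g` is the form of `M` at the vectors `p (g k)`.
    refine (hM fun k => p (g k)).trans_eq ?_
    refine Finset.sum_congr rfl fun k _ => Finset.sum_congr rfl fun l _ => ?_
    change ⟪p (g k), (M k l).1 (p (g l))⟫_ℂ = ⟪g k, π (φ (M k l)) (g l)⟫_ℂ
    rw [hφ, ← ContinuousLinearMap.adjoint_inner_right, ← ContinuousLinearMap.star_eq_adjoint, hps]
    rfl) fun s => by
      rw [← NonUnitalStarAlgHom.norm_map π hπ, hφ]
      refine (norm_mul_le _ _).trans ?_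
      have := norm_mul_le s.1 p
      have h2 : ‖s.1 * p‖ ≤ ‖s.1‖ := this.trans (mul_le_of_le_one_right (norm_nonneg _) hpn)
      exact (mul_le_of_le_one_left (norm_nonneg _) hpn).trans h2
  refine ⟨P, hP, fun b => ?_⟩
  have hb : π b ∈ S := ⟨b, by
    change π b = p * (π b * p)
    rw [hp, ← map_mul, ← map_mul, one_mul, mul_one]⟩
  rw [hPφ ⟨π b, hb⟩]
  refine hπ ?_
  rw [hφ]
  change p * (π b * p) = π b
  rw [hp, ← map_mul, ← map_mul, one_mul, mul_one]

variable {A : Type u} [CStarAlgebra A] [PartialOrder A] [StarOrderedRing A]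

/-- The Bures distance over an injective C*-algebra can be computed in a faithful representation. -/
theorem IsInjectiveCStarAlgebra.bures_eq (hB : IsInjectiveCStarAlgebra B)
    (π : B →⋆ₙₐ[ℂ] (G →L[ℂ] G)) (hπ : Function.Injective π) (φ₁ φ₂ : A →CP B) :
    bures φ₁ φ₂ = bures (starHomComp π φ₁) (starHomComp π φ₂) := by
  obtain ⟨P, hP, hPπ⟩ := hB.exists_retraction π hπ
  refine le_antisymm (le_bures fun Φ hΦ => ?_) (le_bures fun Φ hΦ => ?_)
  -- The retraction brings correlations over `B(G)` down to `B`; in the other direction `π` carries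
  -- them up. Both are contractive on the defect.
  · have h := hΦ.map P
    have h1 : ∀ φ : A →CP B, P.toLinearMap ∘ₗ (starHomComp π φ).toLinearMap = φ.toLinearMap :=
      fun φ => LinearMap.ext fun a => hPπ (φ a)
    rw [h1, h1] at h
    refine h.bures_le.trans (Real.sqrt_le_sqrt ?_)
    rw [kernelDefect_map]
    exact hP _
  · refine (hΦ.map (π : B →CP (G →L[ℂ] G))).bures_le.trans (Real.sqrt_le_sqrt ?_)
    rw [kernelDefect_map]
    exact (NonUnitalStarAlgHom.norm_map π hπ _).le

end Injective

/-! ### Completely bounded norms and the lower estimate. -/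

section CompleteBoundedness

open ContinuousLinearMap

variable {A : Type u} [CStarAlgebra A] [PartialOrder A] [StarOrderedRing A]
  {B : Type v} [CStarAlgebra B]
  {G : Type*} [NormedAddCommGroup G] [InnerProductSpace ℂ G] [CompleteSpace G]
  {n : Type*} [Fintype n] [DecidableEq n]

/-- Links the norm to vectors through the order: `‖M‖² ≤ c` amounts to `c·1 - M*M ≥ 0`, whose form
is computed here. -/
theorem CStarMatrix.sum_inner_smul_one_sub (π : B →⋆ₐ[ℂ] (G →L[ℂ] G)) (M : CStarMatrix n n B)
    (c : ℝ) (g : n → G) :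
    ∑ k, ∑ l, ⟪g k, π (((c : ℂ) • (1 : CStarMatrix n n B) - star M * M) k l) (g l)⟫_ℂ =
      ((c * ∑ k, ‖g k‖ ^ 2 - ∑ p, ‖∑ l, π (M p l) (g l)‖ ^ 2 : ℝ) : ℂ) := by
  have h := CStarMatrix.sum_inner_star_mul_self (π : B →⋆ₙₐ[ℂ] (G →L[ℂ] G)) M g
  simp only [inner_self_eq_norm_sq_to_K] at h
  have h1 : ∀ k l, ⟪g k, π (((c : ℂ) • (1 : CStarMatrix n n B)) k l) (g l)⟫_ℂ =
      if k = l then c * (‖g k‖ : ℂ) ^ 2 else 0 := fun k l => by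
    rw [CStarMatrix.smul_apply, map_smul, _root_.smul_apply, inner_smul_right, CStarMatrix.one_apply]
    split_ifs with hkl
    · rw [hkl, map_one, one_apply_eq_self, inner_self_eq_norm_sq_to_K]; rfl
    · rw [map_zero, _root_.zero_apply, inner_zero_right, mul_zero]
  have h2 : ∀ k l, ⟪g k, π (((c : ℂ) • (1 : CStarMatrix n n B) - star M * M) k l) (g l)⟫_ℂ =
      (if k = l then c * (‖g k‖ : ℂ) ^ 2 else 0) - ⟪g k, π ((star M * M) k l) (g l)⟫_ℂ := fun k l => by
    rw [CStarMatrix.sub_apply, map_sub, _root_.sub_apply, inner_sub_right, h1]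
  simp only [h2, Finset.sum_sub_distrib, Finset.sum_ite_eq, Finset.mem_univ, if_true]
  push_cast
  rw [Finset.mul_sum]
  congr 1

variable [PartialOrder B] [StarOrderedRing B]

/-- The amplification of a representation is contractive. -/
theorem CStarMatrix.sum_norm_sq_le (π : B →⋆ₐ[ℂ] (G →L[ℂ] G)) (M : CStarMatrix n n B)
    (g : n → G) : ∑ p, ‖∑ l, π (M p l) (g l)‖ ^ 2 ≤ ‖M‖ ^ 2 * ∑ k, ‖g k‖ ^ 2 := by
  have h := CStarMatrix.sum_inner_nonneg (π : B →⋆ₙₐ[ℂ] (G →L[ℂ] G))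
    (CStarAlgebra.smul_one_sub_star_mul_self_nonneg M) g
  have h2 := h.trans_eq (CStarMatrix.sum_inner_smul_one_sub π M _ g)
  rw [Complex.zero_le_real] at h2
  linarith

/-- The amplification of a faithful representation is isometric. -/
theorem CStarMatrix.norm_le_of_sum_norm_sq_le (π : B →⋆ₐ[ℂ] (G →L[ℂ] G))
    (hπ : Function.Injective π) {M : CStarMatrix n n B} {C : ℝ} (hC : 0 ≤ C)
    (h : ∀ g : n → G, ∑ p, ‖∑ l, π (M p l) (g l)‖ ^ 2 ≤ C ^ 2 * ∑ k, ‖g k‖ ^ 2) : ‖M‖ ≤ C := by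
  refine CStarAlgebra.norm_le_of_nonneg_smul_one_sub hC ?_
  rw [CStarMatrix.nonneg_iff_forall_inner (π : B →⋆ₙₐ[ℂ] (G →L[ℂ] G)) hπ]
  intro g
  refine LE.le.trans_eq ?_ (CStarMatrix.sum_inner_smul_one_sub π M _ g).symm
  rw [Complex.zero_le_real]
  linarith [h g]

variable {K : Type*} [NormedAddCommGroup K] [InnerProductSpace ℂ K] [CompleteSpace K]

/-- A map of the form `V* σ(·) W` is completely bounded by `‖V‖ ‖W‖`: the amplification of `σ` is
contractive, and `V*` and `W` act diagonally. -/
theorem CStarMatrix.norm_le_of_eq_comp (π : B →⋆ₐ[ℂ] (G →L[ℂ] G)) (hπ : Function.Injective π)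
    (σ : A →⋆ₐ[ℂ] (K →L[ℂ] K)) (V W : G →L[ℂ] K) {M : CStarMatrix n n A} {N : CStarMatrix n n B}
    (h : ∀ p l, π (N p l) = adjoint V ∘L σ (M p l) ∘L W) : ‖N‖ ≤ ‖V‖ * ‖W‖ * ‖M‖ := by
  refine norm_le_of_sum_norm_sq_le π hπ (by positivity) fun g => ?_
  calc ∑ p, ‖∑ l, π (N p l) (g l)‖ ^ 2
      ≤ ∑ p, ‖V‖ ^ 2 * ‖∑ l, σ (M p l) (W (g l))‖ ^ 2 := by
        refine Finset.sum_le_sum fun p _ => ?_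
        rw [← mul_pow]
        refine pow_le_pow_left₀ (norm_nonneg _) ?_ 2
        simp only [h, comp_apply, ← map_sum]
        exact (le_opNorm _ _).trans_eq (by rw [LinearIsometryEquiv.norm_map])
    _ ≤ ‖V‖ ^ 2 * (‖M‖ ^ 2 * ∑ k, ‖W (g k)‖ ^ 2) := by
        rw [← Finset.mul_sum]
        exact mul_le_mul_of_nonneg_left (sum_norm_sq_le σ M _) (sq_nonneg _)
    _ ≤ ‖V‖ ^ 2 * (‖M‖ ^ 2 * ∑ k, ‖W‖ ^ 2 * ‖g k‖ ^ 2) := by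
        gcongr with k
        rw [← mul_pow]
        exact pow_le_pow_left₀ (norm_nonneg _) (le_opNorm _ _) 2
    _ = (‖V‖ * ‖W‖ * ‖M‖) ^ 2 * ∑ k, ‖g k‖ ^ 2 := by
        rw [← Finset.mul_sum]; ring

theorem cbNorm_le {φ : A →ₗ[ℂ] B} {C : ℝ} (hC : 0 ≤ C)
    (h : ∀ (n : ℕ) (M : CStarMatrix (Fin n) (Fin n) A), ‖M.map φ‖ ≤ C * ‖M‖) : cbNorm φ ≤ C :=
  Real.sSup_le (by
    rintro _ ⟨n, M, hM, rfl⟩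
    exact (h n M).trans (mul_le_of_le_one_right hC hM)) hC

theorem IsCompletelyBounded.norm_map_le_cbNorm {φ : A →ₗ[ℂ] B} (hφ : IsCompletelyBounded φ) {n : ℕ}
    {M : CStarMatrix (Fin n) (Fin n) A} (hM : ‖M‖ ≤ 1) : ‖M.map φ‖ ≤ cbNorm φ := by
  obtain ⟨C, hC⟩ := hφ
  refine le_csSup ⟨|C|, ?_⟩ ⟨n, M, hM, rfl⟩
  rintro _ ⟨n, M, hM, rfl⟩
  exact (hC n M).trans ((mul_le_mul_of_nonneg_right (le_abs_self C) (norm_nonneg _)).trans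
    (mul_le_of_le_one_right (abs_nonneg C) hM))

theorem IsCompletelyBounded.norm_map_one_le_cbNorm {φ : A →ₗ[ℂ] B} (hφ : IsCompletelyBounded φ) :
    ‖φ 1‖ ≤ cbNorm φ := by
  have h := hφ.norm_map_le_cbNorm (n := 1) (M := 1) CStarAlgebra.norm_one_le
  refine le_trans ?_ h
  have := CStarMatrix.norm_entry_le_norm (M := (1 : CStarMatrix (Fin 1) (Fin 1) A).map φ) (i := 0)
    (j := 0)
  simpa using this

/-- A positive kernel bounds the completely bounded norm of the difference of its diagonal
entries. -/
theorem IsCorrelation.cb_estimates {Φ : Fin 2 → Fin 2 → A →ₗ[ℂ] B} {φ₁ φ₂ : A →ₗ[ℂ] B}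
    (hΦ : IsCorrelation Φ φ₁ φ₂) : IsCompletelyBounded φ₁ ∧ IsCompletelyBounded φ₂ ∧
      IsCompletelyBounded (φ₁ - φ₂) ∧
      cbNorm (φ₁ - φ₂) ≤ √‖kernelDefect Φ‖ * (√(cbNorm φ₁) + √(cbNorm φ₂)) := by
  obtain ⟨G, _, _, _, π, hπ⟩ := exists_faithful_rep B
  obtain ⟨K, _, _, _, σ, V, hV, -⟩ := hΦ.pos.exists_stinespring (π : B →⋆ₙₐ[ℂ] (G →L[ℂ] G)) hπ
  have hV' : ∀ i j a, π (Φ i j a) = adjoint (V i) ∘L σ a ∘L V j := fun i j a =>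
    ContinuousLinearMap.ext fun g => ext_inner_left ℂ fun h => by
      rw [comp_apply, adjoint_inner_right, comp_apply, hV]; rfl
  have hnorm : ∀ i, ‖V i‖ ^ 2 = ‖Φ i i 1‖ := fun i => by
    rw [← NonUnitalStarAlgHom.norm_map π hπ, hV', map_one, sq, ← norm_adjoint_comp_self]; rfl
  have hdef : ‖V 0 - V 1‖ = √‖kernelDefect Φ‖ := by
    rw [← NonUnitalStarAlgHom.norm_map π hπ, kernelDefect]
    simp only [map_add, map_sub, hV']
    have : adjoint (V 0) ∘L σ 1 ∘L V 0 - adjoint (V 0) ∘L σ 1 ∘L V 1 -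
        adjoint (V 1) ∘L σ 1 ∘L V 0 + adjoint (V 1) ∘L σ 1 ∘L V 1 =
        adjoint (V 0 - V 1) ∘L (V 0 - V 1) := by
      rw [map_one, one_def, map_sub, sub_comp, comp_sub, comp_sub]
      simp only [id_comp]
      abel
    rw [this, norm_adjoint_comp_self, Real.sqrt_mul_self (norm_nonneg _)]
  have hcb : ∀ i j n (M : CStarMatrix (Fin n) (Fin n) A),
      ‖M.map (Φ i j)‖ ≤ ‖V i‖ * ‖V j‖ * ‖M‖ := fun i j n M =>
    CStarMatrix.norm_le_of_eq_comp π hπ σ (V i) (V j) fun p l => hV' i j _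
  have h1 : IsCompletelyBounded φ₁ := ⟨_, hΦ.fst ▸ hcb 0 0⟩
  have h2 : IsCompletelyBounded φ₂ := ⟨_, hΦ.snd ▸ hcb 1 1⟩
  have h3 : ∀ n (M : CStarMatrix (Fin n) (Fin n) A), ‖M.map (φ₁ - φ₂)‖ ≤
      √‖kernelDefect Φ‖ * (‖V 0‖ + ‖V 1‖) * ‖M‖ := fun n M => by
    -- Passing from `Φ₀₀` to `Φ₁₁` through `Φ₀₁` changes one of the two operators at a time, so each
    -- difference carries a factor `V 0 - V 1`.
    have ha : ‖M.map (Φ 0 0 - Φ 0 1)‖ ≤ ‖V 0‖ * ‖V 0 - V 1‖ * ‖M‖ :=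
      CStarMatrix.norm_le_of_eq_comp π hπ σ _ _ fun p l => by
        simp only [CStarMatrix.map_apply, LinearMap.sub_apply, map_sub, hV', comp_sub]
    have hb : ‖M.map (Φ 0 1 - Φ 1 1)‖ ≤ ‖V 0 - V 1‖ * ‖V 1‖ * ‖M‖ :=
      CStarMatrix.norm_le_of_eq_comp π hπ σ _ _ fun p l => by
        simp only [CStarMatrix.map_apply, LinearMap.sub_apply, map_sub, hV', sub_comp]
    have hs : M.map (φ₁ - φ₂) = M.map (Φ 0 0 - Φ 0 1) + M.map (Φ 0 1 - Φ 1 1) := by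
      ext p l
      simp [← hΦ.fst, ← hΦ.snd]
    rw [hs, ← hdef]
    refine (norm_add_le _ _).trans ((add_le_add ha hb).trans_eq (by ring))
  refine ⟨h1, h2, ⟨_, h3⟩, (cbNorm_le (by positivity) h3).trans ?_⟩
  have hle : ∀ i, IsCompletelyBounded (Φ i i) → ‖V i‖ ≤ √(cbNorm (Φ i i)) := fun i hi =>
    Real.le_sqrt_of_sq_le ((hnorm i).trans_le hi.norm_map_one_le_cbNorm)
  have e1 := hle 0 (hΦ.fst ▸ h1)
  have e2 := hle 1 (hΦ.snd ▸ h2)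
  rw [hΦ.fst] at e1
  rw [hΦ.snd] at e2
  gcongr

end CompleteBoundedness

end

section

open scoped ComplexOrder InnerProductSpace CStarAlgebra Topology
open Filter

/-! ### Kernels with values in `B(G)`. -/

section Gram

open ContinuousLinearMap

variable {A : Type u} [CStarAlgebra A]
  {G : Type v} [NormedAddCommGroup G] [InnerProductSpace ℂ G] [CompleteSpace G]
  {K : Type*} [NormedAddCommGroup K] [InnerProductSpace ℂ K] [CompleteSpace K] {ι : Type*}

theorem isPositiveKernel_iff_inner_self {Φ : ι → ι → A →ₗ[ℂ] (G →L[ℂ] G)} : IsPositiveKernel Φ ↔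
    ∀ (n : ℕ) (i : Fin n → ι) (a : Fin n → A) (g : Fin n → G),
      0 ≤ ∑ k, ∑ l, ⟪g k, Φ (i k) (i l) (star (a k) * a l) (g l)⟫_ℂ :=
  isPositiveKernel_iff_inner (NonUnitalStarAlgHom.id ℂ (G →L[ℂ] G)) Function.injective_id

theorem IsPositiveKernel.exists_stinespring_self {ι : Type w} {Φ : ι → ι → A →ₗ[ℂ] (G →L[ℂ] G)}
    (hΦ : IsPositiveKernel Φ) :
    ∃ (K : Type max u v w) (_ : NormedAddCommGroup K) (_ : InnerProductSpace ℂ K)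
      (_ : CompleteSpace K) (σ : A →⋆ₐ[ℂ] (K →L[ℂ] K)) (V : ι → G →L[ℂ] K),
      (∀ i j a g h, ⟪V i g, σ a (V j h)⟫_ℂ = ⟪g, Φ i j a h⟫_ℂ) ∧
      DenseRange (Finsupp.linearCombination ℂ fun p : A × (ι × G) => σ p.1 (V p.2.1 p.2.2)) :=
  hΦ.exists_stinespring (NonUnitalStarAlgHom.id ℂ (G →L[ℂ] G)) Function.injective_id

theorem IsPositiveKernel.add {Φ Ψ : ι → ι → A →ₗ[ℂ] (G →L[ℂ] G)} (hΦ : IsPositiveKernel Φ)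
    (hΨ : IsPositiveKernel Ψ) : IsPositiveKernel fun i j => Φ i j + Ψ i j := fun n i a =>
  add_nonneg (hΦ n i a) (hΨ n i a)

/-- The kernel `Xᵢ* σ(a) Xⱼ`. -/
noncomputable def gramKernel (σ : A →⋆ₐ[ℂ] (K →L[ℂ] K)) (X : ι → G →L[ℂ] K) (i j : ι) :
    A →ₗ[ℂ] (G →L[ℂ] G) where
  toFun a := adjoint (X i) ∘L σ a ∘L X j
  map_add' a b := by rw [map_add, add_comp, comp_add]
  map_smul' c a := by rw [map_smul, smul_comp, comp_smul, RingHom.id_apply]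

theorem inner_gramKernel (σ : A →⋆ₐ[ℂ] (K →L[ℂ] K)) (X : ι → G →L[ℂ] K) (i j : ι) (a : A)
    (g h : G) : ⟪g, gramKernel σ X i j a h⟫_ℂ = ⟪X i g, σ a (X j h)⟫_ℂ := by
  change ⟪g, adjoint (X i) (σ a (X j h))⟫_ℂ = _
  rw [adjoint_inner_right]

theorem isPositiveKernel_gramKernel (σ : A →⋆ₐ[ℂ] (K →L[ℂ] K)) (X : ι → G →L[ℂ] K) :
    IsPositiveKernel (gramKernel σ X) := by
  rw [isPositiveKernel_iff_inner_self]
  intro n i a g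
  refine (inner_self_nonneg_complex (∑ k, σ (a k) (X (i k) (g k)))).trans_eq ?_
  simp only [inner_gramKernel, map_mul, map_star, mul_apply_eq_comp, star_eq_adjoint,
    adjoint_inner_right, sum_inner, inner_sum]
  exact Finset.sum_comm

theorem norm_le_of_inner_le {T : G →L[ℂ] G} {c : ℝ} (hc : 0 ≤ c) (hT : 0 ≤ T)
    (h : ∀ g, (⟪g, T g⟫_ℂ).re ≤ c * ‖g‖ ^ 2) : ‖T‖ ≤ c := by
  rw [CStarAlgebra.norm_le_iff_le_algebraMap T hc hT, ← sub_nonneg, nonneg_iff_forall_inner]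
  intro g
  have him := (Complex.le_def.mp ((nonneg_iff_forall_inner T).mp hT g)).2
  have h1 : ⟪g, (algebraMap ℝ (G →L[ℂ] G) c - T) g⟫_ℂ = ((c * ‖g‖ ^ 2 : ℝ) : ℂ) - ⟪g, T g⟫_ℂ := by
    rw [_root_.sub_apply, inner_sub_right, Algebra.algebraMap_eq_smul_one, _root_.smul_apply,
      one_apply_eq_self, inner_smul_right_eq_smul, inner_self_eq_norm_sq_to_K, Complex.real_smul]
    push_cast
    rfl
  rw [h1, Complex.le_def]
  simp only [Complex.zero_re, Complex.sub_re, Complex.ofReal_re, Complex.zero_im, Complex.sub_im,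
    Complex.ofReal_im] at him ⊢
  exact ⟨by linarith [h g], by linarith⟩

variable {Φ : Fin 2 → Fin 2 → A →ₗ[ℂ] (G →L[ℂ] G)} {V : Fin 2 → G →L[ℂ] K}
  {σ : A →⋆ₐ[ℂ] (K →L[ℂ] K)}

theorem inner_kernelDefect (hV : ∀ i j a g h, ⟪V i g, σ a (V j h)⟫_ℂ = ⟪g, Φ i j a h⟫_ℂ) (g h : G) :
    ⟪g, kernelDefect Φ h⟫_ℂ = ⟪V 0 g - V 1 g, V 0 h - V 1 h⟫_ℂ := by
  have h1 : ∀ i j, ⟪g, Φ i j 1 h⟫_ℂ = ⟪V i g, V j h⟫_ℂ := fun i j => by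
    rw [← hV, map_one, one_apply_eq_self]
  rw [kernelDefect]
  simp only [_root_.add_apply, _root_.sub_apply, inner_add_right, inner_sub_right, inner_sub_left,
    h1]
  ring

theorem norm_sub_le_of_kernelDefect (hV : ∀ i j a g h, ⟪V i g, σ a (V j h)⟫_ℂ = ⟪g, Φ i j a h⟫_ℂ)
    (g : G) : ‖V 0 g - V 1 g‖ ≤ √‖kernelDefect Φ‖ * ‖g‖ := by
  rw [← sq_le_sq₀ (norm_nonneg _) (by positivity), mul_pow, Real.sq_sqrt (norm_nonneg _),
    ← inner_self_eq_norm_sq (𝕜 := ℂ), ← inner_kernelDefect hV]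
  refine (Complex.re_le_norm _).trans ((norm_inner_le_norm _ _).trans ?_)
  have := (kernelDefect Φ).le_opNorm g
  nlinarith [norm_nonneg g]

end Gram

/-! ### Gluing of correlations and the triangle inequality. -/

section Triangle

open ContinuousLinearMap

variable {A : Type u} [CStarAlgebra A]
  {G : Type v} [NormedAddCommGroup G] [InnerProductSpace ℂ G] [CompleteSpace G]

/-- Gluing of two correlations along the common diagonal entry. -/
theorem IsCorrelation.trans {Φ Ψ : Fin 2 → Fin 2 → A →ₗ[ℂ] (G →L[ℂ] G)}
    {φ₁ φ₂ φ₃ : A →ₗ[ℂ] (G →L[ℂ] G)} (hΦ : IsCorrelation Φ φ₁ φ₂) (hΨ : IsCorrelation Ψ φ₂ φ₃) :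
    ∃ Θ, IsCorrelation Θ φ₁ φ₃ ∧ √‖kernelDefect Θ‖ ≤ √‖kernelDefect Φ‖ + √‖kernelDefect Ψ‖ := by
  have hφ : IsPositiveKernel fun _ _ : Unit => φ₂ := fun n _ a => by
    simpa [hΦ.snd] using hΦ.pos n (fun _ => 1) a
  obtain ⟨K₀, _, _, _, σ₀, U, hU, hU'⟩ := hφ.exists_stinespring_self
  obtain ⟨K₁, _, _, _, σ₁, V, hV, -⟩ := hΦ.pos.exists_stinespring_self
  obtain ⟨K₂, _, _, _, σ₂, W, hW, -⟩ := hΨ.pos.exists_stinespring_self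
  obtain ⟨I, hI, hIU, hIσ⟩ := exists_intertwining_isometry σ₀ σ₁ (fun p : Unit × G => U p.1 p.2)
    (fun p => V 1 p.2) (fun p q a => by rw [hU, hV, hΦ.snd]) hU'
  obtain ⟨J, hJ, hJU, hJσ⟩ := exists_intertwining_isometry σ₀ σ₂ (fun p : Unit × G => U p.1 p.2)
    (fun p => W 0 p.2) (fun p q a => by rw [hU, hW, hΨ.fst]) hU'
  have hI' : ∀ x y, ⟪I x, I y⟫_ℂ = ⟪x, y⟫_ℂ :=
    (LinearIsometry.mk I.toLinearMap hI).inner_map_map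
  have hJ' : ∀ x y, ⟪J x, J y⟫_ℂ = ⟪x, y⟫_ℂ :=
    (LinearIsometry.mk J.toLinearMap hJ).inner_map_map
  have hJJ : ∀ x, adjoint J (J x) = x := fun x =>
    ext_inner_left ℂ fun y => by rw [adjoint_inner_right, hJ']
  have hIσ' : ∀ a x, σ₁ a (I x) = I (σ₀ a x) := fun a x => (DFunLike.congr_fun (hIσ a) x).symm
  have hJσ' : ∀ a x, σ₂ a (J x) = J (σ₀ a x) := fun a x => (DFunLike.congr_fun (hJσ a) x).symm
  have hJadj : ∀ a y, adjoint J (σ₂ a y) = σ₀ a (adjoint J y) := fun a y =>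
    ext_inner_left ℂ fun x => by
      rw [adjoint_inner_right, ← adjoint_inner_left, ← star_eq_adjoint, ← map_star, hJσ',
        ← adjoint_inner_right, ← adjoint_inner_left (σ₀ a), ← star_eq_adjoint (σ₀ a), ← map_star]
  -- The common space is `K₁ ⊕ (K₂ ⊖ J K₀)`: the part of `W 1` in `J K₀` is moved into `K₁` by `I
  -- J*`, the rest stays in `K₂`. As `J J*` commutes with `σ₂`, both parts respect the actions and
  -- `φ₃` is recovered.
  let X : Fin 2 → G →L[ℂ] K₁ := ![V 0, I ∘L adjoint J ∘L W 1]
  let Y : Fin 2 → G →L[ℂ] K₂ := ![0, W 1 - J ∘L adjoint J ∘L W 1]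
  have hY1 : ∀ g, Y 1 g = W 1 g - J (adjoint J (W 1 g)) := fun g => rfl
  refine ⟨fun i j => gramKernel σ₁ X i j + gramKernel σ₂ Y i j,
    ⟨(isPositiveKernel_gramKernel σ₁ X).add (isPositiveKernel_gramKernel σ₂ Y), ?_, ?_⟩, ?_⟩
  · refine LinearMap.ext fun a => ContinuousLinearMap.ext fun g => ext_inner_left ℂ fun h => ?_
    rw [LinearMap.add_apply, _root_.add_apply, inner_add_right, inner_gramKernel, inner_gramKernel]
    simp [X, Y, hV, hΦ.fst]
  · refine LinearMap.ext fun a => ContinuousLinearMap.ext fun g => ext_inner_left ℂ fun h => ?_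
    rw [LinearMap.add_apply, _root_.add_apply, inner_add_right, inner_gramKernel, inner_gramKernel,
      hY1, hY1]
    change ⟪I (adjoint J (W 1 h)), σ₁ a (I (adjoint J (W 1 g)))⟫_ℂ + _ = _
    rw [hIσ', hI', map_sub, hJσ', ← hJadj]
    simp only [inner_sub_left, inner_sub_right, hJ']
    rw [← adjoint_inner_left J, ← adjoint_inner_right J, hW, hΨ.snd]
    simp only [adjoint_inner_right]
    ring
  · have hd : ∀ g, ⟪g, kernelDefect (fun i j => gramKernel σ₁ X i j + gramKernel σ₂ Y i j) g⟫_ℂ =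
        ⟪X 0 g - X 1 g, X 0 g - X 1 g⟫_ℂ + ⟪Y 0 g - Y 1 g, Y 0 g - Y 1 g⟫_ℂ := fun g => by
      have e : kernelDefect (fun i j => gramKernel σ₁ X i j + gramKernel σ₂ Y i j) =
          kernelDefect (gramKernel σ₁ X) + kernelDefect (gramKernel σ₂ Y) := by
        simp only [kernelDefect, LinearMap.add_apply]; abel
      rw [e, _root_.add_apply, inner_add_right,
        inner_kernelDefect fun i j a g h => (inner_gramKernel σ₁ X i j a g h).symm,
        inner_kernelDefect fun i j a g h => (inner_gramKernel σ₂ Y i j a g h).symm]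
    refine (Real.sqrt_le_left (by positivity)).mpr (norm_le_of_inner_le (by positivity)
      ((nonneg_iff_forall_inner _).mpr fun g => ?_) fun g => ?_)
    · rw [hd]
      exact add_nonneg (inner_self_nonneg_complex _) (inner_self_nonneg_complex _)
    · rw [hd, Complex.add_re]
      have hre : ∀ {K : Type (max u v)} [NormedAddCommGroup K] [InnerProductSpace ℂ K] (z : K),
          (⟪z, z⟫_ℂ).re = ‖z‖ ^ 2 := fun z => inner_self_eq_norm_sq (𝕜 := ℂ) z
      rw [hre, hre]
      set v := W 0 g - W 1 g with hv
      set u := V 0 g - V 1 g with hu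
      have hp := norm_sub_le_of_kernelDefect hV g
      have hq := norm_sub_le_of_kernelDefect hW g
      rw [← hu] at hp
      rw [← hv] at hq
      have hW0 : W 0 g = J (U () g) := (hJU ((), g)).symm
      have hV1 : V 1 g = I (U () g) := (hIU ((), g)).symm
      have e1 : X 0 g - X 1 g = u + I (adjoint J v) := by
        change V 0 g - I (adjoint J (W 1 g)) = _
        rw [hv, map_sub, map_sub, hW0, hJJ, hu, hV1]
        abel
      have e2 : Y 0 g - Y 1 g = v - J (adjoint J v) := by
        rw [hY1]
        change 0 - _ = _
        rw [hv, map_sub, map_sub, hW0, hJJ]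
        abel
      -- Pythagoras: only the component `J* v` interacts with `u`, so the squared length is at most
      -- `‖u‖² + 2‖u‖‖J* v‖ + ‖v‖² ≤ (‖u‖ + ‖v‖)²`.
      have e3 : ‖v - J (adjoint J v)‖ ^ 2 = ‖v‖ ^ 2 - ‖adjoint J v‖ ^ 2 := by
        rw [← hre, ← hre, ← hre, ← Complex.sub_re]
        congr 1
        simp only [inner_sub_left, inner_sub_right, hJ']
        rw [← adjoint_inner_left J, ← adjoint_inner_right J]
        ring
      have e4 : ‖u + I (adjoint J v)‖ ≤ ‖u‖ + ‖adjoint J v‖ :=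
        (norm_add_le _ _).trans_eq (by rw [hI])
      have e5 : ‖adjoint J v‖ ≤ ‖v‖ := by
        rw [← sq_le_sq₀ (norm_nonneg _) (norm_nonneg _)]
        nlinarith [sq_nonneg ‖v - J (adjoint J v)‖]
      rw [e1, e2, e3]
      calc ‖u + I (adjoint J v)‖ ^ 2 + (‖v‖ ^ 2 - ‖adjoint J v‖ ^ 2)
          ≤ (‖u‖ + ‖adjoint J v‖) ^ 2 + (‖v‖ ^ 2 - ‖adjoint J v‖ ^ 2) := by gcongr
        _ ≤ (‖u‖ + ‖v‖) ^ 2 := by nlinarith [norm_nonneg u]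
        _ ≤ (√‖kernelDefect Φ‖ * ‖g‖ + √‖kernelDefect Ψ‖ * ‖g‖) ^ 2 := by gcongr
        _ = _ := by ring

end Triangle

theorem norm_inner_apply_le {G : Type*} [NormedAddCommGroup G]
    [InnerProductSpace ℂ G] (T : G →L[ℂ] G) (g h : G) : ‖⟪g, T h⟫_ℂ‖ ≤ ‖T‖ * ‖g‖ * ‖h‖ :=
  (norm_inner_le_norm _ _).trans ((mul_le_mul_of_nonneg_left (T.le_opNorm h) (norm_nonneg g)).trans_eq
    (by ring))

/-! ### Weak limits of correlations. -/

section Compactness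

open ContinuousLinearMap

variable {A : Type u} [CStarAlgebra A]
  {G : Type v} [NormedAddCommGroup G] [InnerProductSpace ℂ G] [CompleteSpace G]

/-- Bounded families of operators have limits in the weak operator topology along ultrafilters. -/
theorem exists_weak_limit {α : Type*} (l : Ultrafilter α) (T : α → G →L[ℂ] G) {C : ℝ}
    (hT : ∀ x, ‖T x‖ ≤ C) :
    ∃ S : G →L[ℂ] G, ∀ g h, Tendsto (fun x => ⟪g, T x h⟫_ℂ) l (𝓝 ⟪g, S h⟫_ℂ) := by
  have hbd : ∀ g h x, ‖⟪g, T x h⟫_ℂ‖ ≤ C * ‖g‖ * ‖h‖ := fun g h x =>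
    (norm_inner_apply_le _ _ _).trans (by gcongr; exact hT x)
  have hex : ∀ g h, ∃ z : ℂ, Tendsto (fun x => ⟪g, T x h⟫_ℂ) l (𝓝 z) ∧ ‖z‖ ≤ C * ‖g‖ * ‖h‖ := by
    intro g h
    obtain ⟨z, hz, hlim⟩ := (isCompact_closedBall (0 : ℂ) (C * ‖g‖ * ‖h‖)).ultrafilter_le_nhds
      (l.map fun x => ⟪g, T x h⟫_ℂ) (by
        rw [le_principal_iff]
        exact Filter.mem_map.mpr (Filter.univ_mem' fun x => by
          simpa using hbd g h x))
    exact ⟨z, hlim, by simpa using hz⟩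
  choose b hb hbn using hex
  let L : G →ₗ⋆[ℂ] G →ₗ[ℂ] ℂ := LinearMap.mk₂'ₛₗ (starRingEnd ℂ) (RingHom.id ℂ) b
    (fun g g' h => tendsto_nhds_unique (hb _ _) (by
      simpa only [inner_add_left] using (hb g h).add (hb g' h)))
    (fun c g h => tendsto_nhds_unique (hb _ _) (by
      simpa only [inner_smul_left, smul_eq_mul] using (hb g h).const_mul _))
    (fun g h h' => tendsto_nhds_unique (hb _ _) (by
      simpa only [map_add, inner_add_right] using (hb g h).add (hb g h')))
    (fun c g h => tendsto_nhds_unique (hb _ _) (by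
      simpa only [map_smul, inner_smul_right, smul_eq_mul, RingHom.id_apply] using (hb g h).const_mul _))
  let L' : G →L⋆[ℂ] G →L[ℂ] ℂ := L.mkContinuous₂ C hbn
  refine ⟨adjoint (InnerProductSpace.continuousLinearMapOfBilin L'), fun g h => ?_⟩
  rw [adjoint_inner_right, InnerProductSpace.continuousLinearMapOfBilin_apply]
  exact hb g h

/-- Cauchy–Schwarz in the Stinespring space. The off-diagonal entries are thus bounded by the
diagonal, which makes weak limits of correlations available. -/
theorem IsPositiveKernel.norm_apply_le {ι : Type*} {Φ : ι → ι → A →ₗ[ℂ] (G →L[ℂ] G)}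
    (hΦ : IsPositiveKernel Φ) {C : ℝ} (hC : ∀ i, ‖Φ i i 1‖ ≤ C) (i j : ι) (a : A) :
    ‖Φ i j a‖ ≤ C * ‖a‖ := by
  obtain ⟨K, _, _, _, σ, V, hV, -⟩ := hΦ.exists_stinespring_self
  have hC0 : 0 ≤ C := (norm_nonneg _).trans (hC i)
  have h1 : ∀ i g, ‖V i g‖ ≤ √C * ‖g‖ := fun i g => by
    rw [← sq_le_sq₀ (norm_nonneg _) (by positivity), mul_pow, Real.sq_sqrt hC0,
      ← inner_self_eq_norm_sq (𝕜 := ℂ)]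
    have h := hV i i 1 g g
    rw [map_one, one_apply_eq_self] at h
    rw [h]
    refine (Complex.re_le_norm _).trans ((norm_inner_apply_le _ _ _).trans ?_)
    rw [sq, ← mul_assoc]
    gcongr
    exact hC i
  refine opNorm_le_bound _ (by positivity) fun h => ?_
  have h2 : ‖Φ i j a h‖ ^ 2 ≤ C * ‖a‖ * ‖h‖ * ‖Φ i j a h‖ := by
    rw [← inner_self_eq_norm_sq (𝕜 := ℂ), ← hV]
    refine (Complex.re_le_norm _).trans ((norm_inner_le_norm _ _).trans ?_)
    have h3 : ‖σ a (V j h)‖ ≤ ‖a‖ * (√C * ‖h‖) :=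
      ((σ a).le_opNorm _).trans (by
        gcongr
        · exact NonUnitalStarAlgHom.norm_apply_le σ a
        · exact h1 j h)
    calc _ ≤ (√C * ‖Φ i j a h‖) * (‖a‖ * (√C * ‖h‖)) := by
          gcongr
          exact h1 i _
      _ = √C * √C * ‖a‖ * ‖h‖ * ‖Φ i j a h‖ := by ring
      _ = _ := by rw [Real.mul_self_sqrt hC0]
  rcases (norm_nonneg (Φ i j a h)).eq_or_lt with h0 | h0
  · rw [← h0]; positivity
  · rw [sq] at h2
    exact le_of_mul_le_mul_right h2 h0

/-- Limits of correlations whose diagonal entries converge. -/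
theorem exists_isCorrelation_of_tendsto {α : Type*} (l : Filter α) [l.NeBot]
    {Φ : α → Fin 2 → Fin 2 → A →ₗ[ℂ] (G →L[ℂ] G)} (hΦ : ∀ x, IsPositiveKernel (Φ x)) {C : ℝ}
    (hC : ∀ x i, ‖Φ x i i 1‖ ≤ C) {φ : Fin 2 → A →ₗ[ℂ] (G →L[ℂ] G)}
    (hφ : ∀ i a g h, Tendsto (fun x => ⟪g, Φ x i i a h⟫_ℂ) l (𝓝 ⟪g, φ i a h⟫_ℂ))
    {d : α → ℝ} {r : ℝ} (hd : ∀ x, ‖kernelDefect (Φ x)‖ ≤ d x) (hr : Tendsto d l (𝓝 r)) :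
    ∃ Ψ, IsCorrelation Ψ (φ 0) (φ 1) ∧ ‖kernelDefect Ψ‖ ≤ r := by
  let m : Ultrafilter α := Ultrafilter.of l
  have hml : (m : Filter α) ≤ l := Ultrafilter.of_le l
  choose S hS using fun i j a => exists_weak_limit m (fun x => Φ x i j a)
    fun x => (hΦ x).norm_apply_le (hC x) i j a
  let Ψ : Fin 2 → Fin 2 → A →ₗ[ℂ] (G →L[ℂ] G) := fun i j =>
    { toFun := S i j
      map_add' := fun a b => ContinuousLinearMap.ext fun h => ext_inner_left ℂ fun g =>
        tendsto_nhds_unique (hS i j (a + b) g h) (by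
          simpa only [map_add, _root_.add_apply, inner_add_right] using
            (hS i j a g h).add (hS i j b g h))
      map_smul' := fun c a => ContinuousLinearMap.ext fun h => ext_inner_left ℂ fun g =>
        tendsto_nhds_unique (hS i j (c • a) g h) (by
          simpa only [map_smul, _root_.smul_apply, inner_smul_right, RingHom.id_apply] using
            (hS i j a g h).const_mul c) }
  have hΨ : ∀ i j a g h, Tendsto (fun x => ⟪g, Φ x i j a h⟫_ℂ) m (𝓝 ⟪g, Ψ i j a h⟫_ℂ) := hS
  have hdiag : ∀ i, Ψ i i = φ i := fun i => LinearMap.ext fun a => ContinuousLinearMap.ext fun h =>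
    ext_inner_left ℂ fun g => tendsto_nhds_unique (hΨ i i a g h) ((hφ i a g h).mono_left hml)
  refine ⟨Ψ, ⟨?_, hdiag 0, hdiag 1⟩, ?_⟩
  -- Positivity is a family of inequalities, each in finitely many matrix coefficients, hence stable
  -- under weak limits.
  · rw [isPositiveKernel_iff_inner_self]
    intro n i a g
    exact ge_of_tendsto (tendsto_finsetSum _ fun k _ => tendsto_finsetSum _ fun l _ =>
      hΨ (i k) (i l) (star (a k) * a l) (g k) (g l))
      (.of_forall fun x => isPositiveKernel_iff_inner_self.mp (hΦ x) n i a g)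
  · have hlim : ∀ g h, Tendsto (fun x => ⟪g, kernelDefect (Φ x) h⟫_ℂ) m
        (𝓝 ⟪g, kernelDefect Ψ h⟫_ℂ) := fun g h => by
      simp only [kernelDefect, _root_.add_apply, _root_.sub_apply, inner_add_right, inner_sub_right]
      exact (((hΨ 0 0 1 g h).sub (hΨ 0 1 1 g h)).sub (hΨ 1 0 1 g h)).add (hΨ 1 1 1 g h)
    have hle : ∀ g h, ‖⟪g, kernelDefect Ψ h⟫_ℂ‖ ≤ r * ‖g‖ * ‖h‖ := fun g h =>
      le_of_tendsto_of_tendsto (hlim g h).norm (((hr.mono_left hml).mul_const _).mul_const _)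
        (.of_forall fun x => (norm_inner_apply_le _ _ _).trans
          (mul_le_mul_of_nonneg_right (mul_le_mul_of_nonneg_right (hd x) (norm_nonneg _))
            (norm_nonneg _)))
    have hr0 : 0 ≤ r := ge_of_tendsto hr (.of_forall fun x => (norm_nonneg _).trans (hd x))
    refine opNorm_le_bound _ hr0 fun h => ?_
    have h1 := hle (kernelDefect Ψ h) h
    rw [inner_self_eq_norm_sq_to_K, norm_pow, RCLike.norm_ofReal, abs_norm] at h1
    rcases (norm_nonneg (kernelDefect Ψ h)).eq_or_lt with h0 | h0
    · rw [← h0]; positivity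
    · refine le_of_mul_le_mul_right ?_ h0
      linarith

end Compactness

/-! ### The interpolating contraction. -/

namespace CStarAlgebra

variable {A : Type*} [CStarAlgebra A] [PartialOrder A] [StarOrderedRing A]

/-- Functional calculus for the function `s ↦ 2τ - τ²s - 1` with `τ = 1 / max 1 s`. -/
theorem exists_contraction_of_nonneg {u : A} (hu : 0 ≤ u) :
    ∃ t k : A, IsSelfAdjoint t ∧ IsSelfAdjoint k ∧ ‖k‖ ≤ 1 ∧ k = t + t - t * u * t - 1 ∧
      1 - u ≤ k := by
  -- For `s > 0`, `2τ - τ²s` is largest at `τ = 1/s`. Truncating at `1` keeps the value in `[-1,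
  -- 1]`: it is `1 - s` for `0 ≤ s ≤ 1` and `1/s - 1` for `s ≥ 1`, always at least `1 - s`.
  let τ : ℝ → ℝ := fun s => (max 1 s)⁻¹
  have hpos : ∀ s : ℝ, 0 < max 1 s := fun s => lt_max_of_lt_left one_pos
  have hτ : Continuous τ := (continuous_const.max continuous_id).inv₀ fun s => (hpos s).ne'
  have hu' : IsSelfAdjoint u := hu.isSelfAdjoint
  have hk : cfc (fun s => τ s + τ s - τ s * s * τ s - 1) u =
      cfc τ u + cfc τ u - cfc τ u * u * cfc τ u - 1 := by
    have hτu : ContinuousOn τ (spectrum ℝ u) := hτ.continuousOn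
    rw [cfc_sub (fun s => τ s + τ s - τ s * s * τ s) (fun _ => 1) u (by fun_prop) (by fun_prop),
      cfc_sub (fun s => τ s + τ s) (fun s => τ s * s * τ s) u (by fun_prop) (by fun_prop),
      cfc_add (a := u) τ τ, cfc_mul (fun s => τ s * s) τ u (by fun_prop) (by fun_prop),
      cfc_mul τ (fun s => s) u (by fun_prop) (by fun_prop), cfc_id' ℝ u, cfc_const_one ℝ u]
  have hval : ∀ s : ℝ, 0 ≤ s → |τ s + τ s - τ s * s * τ s - 1| ≤ 1 ∧
      0 ≤ (τ s + τ s - τ s * s * τ s - 1) - (1 - s) := fun s hs => by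
    rcases le_total s 1 with h | h
    · have : τ s = 1 := by simp [τ, max_eq_left h]
      rw [this]
      exact ⟨abs_le.mpr ⟨by linarith, by linarith⟩, by linarith⟩
    · have h0 : 0 < s := one_pos.trans_le h
      have e : τ s = s⁻¹ := by simp [τ, max_eq_right h]
      have e1 : s⁻¹ * s = 1 := inv_mul_cancel₀ h0.ne'
      have e2 : s⁻¹ ≤ 1 := inv_le_one_of_one_le₀ h
      have e3 : 0 < s⁻¹ := inv_pos.mpr h0
      rw [e, e1, one_mul]
      refine ⟨abs_le.mpr ⟨by linarith, by linarith⟩, ?_⟩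
      nlinarith [sq_nonneg (s - 1)]
  refine ⟨cfc τ u, _, cfc_predicate τ u, cfc_predicate (fun s => τ s + τ s - τ s * s * τ s - 1) u,
    ?_, hk, ?_⟩
  · exact norm_cfc_le zero_le_one fun s hs => (hval s (spectrum_nonneg_of_nonneg hu hs)).1
  · have h1 : cfc (fun s : ℝ => 1 - s) u = 1 - u := by
      rw [cfc_sub (fun _ => 1) (fun s => s) u, cfc_const_one ℝ u, cfc_id' ℝ u]
    have hτu : ContinuousOn τ (spectrum ℝ u) := hτ.continuousOn
    rw [← h1, cfc_le_iff _ _ u (by fun_prop) (by fun_prop)]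
    exact fun s hs => by linarith [(hval s (spectrum_nonneg_of_nonneg hu hs)).2]

/-- Adding `ε` makes the square root invertible, so that one can conjugate by its inverse; `ε` is
sent to `0` afterwards. -/
theorem exists_unit_eq_star_mul_self {b : A} (hb : 0 ≤ b) {ε : ℝ} (hε : 0 < ε) :
    ∃ γ δ : A, star γ * γ = b + (ε : ℂ) • 1 ∧ γ * δ = 1 ∧ δ * γ = 1 := by
  have hε' : (0 : A) ≤ (ε : ℂ) • 1 := by
    rw [Complex.coe_smul]
    exact smul_nonneg hε.le zero_le_one
  have hsum : 0 ≤ b + (ε : ℂ) • 1 := add_nonneg hb hε'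
  have hu : IsUnit ((ε : ℂ) • (1 : A)) := by
    rw [← Algebra.algebraMap_eq_smul_one]
    exact (IsUnit.mk0 _ (Complex.ofReal_ne_zero.mpr hε.ne')).map _
  have hunit : IsUnit (b + (ε : ℂ) • 1) :=
    CStarAlgebra.isUnit_of_le ((ε : ℂ) • (1 : A)) (le_add_of_nonneg_left hb) 
      (hu.isStrictlyPositive hε')
  have hsq : CFC.sqrt (b + (ε : ℂ) • 1) * CFC.sqrt (b + (ε : ℂ) • 1) = b + (ε : ℂ) • 1 :=
    CFC.sqrt_mul_sqrt_self _ hsum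
  have hγ : IsUnit (CFC.sqrt (b + (ε : ℂ) • 1)) := by
    rw [← isUnit_pow_iff two_ne_zero, sq, hsq]
    exact hunit
  obtain ⟨v, hv⟩ := hγ
  refine ⟨v, (v⁻¹ : Aˣ), ?_, v.mul_inv, v.inv_mul⟩
  rw [hv, (CFC.sqrt_nonneg _).isSelfAdjoint.star_eq, hsq]

/-- A self-adjoint `a` is the difference of the positive elements `‖a‖·1` and `‖a‖·1 - a`. -/
theorem im_eq_zero_of_isSelfAdjoint {F : A →ₗ[ℂ] ℂ} (hF : ∀ a, 0 ≤ a → 0 ≤ F a) {a : A}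
    (ha : IsSelfAdjoint a) : (F a).im = 0 := by
  have h1 : 0 ≤ algebraMap ℝ A ‖a‖ - a := sub_nonneg.mpr ha.le_algebraMap_norm_self
  have h2 : 0 ≤ algebraMap ℝ A ‖a‖ :=
    by rw [Algebra.algebraMap_eq_smul_one]; exact smul_nonneg (norm_nonneg a) zero_le_one
  have h3 := (Complex.le_def.mp (hF _ h1)).2
  have h4 := (Complex.le_def.mp (hF _ h2)).2
  rw [map_sub, Complex.sub_im, ← h4] at h3
  simpa using h3.symm

theorem norm_smul_one_add_nonneg {a : A} (ha : IsSelfAdjoint a) : 0 ≤ (‖a‖ : ℝ) • (1 : A) + a := by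
  rw [← Algebra.algebraMap_eq_smul_one]
  exact neg_le_iff_add_nonneg'.mp ha.neg_algebraMap_norm_le_self

end CStarAlgebra

namespace CStarMatrix

variable {m n : Type*} [Fintype m] [Fintype n] [DecidableEq m] [DecidableEq n]
  {A : Type*} [CStarAlgebra A]

/-- The blocks of a matrix indexed by a product. -/
def block (X : CStarMatrix (m × n) (m × n) A) (i j : m) : CStarMatrix n n A :=
  ofMatrix fun k l => X (i, k) (j, l)

theorem block_star_mul_self (R : CStarMatrix (m × n) (m × n) A) (i j : m) :
    block (star R * R) i j = ∑ p, star (block R p i) * block R p j := by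
  ext k l
  change (star R * R) (i, k) (j, l) = _
  have h : ∀ S : m → CStarMatrix n n A, (∑ p, S p) k l = ∑ p, S p k l := fun S =>
    map_sum ({ toFun := fun M => M k l, map_zero' := rfl, map_add' := fun _ _ => rfl } :
      CStarMatrix n n A →+ A) _ _
  rw [h]
  simp only [mul_apply, star_apply, Fintype.sum_prod_type]
  rfl

theorem sum_star_mul_block_mul_nonneg [PartialOrder A] [StarOrderedRing A]
    {X : CStarMatrix (m × n) (m × n) A} (hX : 0 ≤ X) (W : m → CStarMatrix n n A) :
    0 ≤ ∑ i, ∑ j, star (W i) * block X i j * W j := by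
  obtain ⟨R, rfl⟩ := CStarAlgebra.exists_eq_star_mul_self hX
  have h : ∑ i, ∑ j, star (W i) * block (star R * R) i j * W j =
      ∑ p, star (∑ i, block R p i * W i) * ∑ j, block R p j * W j := by
    simp only [block_star_mul_self, Finset.mul_sum, Finset.sum_mul, star_sum, star_mul, mul_assoc]
    rw [Finset.sum_comm_cycle]
    refine Finset.sum_congr rfl fun p _ => ?_
    rw [Finset.sum_comm]
  rw [h]
  exact Finset.sum_nonneg fun p _ => star_mul_self_nonneg _

end CStarMatrix

namespace CStarAlgebra

variable {A : Type*} [CStarAlgebra A] [PartialOrder A] [StarOrderedRing A]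

/-- Conjugation by `δ = γ⁻¹` reduces to `b = 1`, with `y₀, y₁` for `x₀, x₁`. For `u = y₁ + 1`, the
hypothesis at `v = 1, w = t` reads `y₀ ≥ 2t - tut - 1 = k`, while `k ≥ 1 - u = -y₁`. -/
theorem exists_contraction_of_forall_nonneg {x₀ x₁ b γ δ : A} (hb : star γ * γ = b)
    (hγδ : γ * δ = 1) (hδγ : δ * γ = 1)
    (h : ∀ v w, 0 ≤ star v * x₀ * v + star w * x₁ * w + star (v - w) * b * (v - w)) :
    ∃ k : A, IsSelfAdjoint k ∧ ‖k‖ ≤ 1 ∧ 0 ≤ x₀ - star γ * k * γ ∧ 0 ≤ x₁ + star γ * k * γ := by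
  have hstar : star γ * star δ = 1 := by rw [← star_mul, hδγ, star_one]
  have hstar' : star δ * star γ = 1 := by rw [← star_mul, hγδ, star_one]
  have hback : ∀ x : A, star γ * (star δ * x * δ) * γ = x := fun x => by
    calc _ = (star γ * star δ) * x * (δ * γ) := by noncomm_ring
      _ = x := by rw [hstar, hδγ, one_mul, mul_one]
  have h' : ∀ v w, 0 ≤ star v * (star δ * x₀ * δ) * v + star w * (star δ * x₁ * δ) * w +
      star (v - w) * (v - w) := fun v w => by
    convert h (δ * v) (δ * w) using 2
    · simp only [star_mul, mul_assoc]
    · rw [← hb, ← mul_sub, star_mul]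
      calc _ = star (v - w) * (star δ * star γ) * (γ * δ) * (v - w) := by
            rw [hγδ, hstar', mul_one, mul_one]
        _ = _ := by noncomm_ring
  set y₀ := star δ * x₀ * δ
  set y₁ := star δ * x₁ * δ
  have hu : 0 ≤ y₁ + 1 := by simpa using h' 0 1
  obtain ⟨t, k, ht, hk, hk1, hkt, hle⟩ := exists_contraction_of_nonneg hu
  refine ⟨k, hk, hk1, ?_, ?_⟩
  · have h1 := h' 1 t
    have h2 : 0 ≤ y₀ - k := by
      convert h1 using 1
      rw [hkt, star_sub, ht.star_eq, star_one]
      noncomm_ring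
    have := star_left_conjugate_nonneg h2 γ
    rwa [mul_sub, sub_mul, hback] at this
  · have h2 : 0 ≤ y₁ + k := by
      have := sub_nonneg.mpr hle
      convert this using 1
      abel
    have := star_left_conjugate_nonneg h2 γ
    rwa [mul_add, add_mul, hback] at this

theorem re_map_star {F : A →ₗ[ℂ] ℂ} (hF : ∀ a, 0 ≤ a → 0 ≤ F a) (a : A) :
    (F (star a)).re = (F a).re := by
  have h : IsSelfAdjoint (Complex.I • (a - star a)) := by
    rw [IsSelfAdjoint, star_smul, star_sub, star_star]
    simp [smul_sub]
    abel
  have := im_eq_zero_of_isSelfAdjoint hF h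
  simp at this
  linarith

end CStarAlgebra

/-! ### The trace inequality on block diagonal matrices. -/

namespace CStarMatrix

variable {n : Type*} [Fintype n] {A : Type*} [CStarAlgebra A]

/-- The block matrix with `β` on the diagonal and `-β` off the diagonal. -/
noncomputable def signBlock (A : Type*) [CStarAlgebra A] (β : CStarMatrix n n ℂ) :
    CStarMatrix (Fin 2 × n) (Fin 2 × n) A :=
  ofMatrix fun p q => (if p.1 = q.1 then (1 : ℂ) else -1) • algebraMap ℂ A (β p.2 q.2)

theorem signBlock_apply (β : CStarMatrix n n ℂ) (p q : Fin 2 × n) :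
    signBlock A β p q =
      (if p.1 = q.1 then (1 : ℂ) else -1) • algebraMap ℂ A (β p.2 q.2) := rfl

theorem signBlock_add (β β' : CStarMatrix n n ℂ) :
    signBlock A (β + β') = signBlock A β + signBlock A β' := by
  ext p q
  simp only [signBlock_apply, add_apply, map_add, smul_add]

theorem signBlock_smul (r : ℝ) (β : CStarMatrix n n ℂ) :
    signBlock A (r • β) = r • signBlock A β := by
  ext p q
  simp only [signBlock_apply, smul_apply, Algebra.algebraMap_eq_smul_one, smul_assoc]
  rw [smul_comm]

theorem signBlock_zero : signBlock A (0 : CStarMatrix n n ℂ) = 0 := by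
  ext p q
  simp [signBlock_apply]

/-- Scalar matrices inside the matrices over `A`. -/
noncomputable def scalarHom (n A : Type*) [Fintype n] [CStarAlgebra A] :
    CStarMatrix n n ℂ →⋆ₙₐ[ℂ] CStarMatrix n n A :=
  mapₙₐ (StarAlgHom.ofId ℂ A : ℂ →⋆ₙₐ[ℂ] A)

theorem scalarHom_apply (β : CStarMatrix n n ℂ) (k l : n) :
    scalarHom n A β k l = algebraMap ℂ A (β k l) := rfl

theorem scalarHom_one [DecidableEq n] : scalarHom n A 1 = 1 := by
  ext k l
  rw [scalarHom_apply, one_apply, one_apply]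
  split_ifs <;> simp

theorem block_signBlock (β : CStarMatrix n n ℂ) (i j : Fin 2) :
    block (signBlock A β) i j = if i = j then scalarHom n A β else -scalarHom n A β := by
  ext k l
  change signBlock A β (i, k) (j, l) = _
  by_cases h : i = j <;> simp [signBlock_apply, h, scalarHom_apply]

theorem block_add {m : Type*} (X Y : CStarMatrix (m × n) (m × n) A) (i j : m) :
    block (X + Y) i j = block X i j + block Y i j := rfl

/-- `M ↦ ∑ k l, ⟪ξ k, f (M k l) (ξ l)⟫`. -/
noncomputable def vectorForm {G : Type*} [NormedAddCommGroup G] [InnerProductSpace ℂ G]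
    (f : A →ₗ[ℂ] (G →L[ℂ] G)) (ξ : n → G) : CStarMatrix n n A →ₗ[ℂ] ℂ where
  toFun M := ∑ k, ∑ l, ⟪ξ k, f (M k l) (ξ l)⟫_ℂ
  map_add' M N := by simp [Finset.sum_add_distrib]
  map_smul' c M := by simp [Finset.mul_sum]

section

variable {G : Type*} [NormedAddCommGroup G] [InnerProductSpace ℂ G]

/-- Moves a scalar conjugation onto the vectors. For orthonormal `ξ` the new vectors have squared
norms summing to `tr γ*γ`, which is how the trace of `β` enters. -/
theorem vectorForm_conjugate (f : A →ₗ[ℂ] (G →L[ℂ] G)) (ξ : n → G)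
    (γ : CStarMatrix n n ℂ) (M : CStarMatrix n n A) :
    vectorForm f ξ (star (scalarHom n A γ) * M * scalarHom n A γ) =
      vectorForm f (fun p => ∑ k, γ p k • ξ k) M := by
  have h : ∀ k l, (star (scalarHom n A γ) * M * scalarHom n A γ) k l =
      ∑ q, ∑ p, (star (γ p k) * γ q l) • M p q := fun k l => by
    simp only [mul_apply, star_apply, scalarHom_apply, Finset.sum_mul]
    refine Finset.sum_congr rfl fun q _ => Finset.sum_congr rfl fun p _ => ?_
    rw [← algebraMap_star_comm, Algebra.algebraMap_eq_smul_one, Algebra.algebraMap_eq_smul_one,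
      smul_mul_assoc, one_mul, mul_smul_comm, mul_one, smul_smul, mul_comm]
  simp only [vectorForm, LinearMap.coe_mk, AddHom.coe_mk, h, map_sum, map_smul,
    _root_.sum_apply, _root_.smul_apply, inner_sum, inner_smul_right, sum_inner, inner_smul_left,
    Finset.mul_sum]
  calc _ = ∑ k, ∑ l, ∑ p, ∑ q, star (γ p k) * γ q l * ⟪ξ k, f (M p q) (ξ l)⟫_ℂ :=
        Finset.sum_congr rfl fun k _ => Finset.sum_congr rfl fun l _ => Finset.sum_comm
    _ = ∑ k, ∑ p, ∑ l, ∑ q, star (γ p k) * γ q l * ⟪ξ k, f (M p q) (ξ l)⟫_ℂ :=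
        Finset.sum_congr rfl fun k _ => Finset.sum_comm
    _ = ∑ p, ∑ k, ∑ q, ∑ l, star (γ p k) * γ q l * ⟪ξ k, f (M p q) (ξ l)⟫_ℂ := by
        rw [Finset.sum_comm]
        exact Finset.sum_congr rfl fun p _ => Finset.sum_congr rfl fun k _ => Finset.sum_comm
    _ = ∑ p, ∑ q, ∑ k, ∑ l, star (γ p k) * γ q l * ⟪ξ k, f (M p q) (ξ l)⟫_ℂ :=
        Finset.sum_congr rfl fun p _ => Finset.sum_comm
    _ = _ := by
        refine Finset.sum_congr rfl fun p _ => Finset.sum_congr rfl fun q _ => ?_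
        rw [Finset.sum_comm]
        refine Finset.sum_congr rfl fun l _ => Finset.sum_congr rfl fun k _ => ?_
        simp only [RCLike.star_def]
        ring

theorem sum_norm_sq_orthonormal {e : n → G} (he : Orthonormal ℂ e) (γ : CStarMatrix n n ℂ) :
    ∑ p, ‖∑ k, γ p k • e k‖ ^ 2 = (∑ k, (star γ * γ) k k).re := by
  have h : ∀ p, ((‖∑ k, γ p k • e k‖ ^ 2 : ℝ) : ℂ) = ∑ k, star (γ p k) * γ p k := fun p => by
    have := inner_self_eq_norm_sq_to_K (𝕜 := ℂ) (∑ k, γ p k • e k)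
    rw [he.inner_sum] at this
    push_cast
    exact this.symm
  have h2 : ((∑ p, ‖∑ k, γ p k • e k‖ ^ 2 : ℝ) : ℂ) = ∑ k, (star γ * γ) k k := by
    rw [Complex.ofReal_sum, Finset.sum_congr rfl fun p _ => h p, Finset.sum_comm]
    simp [mul_apply, star_apply]
  rw [← h2, Complex.ofReal_re]

variable [DecidableEq n] [PartialOrder A] [StarOrderedRing A]

/-- This is the hypothesis of the extension theorem. With `γ*γ = β + ε` and the interpolating `k`,
the first two terms are at least the form of `f₁ - f₂` at `γ*kγ`, which `hc` applied to `-k` bounds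
below by `-c tr(β + ε)`. -/
theorem vectorForm_add_trace_nonneg {f₁ f₂ : A →ₗ[ℂ] (G →L[ℂ] G)} {c : ℝ}
    (h₁ : ∀ ξ : n → G, ∀ M, 0 ≤ M → 0 ≤ vectorForm f₁ ξ M)
    (h₂ : ∀ ξ : n → G, ∀ M, 0 ≤ M → 0 ≤ vectorForm f₂ ξ M)
    (hc : ∀ ξ : n → G, ∀ M, IsSelfAdjoint M → ‖M‖ ≤ 1 →
      (vectorForm (f₁ - f₂) ξ M).re ≤ c * ∑ k, ‖ξ k‖ ^ 2)
    {e : n → G} (he : Orthonormal ℂ e) {X : CStarMatrix (Fin 2 × n) (Fin 2 × n) A}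
    {β : CStarMatrix n n ℂ} (hβ : 0 ≤ β) (hX : 0 ≤ X + signBlock A β)
    (h01 : block X 0 1 = 0) (h10 : block X 1 0 = 0) :
    0 ≤ (vectorForm f₁ e (block X 0 0)).re + (vectorForm f₂ e (block X 1 1)).re +
      c * (∑ k, β k k).re := by
  have hblock : ∀ v w : CStarMatrix n n A, 0 ≤ star v * block X 0 0 * v +
      star w * block X 1 1 * w + star (v - w) * scalarHom n A β * (v - w) := fun v w => by
    have := sum_star_mul_block_mul_nonneg hX ![v, w]
    simp only [Fin.sum_univ_two, block_add, block_signBlock, h01, h10] at this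
    convert this using 1
    simp only [Matrix.cons_val_zero, Matrix.cons_val_one, if_true, star_sub, Fin.isValue,
      zero_ne_one, one_ne_zero, if_false, zero_add]
    noncomm_ring
  have key : ∀ ε : ℝ, 0 < ε → 0 ≤ (vectorForm f₁ e (block X 0 0)).re +
      (vectorForm f₂ e (block X 1 1)).re + c * (∑ k, β k k).re + ε * (c * Fintype.card n) := by
    intro ε hε
    obtain ⟨γ, δ, hγ, hγδ, hδγ⟩ := CStarAlgebra.exists_unit_eq_star_mul_self hβ hε
    obtain ⟨k, hk, hk1, hx0, hx1⟩ := CStarAlgebra.exists_contraction_of_forall_nonneg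
      (γ := scalarHom n A γ) (δ := scalarHom n A δ) rfl
      (by rw [← map_mul, hγδ, scalarHom_one]) (by rw [← map_mul, hδγ, scalarHom_one])
      (x₀ := block X 0 0) (x₁ := block X 1 1) (fun v w => by
        rw [← map_star, ← map_mul, hγ, map_add, map_smul, scalarHom_one, mul_add, add_mul,
          ← add_assoc]
        refine add_nonneg (hblock v w) ?_
        rw [mul_smul_comm, mul_one, smul_mul_assoc, Complex.coe_smul]
        exact smul_nonneg hε.le (star_mul_self_nonneg _))
    have e0 := (Complex.le_def.mp (h₁ e _ hx0)).1
    have e1 := (Complex.le_def.mp (h₂ e _ hx1)).1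
    rw [map_sub, vectorForm_conjugate, Complex.sub_re, Complex.zero_re] at e0
    rw [map_add, vectorForm_conjugate, Complex.add_re, Complex.zero_re] at e1
    have e2 := hc (fun p => ∑ k, γ p k • e k) (-k) hk.neg (by rwa [norm_neg])
    rw [sum_norm_sq_orthonormal he, hγ] at e2
    have e3 : (∑ k, (β + (ε : ℂ) • 1) k k).re = (∑ k, β k k).re + ε * Fintype.card n := by
      have h : ∀ k, ((ε : ℂ) • (1 : CStarMatrix n n ℂ)) k k = ε := fun k => by
        rw [smul_apply, one_apply, if_pos rfl, smul_eq_mul, mul_one]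
      simp only [add_apply, h, Finset.sum_add_distrib, Complex.add_re, Finset.sum_const,
        Finset.card_univ, nsmul_eq_mul]
      simp [mul_comm]
    have e4 : vectorForm (f₁ - f₂) (fun p => ∑ k, γ p k • e k) (-k) =
        vectorForm f₂ (fun p => ∑ k, γ p k • e k) k -
          vectorForm f₁ (fun p => ∑ k, γ p k • e k) k := by
      rw [map_neg]
      simp only [vectorForm, LinearMap.coe_mk, AddHom.coe_mk, LinearMap.sub_apply,
        _root_.sub_apply, inner_sub_right, Finset.sum_sub_distrib, neg_sub]
    rw [e3, e4, Complex.sub_re] at e2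
    linarith
  have hlim : Tendsto (fun ε : ℝ => (vectorForm f₁ e (block X 0 0)).re +
      (vectorForm f₂ e (block X 1 1)).re + c * (∑ k, β k k).re + ε * (c * Fintype.card n))
      (𝓝[>] 0) (𝓝 ((vectorForm f₁ e (block X 0 0)).re +
      (vectorForm f₂ e (block X 1 1)).re + c * (∑ k, β k k).re + 0 * (c * Fintype.card n))) := by
    apply Tendsto.mono_left _ nhdsWithin_le_nhds
    exact (by fun_prop : Continuous fun ε : ℝ => (vectorForm f₁ e (block X 0 0)).re +
      (vectorForm f₂ e (block X 1 1)).re + c * (∑ k, β k k).re +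
        ε * (c * Fintype.card n)).tendsto 0
  rw [zero_mul, add_zero] at hlim
  exact ge_of_tendsto hlim (eventually_mem_nhdsWithin.mono key)

end

end CStarMatrix

/-! ### Extension of positive functionals from block diagonal matrices. -/

namespace CStarMatrix

variable {n : Type*} [Fintype n] [DecidableEq n] {A : Type*} [CStarAlgebra A] [PartialOrder A]
  [StarOrderedRing A]

/-- The real cone of all `(X, s)` with `0 ≤ X + X* + signBlock β` for some `β ≥ 0` whose trace is
controlled by `s`. -/
noncomputable def traceCone (n A : Type*) [Fintype n] [DecidableEq n] [CStarAlgebra A]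
    [PartialOrder A] [StarOrderedRing A] (c : ℝ) :
    PointedCone ℝ (CStarMatrix (Fin 2 × n) (Fin 2 × n) A × ℝ) where
  -- `X + X*` makes the condition meaningful for all matrices; it equals `2X` for self-adjoint `X`,
  -- whence the factor `2` in front of the scalar.
  carrier := {x | ∃ β : CStarMatrix n n ℂ, 0 ≤ β ∧ 0 ≤ x.1 + star x.1 + signBlock A β ∧
    c * (∑ k, β k k).re ≤ 2 * x.2}
  zero_mem' := ⟨0, le_rfl, by simp [signBlock_zero], by simp⟩
  add_mem' := by
    rintro x y ⟨β, hβ, hx, hs⟩ ⟨β', hβ', hy, ht⟩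
    refine ⟨β + β', add_nonneg hβ hβ', ?_, ?_⟩
    · convert add_nonneg hx hy using 1
      simp only [Prod.fst_add, star_add, signBlock_add]
      abel
    · simp only [add_apply, Finset.sum_add_distrib, Complex.add_re, Prod.snd_add] at hs ht ⊢
      linarith
  smul_mem' := by
    rintro ⟨r, hr⟩ x ⟨β, hβ, hx, hs⟩
    refine ⟨r • β, smul_nonneg hr hβ, ?_, ?_⟩
    · convert smul_nonneg hr hx using 1
      simp only [smul_add, ← signBlock_smul]
      change r • x.1 + star (r • x.1) + _ = _
      rw [star_smul, star_trivial]
    · change _ ≤ 2 * (r * x.2)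
      have h : (∑ k, (r • β) k k).re = r * (∑ k, β k k).re := by
        simp only [smul_apply, ← Finset.smul_sum, Complex.smul_re, smul_eq_mul]
      rw [h]
      nlinarith

/-- Block diagonal matrices, paired with scalars. -/
def blockDiagonalSubmodule (n A : Type*) [Fintype n] [CStarAlgebra A] :
    Submodule ℝ (CStarMatrix (Fin 2 × n) (Fin 2 × n) A × ℝ) where
  carrier := {x | block x.1 0 1 = 0 ∧ block x.1 1 0 = 0}
  zero_mem' := ⟨rfl, rfl⟩
  add_mem' := by
    rintro x y ⟨h1, h2⟩ ⟨h3, h4⟩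
    exact ⟨by rw [Prod.fst_add, block_add, h1, h3, add_zero],
      by rw [Prod.fst_add, block_add, h2, h4, add_zero]⟩
  smul_mem' := by
    rintro r x ⟨h1, h2⟩
    exact ⟨(congrArg (r • ·) h1).trans (smul_zero r), (congrArg (r • ·) h2).trans (smul_zero r)⟩

theorem block_star {m : Type*} (X : CStarMatrix (m × n) (m × n) A) (i j : m) :
    block (star X) i j = star (block X j i) := rfl

/-- Riesz extension on pairs `(X, s)`, with the real coordinate carrying the trace budget.
Membership of `(-signBlock β, c tr β)` in the cone becomes the trace estimate for `Λ`. -/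
theorem exists_positive_extension {F₁ F₂ : CStarMatrix n n A →ₗ[ℂ] ℂ}
    (h₁ : ∀ M, 0 ≤ M → 0 ≤ F₁ M) (h₂ : ∀ M, 0 ≤ M → 0 ≤ F₂ M) {c : ℝ}
    (hF : ∀ (X : CStarMatrix (Fin 2 × n) (Fin 2 × n) A) (β : CStarMatrix n n ℂ), 0 ≤ β →
      0 ≤ X + signBlock A β → block X 0 1 = 0 → block X 1 0 = 0 →
      0 ≤ (F₁ (block X 0 0)).re + (F₂ (block X 1 1)).re + c * (∑ k, β k k).re) :
    ∃ Λ : CStarMatrix (Fin 2 × n) (Fin 2 × n) A →ₗ[ℂ] ℂ, (∀ X, 0 ≤ X → 0 ≤ Λ X) ∧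
      (∀ X, block X 0 1 = 0 → block X 1 0 = 0 → Λ X = F₁ (block X 0 0) + F₂ (block X 1 1)) ∧
      ∀ β, 0 ≤ β → (Λ (signBlock A β)).re ≤ c * (∑ k, β k k).re := by
  let f : (CStarMatrix (Fin 2 × n) (Fin 2 × n) A × ℝ) →ₗ.[ℝ] ℝ :=
    { domain := blockDiagonalSubmodule n A
      toFun :=
        { toFun := fun x => (F₁ (block x.1.1 0 0)).re + (F₂ (block x.1.1 1 1)).re + x.1.2
          map_add' := fun x y => by
            have h : ∀ i, block (x + y).1.1 i i = block x.1.1 i i + block y.1.1 i i := fun _ => rfl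
            have h' : (x + y).1.2 = x.1.2 + y.1.2 := rfl
            simp only [h, h', map_add, Complex.add_re]
            ring
          map_smul' := fun r x => by
            have h : ∀ i, block (r • x).1.1 i i = (r : ℂ) • block x.1.1 i i := fun _ => rfl
            have h' : (r • x).1.2 = r * x.1.2 := rfl
            simp only [h, h', map_smul, smul_eq_mul, Complex.re_ofReal_mul, RingHom.id_apply]
            ring } }
  obtain ⟨g, hg, hpos⟩ := riesz_extension (traceCone n A c) f (by
    rintro ⟨⟨X, s⟩, h01, h10⟩ ⟨β, hβ, hX, hs⟩
    change 0 ≤ (F₁ (block X 0 0)).re + (F₂ (block X 1 1)).re + s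
    change block X 0 1 = 0 at h01
    change block X 1 0 = 0 at h10
    have := hF (X + star X) β hβ hX
      (by rw [block_add, block_star, h01, h10, star_zero, add_zero])
      (by rw [block_add, block_star, h01, h10, star_zero, add_zero])
    simp only [block_add, block_star, map_add, Complex.add_re,
      CStarAlgebra.re_map_star h₁, CStarAlgebra.re_map_star h₂] at this
    dsimp only at hs
    linarith) (by
    rintro ⟨Y, s⟩
    -- A large multiple of the identity, which is block diagonal, pushes any pair into the cone with
    -- `β = 0`.
    refine ⟨⟨((‖Y + star Y‖ : ℝ) • 1, -s), ?_, ?_⟩, 0, le_rfl, ?_, ?_⟩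
    · ext k l
      change ‖Y + star Y‖ • (1 : CStarMatrix (Fin 2 × n) (Fin 2 × n) A) (0, k) (1, l) = 0
      simp
    · ext k l
      change ‖Y + star Y‖ • (1 : CStarMatrix (Fin 2 × n) (Fin 2 × n) A) (1, k) (0, l) = 0
      simp
    · have h1 : IsSelfAdjoint (Y + star Y) := .add_star_self Y
      have h2 : 0 ≤ (‖Y + star Y‖ : ℝ) • (1 : CStarMatrix (Fin 2 × n) (Fin 2 × n) A) +
          (Y + star Y) := CStarAlgebra.norm_smul_one_add_nonneg h1
      have h3 : 0 ≤ (‖Y + star Y‖ : ℝ) • (1 : CStarMatrix (Fin 2 × n) (Fin 2 × n) A) :=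
        smul_nonneg (norm_nonneg _) zero_le_one
      have h4 : star ((‖Y + star Y‖ : ℝ) • (1 : CStarMatrix (Fin 2 × n) (Fin 2 × n) A)) =
          (‖Y + star Y‖ : ℝ) • 1 := h3.isSelfAdjoint
      refine (add_nonneg h2 h3).trans_eq ?_
      change _ = (‖Y + star Y‖ : ℝ) • (1 : CStarMatrix (Fin 2 × n) (Fin 2 × n) A) + Y +
        star ((‖Y + star Y‖ : ℝ) • (1 : CStarMatrix (Fin 2 × n) (Fin 2 × n) A) + Y) + _
      rw [signBlock_zero, add_zero, star_add, h4]
      generalize (‖Y + star Y‖ : ℝ) • (1 : CStarMatrix (Fin 2 × n) (Fin 2 × n) A) = T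
      abel
    · simp)
  let g₀ : Module.Dual ℝ (CStarMatrix (Fin 2 × n) (Fin 2 × n) A) := g ∘ₗ LinearMap.inl ℝ _ ℝ
  let Λ : CStarMatrix (Fin 2 × n) (Fin 2 × n) A →ₗ[ℂ] ℂ := g₀.extendRCLike
  have hre : ∀ X, (Λ X).re = g (X, 0) := fun X => by
    simp [Λ, g₀, Module.Dual.extendRCLike_apply]
  have him : ∀ X, (Λ X).im = -g (Complex.I • X, 0) := fun X => by
    simp [Λ, g₀, Module.Dual.extendRCLike_apply]
  have hgs : ∀ s : ℝ, g (0, s) = s := fun s => by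
    have h := hg ⟨(0, s), rfl, rfl⟩
    refine h.trans ?_
    change (F₁ (0 : CStarMatrix n n A)).re + (F₂ (0 : CStarMatrix n n A)).re + s = s
    simp
  refine ⟨Λ, fun X hX => ?_, fun X h01 h10 => ?_, fun β hβ => ?_⟩
  · have hsa := hX.isSelfAdjoint.star_eq
    rw [Complex.le_def, hre, him, Complex.zero_re, Complex.zero_im]
    refine ⟨hpos _ ⟨0, le_rfl, ?_, by simp⟩, ?_⟩
    · rw [signBlock_zero, add_zero]
      dsimp only
      rw [hsa]
      exact add_nonneg hX hX
    -- For `X ≥ 0` the matrix `iX` is skew-adjoint, so both `(iX, 0)` and its negative lie in the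
    -- cone. Hence `g` vanishes there and `Λ X` is real.
    · have hI : Complex.I • X + star (Complex.I • X) = 0 := by
        rw [star_smul, hsa]
        simp
      have hA := hpos (Complex.I • X, 0) ⟨0, le_rfl, by
        rw [signBlock_zero, add_zero]
        exact hI.ge, by simp⟩
      have hB := hpos (-(Complex.I • X), 0) ⟨0, le_rfl, by
        rw [signBlock_zero, add_zero]
        dsimp only
        rw [star_neg, ← neg_add, hI, neg_zero], by simp⟩
      have hC : g (-(Complex.I • X), 0) = -g (Complex.I • X, 0) := by
        rw [← map_neg]
        simp
      linarith
  · have hval : ∀ Y, block Y 0 1 = 0 → block Y 1 0 = 0 →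
        (Λ Y).re = (F₁ (block Y 0 0)).re + (F₂ (block Y 1 1)).re := fun Y h h' => by
      rw [hre]
      refine (hg ⟨(Y, 0), h, h'⟩).trans ?_
      exact add_zero _
    apply Complex.ext
    · rw [hval X h01 h10, Complex.add_re]
    · have h1 := hval (Complex.I • X) ((congrArg (Complex.I • ·) h01).trans (smul_zero _))
        ((congrArg (Complex.I • ·) h10).trans (smul_zero _))
      have h2 : ∀ i, block (Complex.I • X) i i = Complex.I • block X i i := fun _ => rfl
      rw [h2, h2] at h1
      simp only [map_smul, smul_eq_mul, Complex.I_mul_re] at h1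
      rw [Complex.add_im]
      linarith
  · have h1 := hpos (-signBlock A β, c * (∑ k, β k k).re) ⟨(2 : ℝ) • β, smul_nonneg zero_le_two hβ,
      ?_, ?_⟩
    · have h2 : ((-signBlock A β, c * (∑ k, β k k).re) :
          CStarMatrix (Fin 2 × n) (Fin 2 × n) A × ℝ) =
          -(signBlock A β, 0) + (0, c * (∑ k, β k k).re) := by simp
      rw [h2, map_add, map_neg, hgs] at h1
      rw [hre]
      linarith
    · have h2 : star (signBlock A β) = signBlock A β := by
        ext p q
        rw [star_apply, signBlock_apply, signBlock_apply, star_smul, ← algebraMap_star_comm,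
          star_apply_of_isSelfAdjoint hβ.isSelfAdjoint]
        by_cases h : p.1 = q.1
        · simp [h]
        · simp [h, Ne.symm h]
      dsimp only
      rw [star_neg, h2, signBlock_smul, two_smul]
      exact le_of_eq (by abel)
    · have h : (∑ k, ((2 : ℝ) • β) k k).re = 2 * (∑ k, β k k).re := by
        simp only [smul_apply, ← Finset.smul_sum, Complex.smul_re, smul_eq_mul]
      rw [h]
      linarith

end CStarMatrix

namespace CStarMatrix

theorem nonneg_ofMatrix_star_mul {n : Type*} [Fintype n] [DecidableEq n] {A : Type*}
    [CStarAlgebra A] [PartialOrder A] [StarOrderedRing A] (y : n → A) :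
    0 ≤ (ofMatrix fun p q => star (y p) * y q : CStarMatrix n n A) := by
  refine nonneg_of_forall_sum_nonneg fun b => ?_
  refine (star_mul_self_nonneg (∑ q, y q * b q)).trans_eq ?_
  change _ = ∑ p, ∑ q, star (b p) * (star (y p) * y q) * b q
  simp only [star_sum, star_mul, Finset.sum_mul, Finset.mul_sum, mul_assoc]
  exact Finset.sum_comm

end CStarMatrix

/-! ### Correlations compressed to finite-dimensional subspaces. -/

section Compression

open CStarMatrix

variable {n : Type*} [Fintype n] [DecidableEq n] {A : Type u} [CStarAlgebra A] [PartialOrder A]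
  [StarOrderedRing A] {G : Type v} [NormedAddCommGroup G] [InnerProductSpace ℂ G]

/-- The matrix supported in the block `(i, j)` with entries `⟪g, e k⟫ ⟪e l, h⟫ a`. -/
noncomputable def vectorBlock (e : n → G) (i j : Fin 2) (g h : G) :
    A →ₗ[ℂ] CStarMatrix (Fin 2 × n) (Fin 2 × n) A where
  toFun a := ofMatrix fun p q =>
    if p.1 = i ∧ q.1 = j then (⟪g, e p.2⟫_ℂ * ⟪e q.2, h⟫_ℂ) • a else 0
  map_add' a b := by
    ext p q
    change (if p.1 = i ∧ q.1 = j then (⟪g, e p.2⟫_ℂ * ⟪e q.2, h⟫_ℂ) • (a + b) else 0) =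
      (if p.1 = i ∧ q.1 = j then (⟪g, e p.2⟫_ℂ * ⟪e q.2, h⟫_ℂ) • a else 0) +
        if p.1 = i ∧ q.1 = j then (⟪g, e p.2⟫_ℂ * ⟪e q.2, h⟫_ℂ) • b else 0
    split_ifs <;> simp
  map_smul' c a := by
    ext p q
    change (if p.1 = i ∧ q.1 = j then (⟪g, e p.2⟫_ℂ * ⟪e q.2, h⟫_ℂ) • (c • a) else 0) =
      c • if p.1 = i ∧ q.1 = j then (⟪g, e p.2⟫_ℂ * ⟪e q.2, h⟫_ℂ) • a else 0
    split_ifs <;> simp [smul_comm c]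

theorem vectorBlock_apply (e : n → G) (i j : Fin 2) (g h : G) (a : A) (p q : Fin 2 × n) :
    vectorBlock e i j g h a p q =
      if p.1 = i ∧ q.1 = j then (⟪g, e p.2⟫_ℂ * ⟪e q.2, h⟫_ℂ) • a else 0 := rfl

theorem sum_matrix_apply {m T R : Type*} [AddCommMonoid R] (s : Finset T)
    (M : T → CStarMatrix m m R) (p q : m) : (∑ t ∈ s, M t) p q = ∑ t ∈ s, M t p q :=
  map_sum ({ toFun := fun M => M p q, map_zero' := rfl, map_add' := fun _ _ => rfl } :
      CStarMatrix m m R →+ R) _ _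

/-- The sum is the Gram matrix `y p* y q` of a single row `y` over `A`. It turns positivity of `Λ`
into positivity of the kernel. -/
theorem sum_vectorBlock_nonneg (e : n → G) {T : Type*} [Fintype T] (i : T → Fin 2) (a : T → A)
    (g : T → G) : 0 ≤ ∑ s, ∑ t, vectorBlock e (i s) (i t) (g s) (g t) (star (a s) * a t) := by
  let y : Fin 2 × n → A := fun q => ∑ t, if q.1 = i t then ⟪e q.2, g t⟫_ℂ • a t else 0
  refine (nonneg_ofMatrix_star_mul y).trans_eq ?_
  ext p q
  change star (y p) * y q = _
  simp only [sum_matrix_apply, vectorBlock_apply, y, star_sum, Finset.sum_mul, Finset.mul_sum]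
  refine Finset.sum_comm.trans (Finset.sum_congr rfl fun s _ => Finset.sum_congr rfl fun t _ => ?_)
  by_cases h1 : p.1 = i s <;> by_cases h2 : q.1 = i t <;>
    simp [h1, h2, smul_smul, mul_comm]

variable (A) in
/-- The kernel of operators determined by a functional on matrices. -/
noncomputable def functionalKernel [CompleteSpace G] (e : n → G)
    (Λ : CStarMatrix (Fin 2 × n) (Fin 2 × n) A →ₗ[ℂ] ℂ) (i j : Fin 2) : A →ₗ[ℂ] (G →L[ℂ] G) :=
  ∑ k, ∑ l, (Λ ∘ₗ
    { toFun := fun a => ofMatrix (Matrix.single (i, k) (j, l) a)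
      map_add' := fun a b => congrArg ofMatrix (Matrix.single_add _ _ a b)
      map_smul' := fun c a => (congrArg ofMatrix (Matrix.smul_single c _ _ a)).symm }).smulRight
        (InnerProductSpace.rankOne ℂ (e k) (e l))

variable [CompleteSpace G]

theorem inner_functionalKernel (e : n → G) (Λ : CStarMatrix (Fin 2 × n) (Fin 2 × n) A →ₗ[ℂ] ℂ)
    (i j : Fin 2) (a : A) (g h : G) :
    ⟪g, functionalKernel A e Λ i j a h⟫_ℂ = Λ (vectorBlock e i j g h a) := by
  have hZ : vectorBlock e i j g h a = ∑ k, ∑ l, (⟪g, e k⟫_ℂ * ⟪e l, h⟫_ℂ) •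
      (ofMatrix (Matrix.single (i, k) (j, l) a) : CStarMatrix (Fin 2 × n) (Fin 2 × n) A) := by
    ext p q
    simp only [sum_matrix_apply]
    obtain ⟨p1, p2⟩ := p
    obtain ⟨q1, q2⟩ := q
    change (if p1 = i ∧ q1 = j then _ else 0) = ∑ k, ∑ l, (⟪g, e k⟫_ℂ * ⟪e l, h⟫_ℂ) •
      Matrix.single (i, k) (j, l) a (p1, p2) (q1, q2)
    simp only [Matrix.single_apply, Prod.mk.injEq]
    by_cases h1 : i = p1
    · by_cases h2 : j = q1
      · simp [h1, h2, ite_and]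
      · simp [h2, Ne.symm h2]
    · simp [h1, Ne.symm h1]
  rw [hZ]
  simp only [functionalKernel, map_sum, map_smul, LinearMap.sum_apply, _root_.sum_apply, inner_sum,
    LinearMap.smulRight_apply, LinearMap.comp_apply, _root_.smul_apply, inner_smul_right,
    InnerProductSpace.rankOne_apply, smul_eq_mul]
  refine Finset.sum_congr rfl fun k _ => Finset.sum_congr rfl fun l _ => ?_
  rw [mul_comm, mul_comm ⟪g, e k⟫_ℂ]
  rfl

theorem isPositiveKernel_functionalKernel (e : n → G)
    {Λ : CStarMatrix (Fin 2 × n) (Fin 2 × n) A →ₗ[ℂ] ℂ} (hΛ : ∀ X, 0 ≤ X → 0 ≤ Λ X) :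
    IsPositiveKernel (functionalKernel A e Λ) := by
  rw [isPositiveKernel_iff_inner_self]
  intro m i a g
  simp only [inner_functionalKernel, ← map_sum]
  exact hΛ _ (sum_vectorBlock_nonneg e i a g)

theorem exists_compressed_correlation {f : Fin 2 → A →ₗ[ℂ] (G →L[ℂ] G)} {c : ℝ} (hc0 : 0 ≤ c)
    (hf : ∀ i, ∀ ξ : n → G, ∀ M, 0 ≤ M → 0 ≤ vectorForm (f i) ξ M)
    (hc : ∀ ξ : n → G, ∀ M, IsSelfAdjoint M → ‖M‖ ≤ 1 →
      (vectorForm (f 0 - f 1) ξ M).re ≤ c * ∑ k, ‖ξ k‖ ^ 2)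
    {e : n → G} (he : Orthonormal ℂ e) :
    ∃ Φ : Fin 2 → Fin 2 → A →ₗ[ℂ] (G →L[ℂ] G), IsPositiveKernel Φ ∧
      (∀ i a g h, ⟪g, Φ i i a h⟫_ℂ =
        ⟪∑ k, ⟪e k, g⟫_ℂ • e k, f i a (∑ k, ⟪e k, h⟫_ℂ • e k)⟫_ℂ) ∧ ‖kernelDefect Φ‖ ≤ c := by
  obtain ⟨Λ, hpos, hdiag, htr⟩ := exists_positive_extension (hf 0 e) (hf 1 e)
    fun X β hβ hX h01 h10 => vectorForm_add_trace_nonneg (hf 0) (hf 1) hc he hβ hX h01 h10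
  have hΦ := isPositiveKernel_functionalKernel e hpos
  refine ⟨functionalKernel A e Λ, hΦ, fun i a g h => ?_, ?_⟩
  · have hform : ⟪∑ k, ⟪e k, g⟫_ℂ • e k, f i a (∑ k, ⟪e k, h⟫_ℂ • e k)⟫_ℂ =
        ∑ k, ∑ l, ⟪e k, f i a (e l)⟫_ℂ * (⟪g, e k⟫_ℂ * ⟪e l, h⟫_ℂ) := by
      simp only [map_sum, map_smul, sum_inner, inner_sum, inner_smul_left, inner_smul_right,
        inner_conj_symm, Finset.mul_sum]
      refine Finset.sum_comm.trans
        (Finset.sum_congr rfl fun k _ => Finset.sum_congr rfl fun l _ => by ring)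
    have hb : ∀ j j', block (vectorBlock e i i g h a) j j' =
        if j = i ∧ j' = i then ofMatrix (fun k l => (⟪g, e k⟫_ℂ * ⟪e l, h⟫_ℂ) • a) else 0 := by
      intro j j'
      ext k l
      change vectorBlock e i i g h a (j, k) (j', l) = _
      rw [vectorBlock_apply]
      split_ifs <;> rfl
    have hv : vectorForm (f i) e
        (ofMatrix (fun k l => (⟪g, e k⟫_ℂ * ⟪e l, h⟫_ℂ) • a) : CStarMatrix n n A) =
          ∑ k, ∑ l, ⟪e k, f i a (e l)⟫_ℂ * (⟪g, e k⟫_ℂ * ⟪e l, h⟫_ℂ) := by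
      change ∑ k, ∑ l, ⟪e k, f i ((⟪g, e k⟫_ℂ * ⟪e l, h⟫_ℂ) • a) (e l)⟫_ℂ = _
      simp only [map_smul, _root_.smul_apply, inner_smul_right]
      exact Finset.sum_congr rfl fun k _ => Finset.sum_congr rfl fun l _ => mul_comm _ _
    rw [inner_functionalKernel, hform, ← hv, hdiag _ (by rw [hb, if_neg (by omega)])
      (by rw [hb, if_neg (by omega)]), hb, hb]
    rcases Fin.exists_fin_two.mp ⟨i, rfl⟩ with rfl | rfl
    · rw [if_pos ⟨rfl, rfl⟩, if_neg (by decide), map_zero, add_zero]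
    · rw [if_neg (by decide), if_pos ⟨rfl, rfl⟩, map_zero, zero_add]
  · obtain ⟨K, _, _, _, σ, V, hV, -⟩ := hΦ.exists_stinespring_self
    refine norm_le_of_inner_le hc0 ?_ fun g => ?_
    · rw [ContinuousLinearMap.nonneg_iff_forall_inner]
      intro g
      rw [inner_kernelDefect hV]
      exact inner_self_nonneg_complex _
    -- The form of the defect at `g` is `Λ (signBlock β)` for this rank-one `β`, whose trace is at
    -- most `‖g‖²` by Bessel.
    · let β : CStarMatrix n n ℂ := ofMatrix fun k l => star ⟪e k, g⟫_ℂ * ⟪e l, g⟫_ℂ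
      have hβ : 0 ≤ β := nonneg_ofMatrix_star_mul fun k => ⟪e k, g⟫_ℂ
      have h1 : ⟪g, kernelDefect (functionalKernel A e Λ) g⟫_ℂ = Λ (signBlock A β) := by
        simp only [kernelDefect, _root_.add_apply, _root_.sub_apply, inner_add_right,
          inner_sub_right, inner_functionalKernel, ← map_sub, ← map_add]
        congr 1
        ext ⟨i, k⟩ ⟨j, l⟩
        have h3 : β k l = ⟪g, e k⟫_ℂ * ⟪e l, g⟫_ℂ := by rw [← inner_conj_symm g]; rfl
        simp only [CStarMatrix.add_apply, CStarMatrix.sub_apply, vectorBlock_apply,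
          signBlock_apply, h3]
        fin_cases i <;> fin_cases j <;> simp [Algebra.algebraMap_eq_smul_one]
      rw [h1]
      refine (htr β hβ).trans (mul_le_mul_of_nonneg_left ?_ hc0)
      have h2 : ∀ k, (β k k).re = ‖⟪e k, g⟫_ℂ‖ ^ 2 := fun k => by
        change (star ⟪e k, g⟫_ℂ * ⟪e k, g⟫_ℂ).re = _
        generalize ⟪e k, g⟫_ℂ = z
        simp [← Complex.normSq_eq_norm_sq, Complex.normSq_apply]
      rw [Complex.re_sum, Finset.sum_congr rfl fun k _ => h2 k]
      exact he.sum_inner_products_le g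
end Compression

/-! ### The upper estimate on the whole Hilbert space. -/

section UpperBound

open CStarMatrix

variable {G : Type v} [NormedAddCommGroup G] [InnerProductSpace ℂ G]

theorem Orthonormal.norm_sum_inner_smul_le {n : Type*} [Fintype n] {e : n → G}
    (he : Orthonormal ℂ e) (g : G) : ‖∑ k, ⟪e k, g⟫_ℂ • e k‖ ≤ ‖g‖ := by
  rw [← sq_le_sq₀ (norm_nonneg _) (norm_nonneg _)]
  refine le_trans (le_of_eq ?_) (he.sum_inner_products_le (s := Finset.univ) g)
  rw [← inner_self_eq_norm_sq (𝕜 := ℂ), he.inner_sum, map_sum]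
  refine Finset.sum_congr rfl fun k _ => ?_
  generalize ⟪e k, g⟫_ℂ = z
  simp [← Complex.normSq_eq_norm_sq, Complex.normSq_apply]

variable [CompleteSpace G]

theorem norm_le_of_forall_norm_inner_le {T : G →L[ℂ] G} {C : ℝ} (hC : 0 ≤ C)
    (h : ∀ g h, ‖⟪g, T h⟫_ℂ‖ ≤ C * ‖g‖ * ‖h‖) : ‖T‖ ≤ C := by
  refine ContinuousLinearMap.opNorm_le_bound _ hC fun x => ?_
  have h1 := h (T x) x
  rw [inner_self_eq_norm_sq_to_K, norm_pow, RCLike.norm_ofReal, abs_norm] at h1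
  rcases (norm_nonneg (T x)).eq_or_lt with h0 | h0
  · rw [← h0]; positivity
  · refine le_of_mul_le_mul_right ?_ h0
    linarith

variable {A : Type u} [CStarAlgebra A] [PartialOrder A] [StarOrderedRing A]
  {B : Type v} [CStarAlgebra B] [PartialOrder B] [StarOrderedRing B]

theorem vectorForm_nonneg {n : ℕ} (π : B →⋆ₙₐ[ℂ] (G →L[ℂ] G)) (φ : A →CP B) (ξ : Fin n → G)
    {M : CStarMatrix (Fin n) (Fin n) A} (hM : 0 ≤ M) :
    0 ≤ vectorForm (starHomComp π φ).toLinearMap ξ M :=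
  sum_inner_nonneg π (CompletelyPositiveMapClass.map_cstarMatrix_nonneg' φ n M hM) ξ

theorem re_vectorForm_le {n : ℕ} (π : B →⋆ₐ[ℂ] (G →L[ℂ] G)) {f : A →ₗ[ℂ] (G →L[ℂ] G)}
    {φ : A →ₗ[ℂ] B} (hf : ∀ a, f a = π (φ a)) (hφ : IsCompletelyBounded φ) (ξ : Fin n → G)
    {M : CStarMatrix (Fin n) (Fin n) A} (hM : ‖M‖ ≤ 1) :
    (vectorForm f ξ M).re ≤ cbNorm φ * ∑ k, ‖ξ k‖ ^ 2 := by
  have h0 := hφ.norm_map_le_cbNorm hM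
  have h1 := sum_norm_sq_le π (M.map φ) ξ
  have h2 : (vectorForm f ξ M).re = ∑ k, (⟪ξ k, ∑ l, π (M.map φ k l) (ξ l)⟫_ℂ).re := by
    change (∑ k, ∑ l, ⟪ξ k, f (M k l) (ξ l)⟫_ℂ).re = _
    simp only [hf, ← inner_sum, Complex.re_sum]
    rfl
  rw [h2]
  calc _ ≤ ∑ k, ‖ξ k‖ * ‖∑ l, π (M.map φ k l) (ξ l)‖ :=
        Finset.sum_le_sum fun k _ => (Complex.re_le_norm _).trans (norm_inner_le_norm _ _)
    _ ≤ √(∑ k, ‖ξ k‖ ^ 2) * √(∑ k, ‖∑ l, π (M.map φ k l) (ξ l)‖ ^ 2) :=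
        Real.sum_mul_le_sqrt_mul_sqrt _ _ _
    _ ≤ √(∑ k, ‖ξ k‖ ^ 2) * √(‖M.map φ‖ ^ 2 * ∑ k, ‖ξ k‖ ^ 2) := by gcongr
    _ = ‖M.map φ‖ * ∑ k, ‖ξ k‖ ^ 2 := by
        rw [Real.sqrt_mul (sq_nonneg _), Real.sqrt_sq (norm_nonneg _), mul_left_comm,
          Real.mul_self_sqrt (Finset.sum_nonneg fun k _ => sq_nonneg _)]
    _ ≤ _ := by gcongr

/-- Compressed correlations are taken along the directed set of finite subsets `s` of `G`, with an
orthonormal basis of `span s`, and a weak limit is formed. -/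
theorem exists_isCorrelation_le_cbNorm (π : B →⋆ₐ[ℂ] (G →L[ℂ] G)) (φ₁ φ₂ : A →CP B)
    (hφ : IsCompletelyBounded (φ₁.toLinearMap - φ₂.toLinearMap)) :
    ∃ Ψ, IsCorrelation Ψ (starHomComp (π : B →⋆ₙₐ[ℂ] (G →L[ℂ] G)) φ₁).toLinearMap
      (starHomComp (π : B →⋆ₙₐ[ℂ] (G →L[ℂ] G)) φ₂).toLinearMap ∧
      ‖kernelDefect Ψ‖ ≤ cbNorm (φ₁.toLinearMap - φ₂.toLinearMap) := by
  let φ : Fin 2 → A →CP B := ![φ₁, φ₂]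
  let f : Fin 2 → A →ₗ[ℂ] (G →L[ℂ] G) := fun i =>
    (starHomComp (π : B →⋆ₙₐ[ℂ] (G →L[ℂ] G)) (φ i)).toLinearMap
  have hc0 : 0 ≤ cbNorm (φ₁.toLinearMap - φ₂.toLinearMap) :=
    (norm_nonneg _).trans hφ.norm_map_one_le_cbNorm
  let e : (s : Finset G) → Fin (Module.finrank ℂ (Submodule.span ℂ (s : Set G))) → G := fun s k =>
    (stdOrthonormalBasis ℂ (Submodule.span ℂ (s : Set G)) k : G)
  have he : ∀ s, Orthonormal ℂ (e s) := fun s =>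
    (stdOrthonormalBasis ℂ (Submodule.span ℂ (s : Set G))).orthonormal.comp_linearIsometry
      (Submodule.span ℂ (s : Set G)).subtypeₗᵢ
  have hproj : ∀ (s : Finset G), ∀ g ∈ s, ∑ k, ⟪e s k, g⟫_ℂ • e s k = g := fun s g hg => by
    have h := (stdOrthonormalBasis ℂ (Submodule.span ℂ (s : Set G))).sum_repr'
      ⟨g, Submodule.subset_span hg⟩
    simpa using congrArg Subtype.val h
  choose Φ hpos hdiag hdef using fun s => exists_compressed_correlation (f := f) hc0
    (fun i ξ M hM => vectorForm_nonneg _ (φ i) ξ hM)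
    (fun ξ M _ hM => re_vectorForm_le π (f := f 0 - f 1) (fun a => (map_sub π _ _).symm) hφ ξ hM)
    (he s)
  refine exists_isCorrelation_of_tendsto atTop hpos (C := ‖f 0 1‖ + ‖f 1 1‖) (fun s i => ?_)
    (φ := f) (fun i a g h => ?_) hdef tendsto_const_nhds
  · have hi : ‖f i 1‖ ≤ ‖f 0 1‖ + ‖f 1 1‖ := by
      rcases Fin.exists_fin_two.mp ⟨i, rfl⟩ with rfl | rfl
      · exact le_add_of_nonneg_right (norm_nonneg _)
      · exact le_add_of_nonneg_left (norm_nonneg _)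
    refine norm_le_of_forall_norm_inner_le (by positivity) fun g h => ?_
    rw [hdiag]
    refine (norm_inner_apply_le _ _ _).trans ?_
    gcongr
    · exact (he s).norm_sum_inner_smul_le g
    · exact (he s).norm_sum_inner_smul_le h
  -- Once `s` contains `g` and `h`, the projection fixes both and the coefficient is constant.
  · refine tendsto_const_nhds.congr' ?_
    filter_upwards [eventually_ge_atTop {g}, eventually_ge_atTop {h}] with s hg hh
    rw [hdiag, hproj s g (hg (Finset.mem_singleton_self g)),
      hproj s h (hh (Finset.mem_singleton_self h))]

end UpperBound

/-! ### Metric axioms, attainment and the final estimates. -/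

section Metric

variable {A : Type u} [CStarAlgebra A] [PartialOrder A] [StarOrderedRing A]
  {B : Type v} [CStarAlgebra B] [PartialOrder B] [StarOrderedRing B]

theorem bures_comm (φ₁ φ₂ : A →CP B) : bures φ₁ φ₂ = bures φ₂ φ₁ := by
  have h : ∀ ψ₁ ψ₂ : A →CP B, bures ψ₁ ψ₂ ≤ bures ψ₂ ψ₁ := fun ψ₁ ψ₂ => le_bures fun Φ hΦ => by
    have h' : IsCorrelation (fun i j => Φ (1 - i) (1 - j)) ψ₁.toLinearMap ψ₂.toLinearMap :=
      ⟨fun n i a => hΦ.pos n (fun k => 1 - i k) a, hΦ.snd, hΦ.fst⟩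
    refine h'.bures_le.trans (le_of_eq ?_)
    congr 2
    change Φ 1 1 1 - Φ 1 0 1 - Φ 0 1 1 + Φ 0 0 1 = Φ 0 0 1 - Φ 0 1 1 - Φ 1 0 1 + Φ 1 1 1
    abel
  exact le_antisymm (h _ _) (h _ _)

theorem bures_self (φ : A →CP B) : bures φ φ = 0 := by
  refine le_antisymm ?_ (bures_nonneg φ φ)
  have h : IsCorrelation (fun _ _ : Fin 2 => φ.toLinearMap) φ.toLinearMap φ.toLinearMap :=
    ⟨fun n i a => isPositiveKernel_diagonal (fun _ : Unit => φ) n (fun _ => ()) a, rfl, rfl⟩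
  refine h.bures_le.trans_eq ?_
  simp [kernelDefect]

section Operators

variable {G : Type v} [NormedAddCommGroup G] [InnerProductSpace ℂ G] [CompleteSpace G]

theorem bures_triangle_operators (φ₁ φ₂ φ₃ : A →CP (G →L[ℂ] G)) :
    bures φ₁ φ₃ ≤ bures φ₁ φ₂ + bures φ₂ φ₃ := by
  refine le_of_forall_pos_le_add fun ε hε => ?_
  obtain ⟨Φ, hΦ, h1⟩ := exists_isCorrelation_lt
    (lt_add_of_pos_right (bures φ₁ φ₂) (half_pos hε))
  obtain ⟨Ψ, hΨ, h2⟩ := exists_isCorrelation_lt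
    (lt_add_of_pos_right (bures φ₂ φ₃) (half_pos hε))
  obtain ⟨Θ, hΘ, h3⟩ := hΦ.trans hΨ
  have := hΘ.bures_le
  linarith

/-- Weak limit of a minimizing sequence; the diagonal entries are constant along it. -/
theorem exists_isCorrelation_le_bures_operators (φ₁ φ₂ : A →CP (G →L[ℂ] G)) :
    ∃ Φ, IsCorrelation Φ φ₁.toLinearMap φ₂.toLinearMap ∧
      ‖kernelDefect Φ‖ ≤ bures φ₁ φ₂ ^ 2 := by
  choose Φ hΦ hlt using fun n : ℕ => exists_isCorrelation_lt
    (lt_add_of_pos_right (bures φ₁ φ₂) (Nat.one_div_pos_of_nat (α := ℝ) (n := n)))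
  have hlim : Tendsto (fun n : ℕ => (bures φ₁ φ₂ + 1 / ((n : ℝ) + 1)) ^ 2) atTop
      (𝓝 (bures φ₁ φ₂ ^ 2)) := by
    simpa using (tendsto_one_div_add_atTop_nhds_zero_nat.const_add (bures φ₁ φ₂)).pow 2
  have hdiag : ∀ n i, Φ n i i = ![φ₁.toLinearMap, φ₂.toLinearMap] i := fun n i => by
    rcases Fin.exists_fin_two.mp ⟨i, rfl⟩ with rfl | rfl
    · exact (hΦ n).fst
    · exact (hΦ n).snd
  refine exists_isCorrelation_of_tendsto atTop (fun n => (hΦ n).pos) (C := ‖φ₁ 1‖ + ‖φ₂ 1‖)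
    (fun n i => ?_) (φ := ![φ₁.toLinearMap, φ₂.toLinearMap]) (fun i a g h => ?_) (fun n => ?_) hlim
  · rw [hdiag]
    rcases Fin.exists_fin_two.mp ⟨i, rfl⟩ with rfl | rfl
    · exact le_add_of_nonneg_right (norm_nonneg _)
    · exact le_add_of_nonneg_left (norm_nonneg _)
  · simp only [hdiag]
    exact tendsto_const_nhds
  · exact (Real.sqrt_le_left (by have := bures_nonneg φ₁ φ₂; positivity)).mp (hlt n).le

end Operators

namespace IsInjectiveCStarAlgebra

theorem bures_triangle (hB : IsInjectiveCStarAlgebra B) (φ₁ φ₂ φ₃ : A →CP B) :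
    bures φ₁ φ₃ ≤ bures φ₁ φ₂ + bures φ₂ φ₃ := by
  obtain ⟨G, _, _, _, π, hπ⟩ := exists_faithful_rep B
  simp only [hB.bures_eq (π : B →⋆ₙₐ[ℂ] (G →L[ℂ] G)) hπ]
  exact bures_triangle_operators _ _ _

theorem exists_isCorrelation_le_bures (hB : IsInjectiveCStarAlgebra B) (φ₁ φ₂ : A →CP B) :
    ∃ Φ, IsCorrelation Φ φ₁.toLinearMap φ₂.toLinearMap ∧ √‖kernelDefect Φ‖ ≤ bures φ₁ φ₂ := by
  obtain ⟨G, _, _, _, π, hπ⟩ := exists_faithful_rep B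
  obtain ⟨P, hP, hPπ⟩ := hB.exists_retraction (π : B →⋆ₙₐ[ℂ] (G →L[ℂ] G)) hπ
  obtain ⟨Φ, hΦ, hd⟩ := exists_isCorrelation_le_bures_operators
    (starHomComp (π : B →⋆ₙₐ[ℂ] (G →L[ℂ] G)) φ₁) (starHomComp (π : B →⋆ₙₐ[ℂ] (G →L[ℂ] G)) φ₂)
  rw [← hB.bures_eq (π : B →⋆ₙₐ[ℂ] (G →L[ℂ] G)) hπ] at hd
  have h1 : ∀ φ : A →CP B, P.toLinearMap ∘ₗ
      (starHomComp (π : B →⋆ₙₐ[ℂ] (G →L[ℂ] G)) φ).toLinearMap = φ.toLinearMap :=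
    fun φ => LinearMap.ext fun a => hPπ (φ a)
  have h := hΦ.map P
  rw [h1, h1] at h
  refine ⟨_, h, Real.sqrt_le_iff.mpr ⟨bures_nonneg φ₁ φ₂, ?_⟩⟩
  rw [kernelDefect_map]
  exact (hP _).trans hd

theorem exists_bures_eq_norm_sub (hB : IsInjectiveCStarAlgebra B) (φ₁ φ₂ : A →CP B) :
    ∃ E : HilbertBimodule.{u, v, max u v} A B,
      ∃ x₁ ∈ representingSet E φ₁, ∃ x₂ ∈ representingSet E φ₂,
        bures φ₁ φ₂ = buresIn E φ₁ φ₂ ∧ buresIn E φ₁ φ₂ = ‖x₁ - x₂‖ := by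
  obtain ⟨Φ, hΦ, hd⟩ := hB.exists_isCorrelation_le_bures φ₁ φ₂
  obtain ⟨E, x₁, h₁, x₂, h₂, hx⟩ := hΦ.exists_mem
  have h3 := bures_le_buresIn ⟨⟨x₁, h₁⟩, ⟨x₂, h₂⟩⟩
  have h4 := buresIn_le_norm_sub h₁ h₂
  rw [← hx] at hd
  exact ⟨E, x₁, h₁, x₂, h₂, by linarith, by linarith⟩

theorem eq_of_bures_eq_zero (hB : IsInjectiveCStarAlgebra B) {φ₁ φ₂ : A →CP B}
    (h : bures φ₁ φ₂ = 0) : φ₁ = φ₂ := by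
  obtain ⟨E, x₁, h₁, x₂, h₂, h3, h4⟩ := hB.exists_bures_eq_norm_sub φ₁ φ₂
  have hx : x₁ = x₂ := by rw [← sub_eq_zero, ← norm_eq_zero, ← h4, ← h3, h]
  subst hx
  exact DFunLike.ext _ _ fun a => (h₁ a).trans (h₂ a).symm

theorem bures_le_sqrt_cbNorm (hB : IsInjectiveCStarAlgebra B) (φ₁ φ₂ : A →CP B) :
    bures φ₁ φ₂ ≤ √(cbNorm (φ₁.toLinearMap - φ₂.toLinearMap)) := by
  obtain ⟨G, _, _, _, π, hπ⟩ := exists_faithful_rep B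
  obtain ⟨Φ, hΦ⟩ := exists_isCorrelation φ₁ φ₂
  obtain ⟨Ψ, hΨ, hd⟩ := exists_isCorrelation_le_cbNorm π φ₁ φ₂ hΦ.cb_estimates.2.2.1
  rw [hB.bures_eq (π : B →⋆ₙₐ[ℂ] (G →L[ℂ] G)) hπ]
  exact hΨ.bures_le.trans (Real.sqrt_le_sqrt hd)

/-- The Bures metric. -/
@[reducible]
noncomputable def buresMetricSpace (hB : IsInjectiveCStarAlgebra B) : MetricSpace (NonzeroCP A B) where
  dist φ₁ φ₂ := bures φ₁.1 φ₂.1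
  dist_self φ := bures_self φ.1
  dist_comm φ₁ φ₂ := bures_comm φ₁.1 φ₂.1
  dist_triangle φ₁ φ₂ φ₃ := hB.bures_triangle φ₁.1 φ₂.1 φ₃.1
  eq_of_dist_eq_zero h := Subtype.ext (hB.eq_of_bures_eq_zero h)

end IsInjectiveCStarAlgebra

end Metric

end

theorem corollary3p5 {A : Type u} [CStarAlgebra A] [PartialOrder A] [StarOrderedRing A]
    {B : Type v} [CStarAlgebra B] [PartialOrder B] [StarOrderedRing B]
    (hB : IsInjectiveCStarAlgebra B) :
    (∀ (G : Type v) [NormedAddCommGroup G] [InnerProductSpace ℂ G] [CompleteSpace G]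
      (π : B →⋆ₙₐ[ℂ] (G →L[ℂ] G)), Function.Injective π → ∀ φ₁ φ₂ : NonzeroCP A B,
        bures φ₁.1 φ₂.1 = bures (starHomComp π φ₁.1) (starHomComp π φ₂.1)) ∧
    (∃ _ : MetricSpace (NonzeroCP A B), ∀ φ₁ φ₂ : NonzeroCP A B,
        dist φ₁ φ₂ = bures φ₁.1 φ₂.1) ∧
    ∀ φ₁ φ₂ : NonzeroCP A B,
      (IsCompletelyBounded φ₁.1.toLinearMap ∧ IsCompletelyBounded φ₂.1.toLinearMap ∧
        IsCompletelyBounded (φ₁.1.toLinearMap - φ₂.1.toLinearMap)) ∧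
      cbNorm (φ₁.1.toLinearMap - φ₂.1.toLinearMap) /
          (√(cbNorm φ₁.1.toLinearMap) + √(cbNorm φ₂.1.toLinearMap)) ≤ bures φ₁.1 φ₂.1 ∧
      bures φ₁.1 φ₂.1 ≤ √(cbNorm (φ₁.1.toLinearMap - φ₂.1.toLinearMap)) ∧
      ∃ E : HilbertBimodule.{u, v, max u v} A B,
        ∃ x₁ ∈ representingSet E φ₁.1, ∃ x₂ ∈ representingSet E φ₂.1,
          bures φ₁.1 φ₂.1 = buresIn E φ₁.1 φ₂.1 ∧ buresIn E φ₁.1 φ₂.1 = ‖x₁ - x₂‖ := by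
  refine ⟨fun G _ _ _ π hπ φ₁ φ₂ => hB.bures_eq π hπ φ₁.1 φ₂.1,
    ⟨hB.buresMetricSpace, fun _ _ => rfl⟩, fun φ₁ φ₂ => ?_⟩
  -- An optimal correlation yields the lower estimate directly, without an `ε`.
  obtain ⟨Φ, hΦ, hd⟩ := hB.exists_isCorrelation_le_bures φ₁.1 φ₂.1
  obtain ⟨h1, h2, h3, h4⟩ := hΦ.cb_estimates
  refine ⟨⟨h1, h2, h3⟩, ?_, hB.bures_le_sqrt_cbNorm φ₁.1 φ₂.1,
    hB.exists_bures_eq_norm_sub φ₁.1 φ₂.1⟩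
  refine div_le_of_le_mul₀ (by positivity) (bures_nonneg _ _) (h4.trans ?_)
  gcongr
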